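/- **Setting.** All Hilbert spaces are finite dimensional. A *verifier* of a $k$-prover extended nonlocal (ENL) game acts on qubit registers $\hat C$ (sent by the provers), $\hat V$ (private, at least one qubit; its first qubit is the output qubit) and $\hat M=(\hat M_{ij})_{i\le k,\,j\le \ell}$ (messages). It is given by two circuits $C_Q,C_A$ of double Hadamard gates $H\otimes H$ and Toffoli gates; the gates of $C_Q$ touch $\hat M$ only through Toffoli gates with target in $\hat M$ and controls outside $\hat M$, and those of $C_A$ touch $\hat M$ only through Toffoli gates with controls in $\hat M$ and target outside $\hat M$. Its *protocol circuit* is the sequence of gates $g_1,\dots,g_p$ consisting of $C_Q$, all the gates $\mathrm{CTL}\text{-}Q_{ij}=|0\rangle\langle 0|_{\hat M_{ij}}\otimes 1+|1\rangle\langle 1|_{\hat M_{ij}}\otimes Q_{ij}$, all the gates $P_i$, all the gates $\mathrm{TGT}\text{-}A_{ij}=1\otimes\frac{1+A_{ij}}2+\sigma_X(\hat M_{ij})\otimes\frac{1-A_{ij}}2$, and $C_A$, where $Q_{ij},P_i,A_{ij}$ are placeholders for reflections (Hermitian operators of square $1$) on the private register $\mathsf P_i$ of prover $i$. Its size is the number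 $p$ of gates, and we assume that $p$ is at least the number of wires (the qubits of $\hat C\hat V\hat M$ and one wire per prover). A *normal form strategy* is a state on $\hat C\mathsf P_1\cdots\mathsf P_k\mathsf R$ ($\mathsf R$ a reference register) with a choice of all these reflections; its value is the probability that the output qubit is measured to be $1$ after the protocol circuit is run with $\hat V\hat M$ initialized to $|0\rangle$. A *measurement strategy* is such a state with a POVM on $\mathsf P_i$ for each question to prover $i$; its value is the acceptance probability when the verifier applies $C_Q$, measures $\hat M$ to obtain the questions $q_i\in\{0,1\}^\ell$, puts the provers' answers $a_i\in\{0,1\}^\ell$ in $\hat M$, applies $C_A$, and measures the output qubit. The value $\omega^*$ of the game is the supremum of the values of all strategies of both kinds. A *gate Turing machine* (GTM) for a family $\{\mathfrak G_n\}$ of $k$-prover ENL games is a deterministic polynomial-time Turing machine that on input $(n,t)$ in binary returns the description (type and wires) of the $t$-th gate of the protocol circuit of $\mathfrak G_n$ (an error symbol if there is none), and on input $(1^n,-1)$ returns its size $p(n)$. **The game $\mathfrak G^\sharp_{H,n}$.** Let $N=2^n$, $p=p(N)$, let $g_1,\dots,g_p$ be the protocol circuit of $\mathfrak G_N$, and $S=p$.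 There are $k+1$ provers: the Pauli prover $PV$, and $PP_1,\dots,PP_k$. The verifier receives a clock register $\mathsf C$ with basis $|0\rangle,\dots,|p\rangle$. Questions to $PV$ are tuples of at most three commuting $S$-qubit Pauli observables, each acting nontrivially on at most two qubits, answered by one bit per observable; questions to $PP_i$ are $\star$, $Q_{ij}$, $A_{ij}$ or $\bot$ (no question), answered by one bit. The qubits of $\hat C\hat V\hat M$ are identified with the first qubits of $PV$. The verifier runs each of the following with probability $1/3$ (provers that are not mentioned receive no question). * *Gate Check.* Pick $t\in\{1,\dots,p\}$ uniformly; measure $\mathsf C$ with $\{|+_t\rangle\langle +_t|,|-_t\rangle\langle -_t|,\text{rest}\}$, where $|\pm_t\rangle=\frac1{\sqrt2}(|t-1\rangle\pm|t\rangle)$, with outcome $s\in\{0,1,2\}$; accept if $s=2$. Pick a uniform bit $\alpha$. If $g_t$ is a double Hadamard gate on qubits $u_1,u_2$, ask $PV$ for $(X_{u_1}X_{u_2},Z_{u_1}Z_{u_2})$ if $\alpha=0$ and for $(X_{u_1}Z_{u_2},Z_{u_1}X_{u_2})$ if $\alpha=1$, and reject iff $s\oplus a_1=s\oplus a_2=1$.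 For the other types accept if $\alpha=1$, and if $\alpha=0$: if $g_t$ is a Toffoli gate with controls $u_1,u_2$ and target $u_3$, ask $PV$ for $(Z_{u_1},Z_{u_2},X_{u_3})$ and reject iff ($a_1=a_2=1$ and $s\oplus a_3=1$) or ($a_1a_2=0$ and $s=1$); if $g_t=\mathrm{CTL}\text{-}Q_{ij}$, ask $PV$ for $Z$ on $\hat M_{ij}$ and $PP_i$ the question $Q_{ij}$, and reject iff ($a_V=1$ and $s\oplus a_{P,i}=1$) or ($a_V=0$ and $s=1$); if $g_t=\mathrm{TGT}\text{-}A_{ij}$, ask $PV$ for $X$ on $\hat M_{ij}$ and $PP_i$ the question $A_{ij}$, and reject iff ($a_{P,i}=1$ and $s\oplus a_V=1$) or ($a_{P,i}=0$ and $s=1$); if $g_t=P_i$, ask $PP_i$ the question $\star$ and reject iff $a_{P,i}\ne s$. * *Input Check.* Measure $\mathsf C$ in the basis $|0\rangle,\dots,|p\rangle$; if the outcome is not $0$, accept. Otherwise pick a uniformly random qubit of $\hat V\hat M$, ask $PV$ for $Z$ on it, and accept iff the answer is $0$. * *Output Check.* Measure $\mathsf C$ in the basis $|0\rangle,\dots,|p\rangle$;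 if the outcome is not $p$, accept. Otherwise ask $PV$ for $Z$ on the output qubit and accept iff the answer is $1$. A measurement strategy for this game (a state on $\mathsf C$, the $k+1$ provers' registers and a reference register, and a POVM for each question to each prover) is an *honest Pauli strategy* if the register of $PV$ consists of $S$ qubits and $PV$ answers every question by measuring the requested commuting observables. Let $\omega^*_{\mathcal S}(\mathfrak G^\sharp_{H,n})$ be its acceptance probability. **Lemma.** There are universal constants $\alpha\ge1$ and $\beta>0$ such that for every $k$, every GTM for a family $\{\mathfrak G_n\}$ of $k$-prover ENL games, and every integer $n\ge1$, with $N=2^n$: 1. (Completeness) For every $\gamma>0$ there is an honest Pauli strategy $\mathcal S$ with $$\omega^*_{\mathcal S}(\mathfrak G^\sharp_{H,n})\ \ge\ 1-\frac{1-\omega^*(\mathfrak G_N)+\gamma}{p(N)+1},$$ and $\mathcal S$ can be chosen with equality if $\gamma\le\omega^*(\mathfrak G_N)$. 2. (Soundness) Every honest Pauli strategy $\mathcal S$ satisfies $$\omega^*_{\mathcal S}(\mathfrak G^\sharp_{H,n})\ \le\ 1-\Big(\frac{1-\omega^*(\mathfrak G_N)}{\beta\,p(N)}\Big)^{\alpha}.$$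 -/

import Mathlib

open scoped Kronecker Matrix ComplexOrder

namespace ENL

noncomputable section

/-! ## Operators on tensor products -/

/-- The tensor product `⨂ i, A i` of one operator per site. -/
def tensor {ι : Type} [Fintype ι] {d : ι → Type} (A : ∀ i, Matrix (d i) (d i) ℂ) :
    Matrix (∀ i, d i) (∀ i, d i) ℂ :=
  Matrix.of fun x y => ∏ i, A i (x i) (y i)

/-- The operator `A` acting on site `i`, and trivially on all the other sites. -/
def onSite {ι : Type} [Fintype ι] [DecidableEq ι] {d : ι → Type} [∀ i, DecidableEq (d i)]
    (i : ι) (A : Matrix (d i) (d i) ℂ) : Matrix (∀ i, d i) (∀ i, d i) ℂ :=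
  tensor (Function.update (fun j => (1 : Matrix (d j) (d j) ℂ)) i A)

/-- A reflection: a Hermitian operator that squares to the identity. -/
def IsReflection {d : Type} [Fintype d] [DecidableEq d] (A : Matrix d d ℂ) : Prop :=
  A.IsHermitian ∧ A * A = 1

/-! ## Pauli observables -/

/-- Labels of the single-qubit Pauli observables. -/
inductive Pauli
  | I | X | Y | Z
  deriving DecidableEq

/-- The `2 × 2` Pauli matrices; `false` stands for the basis state `|0⟩`, `true` for `|1⟩`. -/
def Pauli.mat : Pauli → Matrix Bool Bool ℂ
  | .I => 1
  | .X => Matrix.of fun a b => if a = b then 0 else 1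
  | .Y => Matrix.of fun a b => if a = b then 0 else if a then Complex.I else -Complex.I
  | .Z => Matrix.of fun a b => if a = b then (if a then -1 else 1) else 0

/-- The `S`-qubit Pauli observable `⨂ i, σ_{W i}`. -/
def pauliOp {S : ℕ} (W : Fin S → Pauli) : Matrix (Fin S → Bool) (Fin S → Bool) ℂ :=
  tensor fun i => (W i).mat

/-- The sign `ε` with `σ_a σ_b = ε σ_b σ_a`. -/
def Pauli.sign : Pauli → Pauli → ℂ
  | .I, _ => 1
  | _, .I => 1
  | .X, .X => 1
  | .Y, .Y => 1
  | .Z, .Z => 1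
  | _, _ => -1

theorem Pauli.mat_mul_mat (a b : Pauli) : a.mat * b.mat = Pauli.sign a b • (b.mat * a.mat) := by
  cases a <;> cases b <;> ext x y <;> cases x <;> cases y <;>
    simp [Pauli.mat, Pauli.sign, Matrix.mul_apply]

theorem tensor_mul {ι : Type} [Fintype ι] [DecidableEq ι] {d : ι → Type} [∀ i, Fintype (d i)]
    (A B : ∀ i, Matrix (d i) (d i) ℂ) : tensor A * tensor B = tensor fun i => A i * B i := by
  ext x z
  simp only [tensor, Matrix.mul_apply, Matrix.of_apply, ← Finset.prod_mul_distrib]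
  rw [Finset.prod_univ_sum, Fintype.piFinset_univ]

theorem pauliOp_commute {S : ℕ} (W W' : Fin S → Pauli)
    (h : ∏ i, Pauli.sign (W i) (W' i) = 1) : Commute (pauliOp W) (pauliOp W') := by
  unfold Commute SemiconjBy pauliOp
  rw [tensor_mul, tensor_mul]
  ext x y
  simp only [tensor, Matrix.of_apply, fun i => Pauli.mat_mul_mat (W i) (W' i), Matrix.smul_apply, smul_eq_mul,
    Finset.prod_mul_distrib, h, one_mul]

/-- The label of `σ_P` on qubit `u`. -/
def pauliOne {S : ℕ} (u : Fin S) (P : Pauli) : Fin S → Pauli :=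
  Function.update (fun _ => Pauli.I) u P

/-- The label of `σ_P ⊗ σ_P'` on qubits `u` and `v`. -/
def pauliTwo {S : ℕ} (u : Fin S) (P : Pauli) (v : Fin S) (P' : Pauli) : Fin S → Pauli :=
  Function.update (pauliOne u P) v P'

/-- The weight: the number of qubits on which the observable acts nontrivially. -/
def weight {S : ℕ} (W : Fin S → Pauli) : ℕ := (Finset.univ.filter fun i => W i ≠ Pauli.I).card

theorem weight_two_le {S : ℕ} (u : Fin S) (P : Pauli) (v : Fin S) (P' : Pauli) :
    weight (pauliTwo u P v P') ≤ 2 := by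
  have hsub : (Finset.univ.filter fun i => pauliTwo u P v P' i ≠ Pauli.I) ⊆ {u, v} := by
    intro i hi
    simp only [Finset.mem_filter, Finset.mem_univ, true_and] at hi
    by_contra hne
    simp only [Finset.mem_insert, Finset.mem_singleton, not_or] at hne
    exact hi (by simp [pauliTwo, pauliOne, Function.update_of_ne, hne.1, hne.2])
  exact (Finset.card_le_card hsub).trans Finset.card_le_two

theorem weight_one_le {S : ℕ} (u : Fin S) (P : Pauli) : weight (pauliOne u P) ≤ 2 := by
  have h := weight_two_le u P u P
  simpa [pauliTwo, pauliOne] using h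

theorem commute_one_one {S : ℕ} {u v : Fin S} (P P' : Pauli) (huv : u ≠ v) :
    Commute (pauliOp (pauliOne u P)) (pauliOp (pauliOne v P')) := by
  refine pauliOp_commute _ _ (Finset.prod_eq_one fun i _ => ?_)
  by_cases hu : i = u
  · subst hu
    rw [pauliOne, pauliOne, Function.update_self, Function.update_of_ne huv]
    cases P <;> rfl
  · rw [pauliOne, Function.update_of_ne hu]
    rfl

theorem commute_two_two {S : ℕ} {u v : Fin S} (P₁ P₂ P₁' P₂' : Pauli) (huv : u ≠ v)
    (h : Pauli.sign P₁ P₁' * Pauli.sign P₂ P₂' = 1) :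
    Commute (pauliOp (pauliTwo u P₁ v P₂)) (pauliOp (pauliTwo u P₁' v P₂')) := by
  refine pauliOp_commute _ _ ?_
  rw [Finset.prod_eq_mul u v huv]
  · simpa [pauliTwo, pauliOne, Function.update_of_ne huv] using h
  · intro i _ hi
    simp [pauliTwo, pauliOne, Function.update_of_ne hi.1, Function.update_of_ne hi.2, Pauli.sign]
  · simp
  · simp

/-- A question to the Pauli prover: a set of labels of at most three pairwise commuting `S`-qubit
Pauli observables, each of which acts nontrivially on at most two qubits. -/
structure PauliQuestion (S : ℕ) where
  num : ℕ
  num_le : num ≤ 3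
  obs : Fin num → (Fin S → Pauli)
  weight_le : ∀ j, weight (obs j) ≤ 2
  commute : ∀ j j', Commute (pauliOp (obs j)) (pauliOp (obs j'))

/-- No question is asked to the Pauli prover. -/
def PauliQuestion.none (S : ℕ) : PauliQuestion S where
  num := 0
  num_le := by omega
  obs := Fin.elim0
  weight_le := fun j => j.elim0
  commute := fun j => j.elim0

/-- The question consisting of the single observable `σ_P` on qubit `u`. -/
def PauliQuestion.one {S : ℕ} (u : Fin S) (P : Pauli) : PauliQuestion S where
  num := 1
  num_le := by omega
  obs := fun _ => pauliOne u P
  weight_le := fun _ => weight_one_le u P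
  commute := fun _ _ => Commute.refl _

/-- The question `(Z_u, Z_v, X_w)`. -/
def PauliQuestion.zzx {S : ℕ} (u v w : Fin S) (huv : u ≠ v) (huw : u ≠ w) (hvw : v ≠ w) :
    PauliQuestion S where
  num := 3
  num_le := le_rfl
  obs := ![pauliOne u .Z, pauliOne v .Z, pauliOne w .X]
  weight_le := by
    intro j
    fin_cases j <;> exact weight_one_le _ _
  commute := by
    intro j j'
    fin_cases j <;> fin_cases j' <;>
      first
      | exact Commute.refl _
      | exact commute_one_one _ _ huv
      | exact commute_one_one _ _ huw
      | exact commute_one_one _ _ hvw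
      | exact commute_one_one _ _ huv.symm
      | exact commute_one_one _ _ huw.symm
      | exact commute_one_one _ _ hvw.symm

/-- The question `(X_u X_v, Z_u Z_v)`. -/
def PauliQuestion.xxzz {S : ℕ} (u v : Fin S) (huv : u ≠ v) : PauliQuestion S where
  num := 2
  num_le := by omega
  obs := ![pauliTwo u .X v .X, pauliTwo u .Z v .Z]
  weight_le := by
    intro j
    fin_cases j <;> exact weight_two_le _ _ _ _
  commute := by
    intro j j'
    fin_cases j <;> fin_cases j' <;>
      exact commute_two_two _ _ _ _ huv (by simp [Pauli.sign])

/-- The question `(X_u Z_v, Z_u X_v)`. -/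
def PauliQuestion.xzzx {S : ℕ} (u v : Fin S) (huv : u ≠ v) : PauliQuestion S where
  num := 2
  num_le := by omega
  obs := ![pauliTwo u .X v .Z, pauliTwo u .Z v .X]
  weight_le := by
    intro j
    fin_cases j <;> exact weight_two_le _ _ _ _
  commute := by
    intro j j'
    fin_cases j <;> fin_cases j' <;>
      exact commute_two_two _ _ _ _ huv (by simp [Pauli.sign])

/-- The joint measurement of the commuting observables of a question: the operator of the outcome
`a` is `∏ j, (1 + (-1)^{a j} σ_{W j}) / 2`. -/
def PauliQuestion.measure {S : ℕ} (q : PauliQuestion S) (a : Fin q.num → Bool) :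
    Matrix (Fin S → Bool) (Fin S → Bool) ℂ :=
  ((List.finRange q.num).map fun j =>
    (2⁻¹ : ℂ) • (1 + (if a j then (-1 : ℂ) else 1) • pauliOp (q.obs j))).prod

/-! ## Extended nonlocal games and measurement strategies -/

/-- The verifier of an extended nonlocal game with provers `ι`, whose quantum register (received
from the provers in the first message) has basis `C`, with questions `Q i` to prover `i` and
answers `A i q` to the question `q`.

`Branch` is the classical record the verifier holds when sending the questions (coins, outcomes of
measurements made on `C`), and determines the questions. `accept b a` is the effect (positive
operator on `C`) of the event that the verifier reaches `b` and, given the answers `a`, accepts. -/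
structure Game (ι C : Type) (Q : ι → Type) (A : ∀ i, Q i → Type) where
  Branch : Type
  [fintypeBranch : Fintype Branch]
  query : Branch → ∀ i, Q i
  accept : (b : Branch) → (∀ i, A i (query b i)) → Matrix C C ℂ

attribute [instance] Game.fintypeBranch

/-- A measurement strategy: finite-dimensional prover registers `P i` and a reference register
`R`, a unit vector on `C ⊗ P ⊗ R`, and for each question to prover `i` a POVM on `P i`. -/
structure MeasurementStrategy (ι C : Type) [Fintype ι] [DecidableEq ι] [Fintype C]
    (Q : ι → Type) (A : ∀ i, Q i → Type) [∀ i q, Fintype (A i q)] where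
  P : ι → Type
  [fintypeP : ∀ i, Fintype (P i)]
  [decEqP : ∀ i, DecidableEq (P i)]
  R : Type
  [fintypeR : Fintype R]
  [decEqR : DecidableEq R]
  ψ : C × (∀ i, P i) × R → ℂ
  norm_ψ : ∑ x, ‖ψ x‖ ^ 2 = 1
  M : ∀ i (q : Q i), A i q → Matrix (P i) (P i) ℂ
  posSemidef : ∀ i q a, (M i q a).PosSemidef
  sum_eq_one : ∀ i q, ∑ a, M i q a = 1

attribute [instance] MeasurementStrategy.fintypeP MeasurementStrategy.decEqP
  MeasurementStrategy.fintypeR MeasurementStrategy.decEqR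

/-- The value of a measurement strategy: the probability that the verifier accepts. -/
def MeasurementStrategy.value {ι C : Type} [Fintype ι] [DecidableEq ι] [Fintype C]
    {Q : ι → Type} {A : ∀ i, Q i → Type} [∀ i q, Fintype (A i q)]
    (s : MeasurementStrategy ι C Q A) (G : Game ι C Q A) : ℝ :=
  ∑ b : G.Branch, ∑ a : (∀ i, A i (G.query b i)),
    (star s.ψ ⬝ᵥ ((G.accept b a ⊗ₖ
      (tensor (fun i => s.M i (G.query b i) (a i)) ⊗ₖ (1 : Matrix s.R s.R ℂ))) *ᵥ s.ψ)).re

/-! ## Protocol circuits -/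

/-- The qubits of the verifier: the register `C` (received from the provers), the private register
`V`, and for each of the `k` provers a message register of `ℓ` qubits. -/
abbrev Wire (k nC nV ℓ : ℕ) : Type := Fin nC ⊕ Fin nV ⊕ (Fin k × Fin ℓ)

/-- Whether a qubit belongs to a message register. -/
def Wire.IsMsg {k nC nV ℓ : ℕ} : Wire k nC nV ℓ → Prop
  | .inr (.inr _) => True
  | _ => False

/-- The verifier's gates on a set `W` of qubits: double Hadamard gates, and Toffoli gates with
controls `u`, `v` and target `w`. -/
inductive VGate (W : Type)
  | hadamard (u v : W) (huv : u ≠ v)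
  | toffoli (u v w : W) (huv : u ≠ v) (huw : u ≠ w) (hvw : v ≠ w)

/-- An operator on a single qubit. -/
def onQubit {W : Type} [Fintype W] [DecidableEq W] (u : W) (A : Matrix Bool Bool ℂ) :
    Matrix (W → Bool) (W → Bool) ℂ :=
  onSite (d := fun _ : W => Bool) u A

/-- The Hadamard matrix. -/
def hadamardMat : Matrix Bool Bool ℂ :=
  Matrix.of fun a b => (if a && b then -1 else 1) * ((√2 : ℝ) : ℂ)⁻¹

/-- The projector `|b⟩⟨b|` on a qubit. -/
def proj (b : Bool) : Matrix Bool Bool ℂ := Matrix.single b b 1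

/-- The unitary of a verifier gate. -/
def VGate.op {W : Type} [Fintype W] [DecidableEq W] : VGate W → Matrix (W → Bool) (W → Bool) ℂ
  | .hadamard u v _ => onQubit u hadamardMat * onQubit v hadamardMat
  | .toffoli u v w _ _ _ =>
      1 - onQubit u (proj true) * onQubit v (proj true) * (1 - onQubit w Pauli.X.mat)

/-- The unitary of a list of verifier gates; the first gate of the list is applied first. -/
def circuitOp {W : Type} [Fintype W] [DecidableEq W] (l : List (VGate W)) :
    Matrix (W → Bool) (W → Bool) ℂ :=
  l.foldl (fun U g => g.op * U) 1

/-- The gates of a query circuit touch the message registers only by flipping message qubits,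
controlled on other qubits. -/
def VGate.IsQueryGate {k nC nV ℓ : ℕ} : VGate (Wire k nC nV ℓ) → Prop
  | .hadamard u v _ => ¬ u.IsMsg ∧ ¬ v.IsMsg
  | .toffoli u v _ _ _ _ => ¬ u.IsMsg ∧ ¬ v.IsMsg

/-- The gates of an answer circuit touch the message registers only by using message qubits as
controls. -/
def VGate.IsAnswerGate {k nC nV ℓ : ℕ} : VGate (Wire k nC nV ℓ) → Prop
  | .hadamard u v _ => ¬ u.IsMsg ∧ ¬ v.IsMsg
  | .toffoli _ _ w _ _ _ => ¬ w.IsMsg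

/-- The gates of a protocol circuit: verifier gates, the communication gates `CTL-Q_ij` and
`TGT-A_ij`, and the prover reflection gates `P_i`. -/
inductive Gate (W : Type) (k ℓ : ℕ)
  | verifier (g : VGate W)
  | query (i : Fin k) (j : Fin ℓ)
  | answer (i : Fin k) (j : Fin ℓ)
  | reflect (i : Fin k)

/-- The verifier `(C_Q, C_A)` of a `k`-prover extended nonlocal game, with questions and answers
of `ℓ` bits. -/
structure Verifier (k : ℕ) where
  nC : ℕ
  nV : ℕ
  ℓ : ℕ
  nV_pos : 0 < nV
  queryCircuit : List (VGate (Wire k nC nV ℓ))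
  answerCircuit : List (VGate (Wire k nC nV ℓ))
  query_classical : ∀ g ∈ queryCircuit, g.IsQueryGate
  answer_classical : ∀ g ∈ answerCircuit, g.IsAnswerGate

namespace Verifier

variable {k : ℕ} (c : Verifier k)

/-- The qubits the verifier acts on. -/
abbrev W : Type := Wire k c.nC c.nV c.ℓ

/-- The output qubit is the first qubit of `V`. -/
def outWire : c.W := .inr (.inl ⟨0, c.nV_pos⟩)

/-- The message qubit `M_ij`. -/
def msgWire (i : Fin k) (j : Fin c.ℓ) : c.W := .inr (.inr (i, j))

/-- The gates of the protocol circuit, in order: `C_Q`, all `CTL-Q_ij`, all `P_i`, all `TGT-A_ij`,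
`C_A`. -/
def gates : List (Gate c.W k c.ℓ) :=
  c.queryCircuit.map .verifier
    ++ (List.finRange k).flatMap (fun i => (List.finRange c.ℓ).map (.query i))
    ++ (List.finRange k).map .reflect
    ++ (List.finRange k).flatMap (fun i => (List.finRange c.ℓ).map (.answer i))
    ++ c.answerCircuit.map .verifier

/-- The number of gates of the protocol circuit. -/
def size : ℕ := c.gates.length

/-- The number of verifier wires. -/
def numVerifierWires : ℕ := c.nC + (c.nV + k * c.ℓ)

end Verifier

/-- A `k`-prover protocol circuit. Its number of gates is at least its number of wires (the
verifier's qubits and one wire for each prover); any circuit is brought to this form by adding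
two idle qubits to `V` and pairs of double Hadamard gates that act on them. -/
structure ProtocolCircuit (k : ℕ) extends Verifier k where
  wires_le_size : toVerifier.numVerifierWires + k ≤ toVerifier.size

namespace ProtocolCircuit

variable {k : ℕ} (c : ProtocolCircuit k)

/-- The position of a verifier wire in the list of all the verifier's qubits, ordered as
`C`, `V`, `M`. -/
def indEquiv : c.W ≃ Fin c.numVerifierWires :=
  (Equiv.sumCongr (Equiv.refl _)
    ((Equiv.sumCongr (Equiv.refl _) finProdFinEquiv).trans finSumFinEquiv)).trans finSumFinEquiv

/-- The same position, among `S = p` qubits, where `p` is the size of the circuit. -/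
def ind (w : c.W) : Fin c.size :=
  Fin.castLE ((Nat.le_add_right _ _).trans c.wires_le_size) (c.indEquiv w)

theorem ind_ne {u v : c.W} (h : u ≠ v) : c.ind u ≠ c.ind v := by
  intro e
  exact h (c.indEquiv.injective (Fin.castLE_injective _ e))

/-- The description of a gate: its type and its wires. -/
def describe : Gate c.W k c.ℓ → List ℕ
  | .verifier (.hadamard u v _) => [0, c.indEquiv u, c.indEquiv v]
  | .verifier (.toffoli u v w _ _ _) => [1, c.indEquiv u, c.indEquiv v, c.indEquiv w]
  | .query i j => [2, i, j]
  | .answer i j => [3, i, j]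
  | .reflect i => [4, i]

/-- The description of the `t`-th gate (`1 ≤ t ≤ p`), and the error symbol `[]` for the other
values of `t`. -/
def describeAt : ℕ → List ℕ
  | 0 => []
  | t + 1 => (c.gates[t]?).elim [] c.describe

end ProtocolCircuit

/-! ## Gate Turing machines -/

/-- Lists of natural numbers as strings: binary expansions, each followed by a comma. -/
def encodeNats (l : List ℕ) : List Computability.Γ' :=
  l.flatMap fun n => (Computability.encodeNat n).map .bit ++ [.comma]

/-- The inputs of a gate Turing machine: `(n, t)`, with both numbers in binary, or
`(1^n, -1)`, with the symbol `bra` as the flag `-1`. -/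
def encodeInput : (ℕ × ℕ) ⊕ ℕ → List Computability.Γ'
  | .inl (n, t) => encodeNats [n, t]
  | .inr n => .bra :: List.replicate n (.bit true)

/-- A gate Turing machine for a family of `k`-prover extended nonlocal games: a polynomial-time
Turing machine that on input `(n, t)` returns the description of the `t`-th gate of the `n`-th
protocol circuit (or an error symbol), and on input `(1^n, -1)` returns the size of this circuit. -/
structure GTM (k : ℕ) where
  circuit : ℕ → ProtocolCircuit k
  machine : Turing.TM2ComputableInPolyTime encodeInput encodeNats
    (Sum.elim (fun x => (circuit x.1).describeAt x.2) (fun n => [(circuit n).size]))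

/-! ## The value of the game of a protocol circuit -/

/-- A normal form strategy: a shared unit vector on `C ⊗ P ⊗ R` and reflections `Q i j`, `P i`,
`A i j` on the register of prover `i`. -/
structure NormalFormStrategy {k : ℕ} (c : Verifier k) where
  D : Fin k → Type
  [fintypeD : ∀ i, Fintype (D i)]
  [decEqD : ∀ i, DecidableEq (D i)]
  R : Type
  [fintypeR : Fintype R]
  [decEqR : DecidableEq R]
  ψ : (Fin c.nC → Bool) × (∀ i, D i) × R → ℂ
  norm_ψ : ∑ x, ‖ψ x‖ ^ 2 = 1
  Q : ∀ i, Fin c.ℓ → Matrix (D i) (D i) ℂ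
  P : ∀ i, Matrix (D i) (D i) ℂ
  A : ∀ i, Fin c.ℓ → Matrix (D i) (D i) ℂ
  Q_refl : ∀ i j, IsReflection (Q i j)
  P_refl : ∀ i, IsReflection (P i)
  A_refl : ∀ i j, IsReflection (A i j)

attribute [instance] NormalFormStrategy.fintypeD NormalFormStrategy.decEqD
  NormalFormStrategy.fintypeR NormalFormStrategy.decEqR

namespace NormalFormStrategy

variable {k : ℕ} {c : Verifier k} (s : NormalFormStrategy c)

/-- The unitary of a gate, on the verifier's qubits and the provers' registers. -/
def gateOp : Gate c.W k c.ℓ → Matrix ((c.W → Bool) × (∀ i, s.D i)) ((c.W → Bool) × (∀ i, s.D i)) ℂ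
  | .verifier g => g.op ⊗ₖ 1
  | .query i j =>
      onQubit (c.msgWire i j) (proj false) ⊗ₖ 1
        + onQubit (c.msgWire i j) (proj true) ⊗ₖ onSite i (s.Q i j)
  | .answer i j =>
      1 ⊗ₖ ((2⁻¹ : ℂ) • (1 + onSite i (s.A i j)))
        + onQubit (c.msgWire i j) Pauli.X.mat ⊗ₖ ((2⁻¹ : ℂ) • (1 - onSite i (s.A i j)))
  | .reflect i => 1 ⊗ₖ onSite i (s.P i)

/-- The initial state: the shared state, with all the qubits of `V` and `M` set to `|0⟩`. -/
def initial : ((c.W → Bool) × (∀ i, s.D i)) × s.R → ℂ :=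
  fun x => if ∀ w, x.1.1 (.inr w) = false then s.ψ (fun i => x.1.1 (.inl i), x.1.2, x.2) else 0

/-- The state after all the gates of the protocol circuit have been applied. -/
def final : ((c.W → Bool) × (∀ i, s.D i)) × s.R → ℂ :=
  c.gates.foldl (fun v g => (s.gateOp g ⊗ₖ (1 : Matrix s.R s.R ℂ)) *ᵥ v) s.initial

/-- The value: the probability that measuring the output qubit at the end returns `1`. -/
def value : ℝ :=
  ∑ x, if x.1.1 c.outWire = true then ‖s.final x‖ ^ 2 else 0

end NormalFormStrategy

namespace Verifier

variable {k : ℕ} (c : Verifier k)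

/-- The inclusion of `C` in the verifier's space, with the qubits of `V` and `M` in state `|0⟩`. -/
def initMap : Matrix (c.W → Bool) (Fin c.nC → Bool) ℂ :=
  Matrix.of fun x y => if (∀ i, x (.inl i) = y i) ∧ ∀ w, x (.inr w) = false then 1 else 0

/-- The operator `|a⟩⟨q|` on the message registers. -/
def replaceMsg (q a : Fin k → Fin c.ℓ → Bool) : Matrix (c.W → Bool) (c.W → Bool) ℂ :=
  Matrix.of fun x y => if (∀ i j, y (c.msgWire i j) = q i j) ∧ (∀ i j, x (c.msgWire i j) = a i j)
    ∧ (∀ i, x (.inl i) = y (.inl i)) ∧ (∀ i, x (.inr (.inl i)) = y (.inr (.inl i))) then 1 else 0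

/-- The accepting Kraus operator: apply `C_Q`, send the questions `q`, receive the answers `a`,
apply `C_A`, and find the output qubit in state `|1⟩`. -/
def acceptKraus (q a : Fin k → Fin c.ℓ → Bool) : Matrix (c.W → Bool) (Fin c.nC → Bool) ℂ :=
  onQubit c.outWire (proj true) * circuitOp c.answerCircuit * c.replaceMsg q a
    * circuitOp c.queryCircuit * c.initMap

/-- The extended nonlocal game of the verifier `(C_Q, C_A)`. -/
def game : Game (Fin k) (Fin c.nC → Bool) (fun _ => Fin c.ℓ → Bool) (fun _ _ => Fin c.ℓ → Bool) where
  Branch := Fin k → Fin c.ℓ → Bool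
  query := fun q => q
  accept := fun q a => (c.acceptKraus q a)ᴴ * c.acceptKraus q a

/-- The value `ω*` of the game: the supremum of the values of all finite-dimensional strategies
(measurement strategies and normal form reflection strategies). -/
def omega : ℝ :=
  sSup ({v | ∃ s : MeasurementStrategy (Fin k) (Fin c.nC → Bool) (fun _ => Fin c.ℓ → Bool)
              (fun _ _ => Fin c.ℓ → Bool), v = s.value c.game}
    ∪ {v | ∃ s : NormalFormStrategy c, v = s.value})

end Verifier

/-! ## Honest Pauli Prover games -/

/-- The questions of a `(k+1)`-prover `S`-qubit Honest Pauli Prover game; `none` is the Pauli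
prover, and the other `k` provers have question set `Q`. -/
abbrev HPQuestion (k S : ℕ) (Q : Type) : Option (Fin k) → Type
  | none => PauliQuestion S
  | some _ => Q

/-- The answers: the Pauli prover answers one bit for each observable, and the other provers have
answer set `A`. -/
abbrev HPAnswer (k S : ℕ) (Q A : Type) : (i : Option (Fin k)) → HPQuestion k S Q i → Type
  | none, q => Fin (PauliQuestion.num q) → Bool
  | some _, _ => A

instance (k S : ℕ) (Q A : Type) [Fintype A] :
    (i : Option (Fin k)) → (q : HPQuestion k S Q i) → Fintype (HPAnswer k S Q A i q)
  | none, q => inferInstanceAs (Fintype (Fin (PauliQuestion.num q) → Bool))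
  | some _, _ => inferInstanceAs (Fintype A)

/-- A tuple of questions. -/
def hpQuery {k S : ℕ} {Q : Type} (qV : PauliQuestion S) (qP : Fin k → Q) :
    (i : Option (Fin k)) → HPQuestion k S Q i
  | none => qV
  | some i => qP i

/-- Strategies for the `(k+1)` provers of an `S`-qubit Honest Pauli Prover game. -/
abbrev HPStrategy (k S : ℕ) (C : Type) [Fintype C] (Q A : Type) [Fintype A] :=
  MeasurementStrategy (Option (Fin k)) C (HPQuestion k S Q) (HPAnswer k S Q A)

/-- An honest Pauli strategy: the register of the Pauli prover consists of `S` qubits, and this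
prover answers by measuring the observables specified by the question. -/
def HPStrategy.IsHonest {k S : ℕ} {C : Type} [Fintype C] {Q A : Type} [Fintype A]
    (s : HPStrategy k S C Q A) : Prop :=
  ∃ e : s.P none ≃ (Fin S → Bool), ∀ (q : PauliQuestion S) (a : Fin q.num → Bool),
    s.M none q a = (q.measure a).submatrix e e

/-! ## The verifier of the compressed game -/

/-- Questions to the provers other than the Pauli prover: the reflection `⋆`, the observables
`Q_ij` and `A_ij`, and no question `⊥`. -/
inductive ProverQuestion (ℓ : ℕ)
  | star
  | query (j : Fin ℓ)
  | answer (j : Fin ℓ)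
  | bot

/-- A test: questions to all the provers, and the acceptance predicate on the answers (one bit for
each observable from the Pauli prover, one bit from each other prover). -/
structure Test (S k ℓ : ℕ) where
  qV : PauliQuestion S
  qP : Fin k → ProverQuestion ℓ
  accept : (Fin qV.num → Bool) → (Fin k → Bool) → Bool

/-- Accept without asking any question. -/
def Test.acceptAll (S k ℓ : ℕ) : Test S k ℓ where
  qV := .none S
  qP := fun _ => .bot
  accept := fun _ _ => true

/-- The questions to the other provers when only prover `i` is asked a question. -/
def askOnly {k ℓ : ℕ} (i : Fin k) (q : ProverQuestion ℓ) : Fin k → ProverQuestion ℓ :=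
  fun i' => if i' = i then q else .bot

/-- Toffoli Check, when the coin is `0`. -/
def toffoliTest {S k ℓ : ℕ} (u v w : Fin S) (huv : u ≠ v) (huw : u ≠ w) (hvw : v ≠ w) (s : Bool) :
    Test S k ℓ where
  qV := .zzx u v w huv huw hvw
  qP := fun _ => .bot
  accept := fun (a : Fin 3 → Bool) _ =>
    !((a 0 && a 1 && (s ^^ a 2)) || (!(a 0 && a 1) && s))

/-- Hadamard Check, with coin `α`. -/
def hadamardTest {S k ℓ : ℕ} (u v : Fin S) (huv : u ≠ v) (s : Bool) : Bool → Test S k ℓ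
  | false =>
    { qV := .xxzz u v huv
      qP := fun _ => .bot
      accept := fun (a : Fin 2 → Bool) _ => !((s ^^ a 0) && (s ^^ a 1)) }
  | true =>
    { qV := .xzzx u v huv
      qP := fun _ => .bot
      accept := fun (a : Fin 2 → Bool) _ => !((s ^^ a 0) && (s ^^ a 1)) }

/-- Communication Channel Check for a gate `CTL-Q_ij`, when the coin is `0`; `u` is the index of
the qubit `M_ij`. -/
def queryTest {S k ℓ : ℕ} (u : Fin S) (i : Fin k) (j : Fin ℓ) (s : Bool) : Test S k ℓ where
  qV := .one u .Z
  qP := askOnly i (.query j)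
  accept := fun (a : Fin 1 → Bool) b => !((a 0 && (s ^^ b i)) || (!(a 0) && s))

/-- Communication Channel Check for a gate `TGT-A_ij`, when the coin is `0`; `u` is the index of
the qubit `M_ij`. -/
def answerTest {S k ℓ : ℕ} (u : Fin S) (i : Fin k) (j : Fin ℓ) (s : Bool) : Test S k ℓ where
  qV := .one u .X
  qP := askOnly i (.answer j)
  accept := fun (a : Fin 1 → Bool) b => !((b i && (s ^^ a 0)) || (!(b i) && s))

/-- Prover Reflection Check, when the coin is `0`. -/
def reflectTest {S k ℓ : ℕ} (i : Fin k) (s : Bool) : Test S k ℓ where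
  qV := .none S
  qP := askOnly i .star
  accept := fun _ b => b i == s

/-- The test that the output qubit or an input qubit `u` has value `b`. -/
def valueTest {S k ℓ : ℕ} (u : Fin S) (b : Bool) : Test S k ℓ where
  qV := .one u .Z
  qP := fun _ => .bot
  accept := fun (a : Fin 1 → Bool) _ => a 0 == b

namespace ProtocolCircuit

variable {k : ℕ} (c : ProtocolCircuit k)

/-- The test of Gate Check for the gate `g`, clock outcome `s` and coin `α`. -/
def gateTest (g : Gate c.W k c.ℓ) (s α : Bool) : Test c.size k c.ℓ :=
  match g with
  | .verifier (.hadamard u v huv) => hadamardTest (c.ind u) (c.ind v) (c.ind_ne huv) s α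
  | .verifier (.toffoli u v w huv huw hvw) =>
      if α then .acceptAll _ _ _
      else toffoliTest (c.ind u) (c.ind v) (c.ind w) (c.ind_ne huv) (c.ind_ne huw) (c.ind_ne hvw) s
  | .query i j => if α then .acceptAll _ _ _ else queryTest (c.ind (c.msgWire i j)) i j s
  | .answer i j => if α then .acceptAll _ _ _ else answerTest (c.ind (c.msgWire i j)) i j s
  | .reflect i => if α then .acceptAll _ _ _ else reflectTest i s

/-- The clock register has basis `{0, …, p}`. -/
abbrev Clock : Type := Fin (c.size + 1)

/-- The clock states `|+_t⟩` (`s = false`) and `|-_t⟩` (`s = true`), where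
`|±_t⟩ = (|t-1⟩ ± |t⟩) / √2`; the index `t : Fin p` stands for the time `t + 1`. -/
def clockPM (t : Fin c.size) (s : Bool) : c.Clock → ℂ :=
  fun x => (if x = t.castSucc then 1 else if x = t.succ then (if s then -1 else 1) else 0)
    * ((√2 : ℝ) : ℂ)⁻¹

/-- The projectors on `|+_t⟩` and `|-_t⟩`. -/
def clockProj (t : Fin c.size) (s : Bool) : Matrix c.Clock c.Clock ℂ :=
  Matrix.vecMulVec (c.clockPM t s) (star (c.clockPM t s))

/-- The measurement of the clock register in Gate Check; `none` is the third outcome. -/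
def clockEffect (t : Fin c.size) : Option Bool → Matrix c.Clock c.Clock ℂ
  | some s => c.clockProj t s
  | none => 1 - c.clockProj t false - c.clockProj t true

/-- The records of the compressed verifier: in Gate Check the time, the clock outcome and the coin;
in Input Check the clock outcome and the chosen qubit of `V` or `M`; in Output Check the clock
outcome. -/
abbrev HonestBranch : Type :=
  (Fin c.size × Option Bool × Bool)
    ⊕ (c.Clock × (Fin c.nV ⊕ (Fin k × Fin c.ℓ)))
    ⊕ c.Clock

/-- The effect, on the clock register, of reaching a branch. Each of the three checks is run with
probability `1/3`; times, coins and qubit indices are uniform. -/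
def honestEffect : c.HonestBranch → Matrix c.Clock c.Clock ℂ
  | .inl (t, s, _) => ((3⁻¹ : ℂ) * (c.size : ℂ)⁻¹ * 2⁻¹) • c.clockEffect t s
  | .inr (.inl (t, _)) => ((3⁻¹ : ℂ) * ((c.nV + k * c.ℓ : ℕ) : ℂ)⁻¹) • Matrix.single t t 1
  | .inr (.inr t) => (3⁻¹ : ℂ) • Matrix.single t t 1

/-- The test performed in a branch. -/
def honestTest : c.HonestBranch → Test c.size k c.ℓ
  | .inl (_, none, _) => .acceptAll _ _ _
  | .inl (t, some s, α) => c.gateTest (c.gates.get t) s α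
  | .inr (.inl (t, j)) => if t = 0 then valueTest (c.ind (.inr j)) false else .acceptAll _ _ _
  | .inr (.inr t) =>
      if t = Fin.last c.size then valueTest (c.ind c.outWire) true else .acceptAll _ _ _

/-- The `(k+1)`-prover Honest Pauli Prover game of the protocol circuit, on `S = p` qubits. -/
def honestPauliGame : Game (Option (Fin k)) c.Clock (HPQuestion k c.size (ProverQuestion c.ℓ))
    (HPAnswer k c.size (ProverQuestion c.ℓ) Bool) where
  Branch := c.HonestBranch
  query := fun b => hpQuery (c.honestTest b).qV (c.honestTest b).qP
  accept := fun b a =>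
    if (c.honestTest b).accept (a none) (fun i => a (some i)) then c.honestEffect b else 0

/-- Strategies for this game. -/
abbrev HonestStrategy : Type 1 := HPStrategy k c.size c.Clock (ProverQuestion c.ℓ) Bool

end ProtocolCircuit

end

end ENL

/-!
Both parts rest on one formula for the rejection probability of an honest Pauli strategy
(`HPStrategy.one_sub_value`). Let `φ t` be the component of the shared state at clock time `t`, and
let `G t` be the operator of the gate `t`, in which every reflection is replaced by the observable
(the difference of the two measurement operators) with which the prover answers the corresponding
question. The rejection probability is a positive combination of the propagation terms
`‖φ (t-1)‖² + ‖φ t‖² - 2 Re ⟨φ t, G t φ (t-1)⟩`, of the weights of `φ 0` on states in which a qubit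
of `V` or `M` is `|1⟩`, and of the weight of `φ p` on output `0`. The reason is that Gate Check
measures the observable `G t` (`HPStrategy.represents_gateTest`) and compares the outcome with the
sign of the clock state `|±⟩`. For a double Hadamard gate, this uses
`H ⊗ H = (XX + ZZ + XZ + ZX) / 2`, and that the products `XX · ZZ` and `XZ · ZX` of the observables
in the two questions cancel.

For soundness, Naimark's theorem (`exists_reflection_dilation`) turns the observables of the provers
into compressions of reflections on larger registers. As every gate is affine in a single observable
(`ProverOps.gateOp_submatrix`), the formula remains true when the components `φ t` are extended by
zero and the `G t` are replaced by unitary gates; the propagation terms become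
`‖φ t - G t φ (t-1)‖²`. Hence `φ t` stays close to the run of the protocol circuit that starts in
the projection of `φ 0` to the space of initial states (`norm_sub_le_add_sum`). The definition of
`ω*` bounds the weight of that run on output `0` from below by `1 - ω*` times its squared norm. As
the squared norms of the `p + 1` components sum to one, this norm is not small unless the components
are far from the run. This gives `1 - ω* ≤ 1000 p³ (1 - value)`.

For completeness, the history state of a normal form strategy of value `v` passes all tests but
Output Check, and is rejected with probability `(1 - v) / (3 (p + 1))`
(`NormalFormStrategy.rejection_history`). A basis state at time `0` with wrong input qubits is
rejected with probability at least `1 / 3`, and by continuity superpositions of the two attain every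
rejection probability in between.

Since `ω*` is defined with both kinds of strategies, measurement strategies have to be converted to
normal form strategies of the same value (`Verifier.exists_normalForm_value_eq`). Each prover copies
the question to a fresh register, applies a reflection that maps its register isometrically to the
Kraus operators of the POVM with the answer recorded next to them, and flips the message bits in
which the answer differs from the question. The questions and answers remain recorded, so that the
final state is an orthogonal sum over them of the accepting branches of the game.
-/

set_option linter.unusedSectionVars false
set_option linter.unusedSimpArgs false
set_option synthInstance.maxSize 1000

namespace ENL

/-! ### Operators on tensor products -/

section Tensor

variable {ι : Type} [Fintype ι] [DecidableEq ι] {d : ι → Type} [∀ i, Fintype (d i)]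
  [∀ i, DecidableEq (d i)]

theorem onSite_apply (i : ι) (A : Matrix (d i) (d i) ℂ) (x y : ∀ i, d i) :
    onSite i A x y = if ∀ j, j ≠ i → x j = y j then A (x i) (y i) else 0 := by
  unfold onSite tensor
  rw [Matrix.of_apply, ← Finset.mul_prod_erase _ _ (Finset.mem_univ i), Function.update_self]
  split_ifs with h
  · rw [Finset.prod_eq_one, mul_one]
    intro j hj
    rw [Function.update_of_ne (Finset.ne_of_mem_erase hj), h j (Finset.ne_of_mem_erase hj),
      Matrix.one_apply_eq]
  · push Not at h
    obtain ⟨j, hj, hne⟩ := h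
    rw [Finset.prod_eq_zero (i := j) (by simp [hj]), mul_zero]
    rw [Function.update_of_ne hj, Matrix.one_apply_ne hne]

theorem tensor_one : tensor (fun i => (1 : Matrix (d i) (d i) ℂ)) = 1 := by
  ext x y
  simp only [tensor, Matrix.of_apply, Matrix.one_apply]
  rw [Finset.prod_ite_zero]
  simp [funext_iff]

theorem onSite_one (i : ι) : onSite i (1 : Matrix (d i) (d i) ℂ) = 1 := by
  unfold onSite
  rw [← tensor_one]
  congr 1
  ext1 j
  by_cases h : j = i
  · subst h; simp
  · simp [h]

theorem onSite_mul (i : ι) (A B : Matrix (d i) (d i) ℂ) :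
    onSite i (A * B) = onSite i A * onSite i B := by
  unfold onSite
  rw [tensor_mul]
  congr 1
  ext1 j
  by_cases h : j = i
  · subst h; simp
  · simp [h]

theorem onSite_zero (i : ι) : onSite i (0 : Matrix (d i) (d i) ℂ) = 0 := by
  ext x y
  rw [onSite_apply]
  simp

theorem onSite_add (i : ι) (A B : Matrix (d i) (d i) ℂ) :
    onSite i (A + B) = onSite i A + onSite i B := by
  ext x y
  simp only [onSite_apply, Matrix.add_apply]
  split_ifs <;> simp

theorem onSite_smul (i : ι) (r : ℂ) (A : Matrix (d i) (d i) ℂ) :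
    onSite i (r • A) = r • onSite i A := by
  ext x y
  simp only [onSite_apply, Matrix.smul_apply]
  split_ifs <;> simp

theorem onSite_sub (i : ι) (A B : Matrix (d i) (d i) ℂ) :
    onSite i (A - B) = onSite i A - onSite i B := by
  ext x y
  simp only [onSite_apply, Matrix.sub_apply]
  split_ifs <;> simp

theorem onSite_conjTranspose (i : ι) (A : Matrix (d i) (d i) ℂ) :
    (onSite i A)ᴴ = onSite i Aᴴ := by
  ext x y
  simp only [onSite_apply, Matrix.conjTranspose_apply, eq_comm (a := y _)]
  split_ifs <;> simp

theorem onSite_mul_onSite_of_ne {i j : ι} (h : i ≠ j) (A : Matrix (d i) (d i) ℂ)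
    (B : Matrix (d j) (d j) ℂ) :
    onSite i A * onSite j B = tensor (Function.update (Function.update (fun _ => 1) i A) j B) := by
  unfold onSite
  rw [tensor_mul]
  congr 1
  ext1 l
  by_cases hi : l = i
  · subst hi; simp [h]
  · by_cases hj : l = j
    · subst hj; simp [hi]
    · simp [hi, hj]

theorem onSite_commute {i j : ι} (h : i ≠ j) (A : Matrix (d i) (d i) ℂ)
    (B : Matrix (d j) (d j) ℂ) : Commute (onSite i A) (onSite j B) := by
  unfold Commute SemiconjBy
  rw [onSite_mul_onSite_of_ne h, onSite_mul_onSite_of_ne h.symm, Function.update_comm h]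

/-- Multilinearity of the tensor product, summed over a family of outcomes at every site. -/
theorem sum_tensor {β : ι → Type} [∀ i, Fintype (β i)] (N : ∀ i, β i → Matrix (d i) (d i) ℂ) :
    ∑ b : ∀ i, β i, tensor (fun i => N i (b i)) = tensor fun i => ∑ b, N i b := by
  ext x y
  simp only [tensor, Matrix.of_apply, Matrix.sum_apply]
  rw [Finset.prod_univ_sum, Fintype.piFinset_univ]

theorem tensor_conjTranspose (A : ∀ i, Matrix (d i) (d i) ℂ) :
    (tensor A)ᴴ = tensor fun i => (A i)ᴴ := by
  ext x y
  simp [tensor, Matrix.conjTranspose_apply]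

end Tensor

/-! ### Reflections -/

section Reflection

variable {n m : Type} [Fintype n] [DecidableEq n] [Fintype m] [DecidableEq m]

theorem sub_kronecker (A A' : Matrix n n ℂ) (B : Matrix m m ℂ) :
    (A - A') ⊗ₖ B = A ⊗ₖ B - A' ⊗ₖ B := by
  ext x y; simp [sub_mul]

theorem kronecker_sub (A : Matrix n n ℂ) (B B' : Matrix m m ℂ) :
    A ⊗ₖ (B - B') = A ⊗ₖ B - A ⊗ₖ B' := by
  ext x y; simp [mul_sub]

theorem IsReflection.one : IsReflection (1 : Matrix n n ℂ) :=
  ⟨Matrix.isHermitian_one, mul_one 1⟩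

theorem IsReflection.kronecker {A : Matrix n n ℂ} {B : Matrix m m ℂ} (hA : IsReflection A)
    (hB : IsReflection B) : IsReflection (A ⊗ₖ B) := by
  refine ⟨?_, ?_⟩
  · rw [Matrix.IsHermitian, Matrix.conjTranspose_kronecker, hA.1.eq, hB.1.eq]
  · rw [← Matrix.mul_kronecker_mul, hA.2, hB.2, Matrix.one_kronecker_one]

theorem IsReflection.mul_of_commute {A B : Matrix n n ℂ} (hA : IsReflection A)
    (hB : IsReflection B) (h : Commute A B) : IsReflection (A * B) := by
  refine ⟨?_, ?_⟩
  · rw [Matrix.IsHermitian, Matrix.conjTranspose_mul, hA.1.eq, hB.1.eq, h.eq]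
  · rw [mul_assoc, ← mul_assoc B, ← h.eq, mul_assoc A B, hB.2, mul_one, hA.2]

theorem IsReflection.onSite {ι : Type} [Fintype ι] [DecidableEq ι] {d : ι → Type}
    [∀ i, Fintype (d i)] [∀ i, DecidableEq (d i)] {i : ι} {A : Matrix (d i) (d i) ℂ}
    (hA : IsReflection A) : IsReflection (ENL.onSite i A) := by
  refine ⟨?_, ?_⟩
  · rw [Matrix.IsHermitian, onSite_conjTranspose, hA.1.eq]
  · rw [← onSite_mul, hA.2, onSite_one]

/-- A reflection controlled by a commuting projector is a reflection. -/
theorem IsReflection.controlled {T A : Matrix n n ℂ} (hT : T.IsHermitian) (hT2 : T * T = T)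
    (hA : IsReflection A) (h : Commute T A) : IsReflection (1 - T * (1 - A)) := by
  have hc : A * T = T * A := h.eq.symm
  refine ⟨?_, ?_⟩
  · rw [Matrix.IsHermitian]
    simp only [Matrix.conjTranspose_sub, Matrix.conjTranspose_mul, Matrix.conjTranspose_one,
      hA.1.eq, hT.eq, sub_mul, mul_sub, one_mul, mul_one, hc]
  · have e : T * (1 - A) * (T * (1 - A)) = T * (1 - A) + T * (1 - A) := by
      have : T * (1 - A) * (T * (1 - A)) = T * ((1 - A) * T) * (1 - A) := by
        simp only [mul_assoc]
      rw [this, sub_mul, one_mul, hc, ← mul_one_sub, ← mul_assoc, hT2, mul_assoc]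
      rw [show (1 - A) * (1 - A) = (1 - A) + (1 - A) by
        rw [sub_mul, mul_sub, mul_sub, hA.2]; simp only [one_mul, mul_one]; abel, mul_add]
    generalize T * (1 - A) = B at e ⊢
    rw [sub_mul, mul_sub, mul_sub, e]
    simp only [one_mul, mul_one]
    abel

theorem IsReflection.star_mulVec {A : Matrix n n ℂ} (hA : IsReflection A) (u v : n → ℂ) :
    star (A *ᵥ u) ⬝ᵥ (A *ᵥ v) = star u ⬝ᵥ v := by
  rw [Matrix.star_mulVec, ← Matrix.dotProduct_mulVec, hA.1.eq, Matrix.mulVec_mulVec, hA.2,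
    Matrix.one_mulVec]

theorem Pauli.isReflection_mat (P : Pauli) : IsReflection P.mat := by
  constructor <;> cases P <;> ext a b <;> cases a <;> cases b <;>
    simp [Pauli.mat, Matrix.mul_apply, Matrix.conjTranspose_apply]

theorem hadamardMat_eq :
    hadamardMat = (((√2 : ℝ) : ℂ)⁻¹) • (Pauli.X.mat + Pauli.Z.mat) := by
  ext a b; cases a <;> cases b <;> simp [Pauli.mat, hadamardMat]

theorem inv_sqrt_two_sq : (((√2 : ℝ) : ℂ)⁻¹) * (((√2 : ℝ) : ℂ)⁻¹) = 2⁻¹ := by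
  rw [← mul_inv, ← Complex.ofReal_mul, Real.mul_self_sqrt (by norm_num)]; norm_num

theorem isReflection_hadamardMat : IsReflection hadamardMat := by
  refine ⟨?_, ?_⟩
  · ext a b; cases a <;> cases b <;> simp [hadamardMat, Matrix.conjTranspose_apply]
  · have h : (Pauli.X.mat + Pauli.Z.mat) * (Pauli.X.mat + Pauli.Z.mat) = (2 : ℂ) • 1 := by
      ext a b; cases a <;> cases b <;> simp [Pauli.mat, Matrix.mul_apply] <;> norm_num
    rw [hadamardMat_eq, Matrix.smul_mul, Matrix.mul_smul, smul_smul, h, smul_smul,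
      inv_sqrt_two_sq]
    norm_num

theorem proj_add : proj false + proj true = 1 := by
  ext a b; cases a <;> cases b <;> simp [proj, Matrix.single_apply]

theorem proj_eq (b : Bool) :
    proj b = (2⁻¹ : ℂ) • (1 + (if b then (-1 : ℂ) else 1) • Pauli.Z.mat) := by
  ext x y; cases b <;> cases x <;> cases y <;>
    simp [proj, Pauli.mat, Matrix.single_apply] <;> norm_num

theorem proj_isHermitian (b : Bool) : (proj b).IsHermitian := by
  ext x y; cases b <;> cases x <;> cases y <;>
    simp [proj, Matrix.conjTranspose_apply]

theorem proj_mul_self (b : Bool) : proj b * proj b = proj b := by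
  simp [proj]

end Reflection

/-! ### Qubit operators and the gates of the verifier -/

section Qubit

variable {W : Type} [Fintype W] [DecidableEq W]

theorem onQubit_commute {u v : W} (h : u ≠ v) (A B : Matrix Bool Bool ℂ) :
    Commute (onQubit u A) (onQubit v B) :=
  onSite_commute (d := fun _ : W => Bool) h A B

theorem onQubit_apply (u : W) (A : Matrix Bool Bool ℂ) (x y : W → Bool) :
    onQubit u A x y = if ∀ j, j ≠ u → x j = y j then A (x u) (y u) else 0 :=
  onSite_apply (d := fun _ : W => Bool) u A x y

theorem onQubit_mul (u : W) (A B : Matrix Bool Bool ℂ) :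
    onQubit u (A * B) = onQubit u A * onQubit u B :=
  onSite_mul (d := fun _ : W => Bool) u A B

theorem onQubit_one (u : W) : onQubit u (1 : Matrix Bool Bool ℂ) = 1 :=
  onSite_one (d := fun _ : W => Bool) u

theorem onQubit_add (u : W) (A B : Matrix Bool Bool ℂ) :
    onQubit u (A + B) = onQubit u A + onQubit u B :=
  onSite_add (d := fun _ : W => Bool) u A B

theorem onQubit_smul (u : W) (r : ℂ) (A : Matrix Bool Bool ℂ) :
    onQubit u (r • A) = r • onQubit u A :=
  onSite_smul (d := fun _ : W => Bool) u r A

theorem IsReflection.onQubit {A : Matrix Bool Bool ℂ} (hA : IsReflection A) (u : W) :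
    IsReflection (ENL.onQubit u A) :=
  IsReflection.onSite (d := fun _ : W => Bool) hA

theorem onQubit_proj (u : W) (b : Bool) :
    onQubit u (proj b) =
      (2⁻¹ : ℂ) • (1 + (if b then (-1 : ℂ) else 1) • onQubit u Pauli.Z.mat) := by
  rw [proj_eq, onQubit_smul, onQubit_add, onQubit_one, onQubit_smul]

theorem onQubit_proj_isHermitian (u : W) (b : Bool) : (onQubit u (proj b)).IsHermitian := by
  rw [Matrix.IsHermitian, onQubit, onSite_conjTranspose, (proj_isHermitian b).eq]

theorem onQubit_proj_mul_self (u : W) (b : Bool) :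
    onQubit u (proj b) * onQubit u (proj b) = onQubit u (proj b) := by
  rw [← onQubit_mul, proj_mul_self]

theorem onQubit_proj_false (u : W) : onQubit u (proj false) = 1 - onQubit u (proj true) := by
  rw [eq_sub_iff_add_eq, ← onQubit_add, proj_add, onQubit_one]

theorem VGate.op_isReflection (g : VGate W) : IsReflection g.op := by
  cases g with
  | hadamard u v huv =>
    exact (isReflection_hadamardMat.onQubit u).mul_of_commute (isReflection_hadamardMat.onQubit v)
      (onQubit_commute huv _ _)
  | toffoli u v w huv huw hvw =>
    refine IsReflection.controlled ?_ ?_ ((Pauli.isReflection_mat .X).onQubit _) ?_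
    · rw [Matrix.IsHermitian, Matrix.conjTranspose_mul, (onQubit_proj_isHermitian _ _).eq,
        (onQubit_proj_isHermitian _ _).eq, (onQubit_commute huv _ _).eq]
    · rw [mul_assoc, ← mul_assoc (onQubit v _), ← (onQubit_commute huv _ _).eq, mul_assoc,
        onQubit_proj_mul_self, ← mul_assoc, onQubit_proj_mul_self]
    · exact (onQubit_commute huw _ _).mul_left (onQubit_commute hvw _ _)

end Qubit

/-! ### The gates of the protocol circuit -/

/-- The observables of the provers: Hermitian operators in the place of the reflections of a
normal form strategy. -/
structure ProverOps {k : ℕ} (c : Verifier k) (D : Fin k → Type) where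
  Q : ∀ i, Fin c.ℓ → Matrix (D i) (D i) ℂ
  P : ∀ i, Matrix (D i) (D i) ℂ
  A : ∀ i, Fin c.ℓ → Matrix (D i) (D i) ℂ

namespace ProverOps

variable {k : ℕ} {c : Verifier k} {D : Fin k → Type} [∀ i, Fintype (D i)]
  [∀ i, DecidableEq (D i)]

/-- The operator of a gate when the provers use the given observables. -/
noncomputable def gateOp (o : ProverOps c D) :
    Gate c.W k c.ℓ → Matrix ((c.W → Bool) × (∀ i, D i)) ((c.W → Bool) × (∀ i, D i)) ℂ
  | .verifier g => g.op ⊗ₖ 1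
  | .query i j =>
      onQubit (c.msgWire i j) (proj false) ⊗ₖ 1
        + onQubit (c.msgWire i j) (proj true) ⊗ₖ onSite i (o.Q i j)
  | .answer i j =>
      1 ⊗ₖ ((2⁻¹ : ℂ) • (1 + onSite i (o.A i j)))
        + onQubit (c.msgWire i j) Pauli.X.mat ⊗ₖ ((2⁻¹ : ℂ) • (1 - onSite i (o.A i j)))
  | .reflect i => 1 ⊗ₖ onSite i (o.P i)

/-- All the observables are reflections. -/
structure IsReflective (o : ProverOps c D) : Prop where
  Q : ∀ i j, IsReflection (o.Q i j)
  P : ∀ i, IsReflection (o.P i)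
  A : ∀ i j, IsReflection (o.A i j)

theorem IsReflective.gateOp {o : ProverOps c D} (h : o.IsReflective) (g : Gate c.W k c.ℓ) :
    IsReflection (o.gateOp g) := by
  cases g with
  | verifier g => exact g.op_isReflection.kronecker .one
  | query i j =>
    have e : o.gateOp (.query i j) = 1 - (onQubit (c.msgWire i j) (proj true) ⊗ₖ 1) *
        (1 - 1 ⊗ₖ onSite i (o.Q i j)) := by
      rw [mul_sub, mul_one, ← Matrix.mul_kronecker_mul, mul_one, one_mul, ProverOps.gateOp,
        onQubit_proj_false, sub_kronecker, Matrix.one_kronecker_one]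
      abel
    rw [e]
    refine IsReflection.controlled ?_ ?_ (IsReflection.one.kronecker (h.Q i j).onSite) ?_
    · rw [Matrix.IsHermitian, Matrix.conjTranspose_kronecker, (onQubit_proj_isHermitian _ _).eq,
        Matrix.conjTranspose_one]
    · rw [← Matrix.mul_kronecker_mul, onQubit_proj_mul_self, one_mul]
    · simp [Commute, SemiconjBy, ← Matrix.mul_kronecker_mul]
  | answer i j =>
    have e : o.gateOp (.answer i j) =
        1 - (1 ⊗ₖ ((2⁻¹ : ℂ) • (1 - onSite i (o.A i j)))) *
          (1 - onQubit (c.msgWire i j) Pauli.X.mat ⊗ₖ 1) := by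
      have e1 : (2⁻¹ : ℂ) • (1 + onSite i (o.A i j)) =
          1 - (2⁻¹ : ℂ) • (1 - onSite i (o.A i j)) := by
        module
      rw [mul_sub, mul_one, ← Matrix.mul_kronecker_mul, mul_one, one_mul, ProverOps.gateOp, e1,
        kronecker_sub, Matrix.one_kronecker_one]
      abel
    have hA := (h.A i j).onSite (d := D)
    rw [e]
    refine IsReflection.controlled ?_ ?_
      (IsReflection.kronecker ((Pauli.isReflection_mat .X).onQubit _) .one) ?_
    · rw [Matrix.IsHermitian, Matrix.conjTranspose_kronecker, Matrix.conjTranspose_one,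
        Matrix.conjTranspose_smul, Matrix.conjTranspose_sub, hA.1.eq, Matrix.conjTranspose_one]
      simp
    · rw [← Matrix.mul_kronecker_mul, one_mul]
      congr 1
      rw [Matrix.smul_mul, Matrix.mul_smul, sub_mul, mul_sub, mul_sub, hA.2]
      simp only [one_mul, mul_one]
      module
    · simp [Commute, SemiconjBy, ← Matrix.mul_kronecker_mul, onQubit]
  | reflect i => exact IsReflection.one.kronecker (h.P i).onSite

end ProverOps

/-- The reflections of a normal form strategy. -/
def NormalFormStrategy.ops {k : ℕ} {c : Verifier k} (s : NormalFormStrategy c) :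
    ProverOps c s.D where
  Q := s.Q
  P := s.P
  A := s.A

theorem NormalFormStrategy.ops_isReflective {k : ℕ} {c : Verifier k} (s : NormalFormStrategy c) :
    s.ops.IsReflective := ⟨s.Q_refl, s.P_refl, s.A_refl⟩

theorem NormalFormStrategy.gateOp_eq {k : ℕ} {c : Verifier k} (s : NormalFormStrategy c)
    (g : Gate c.W k c.ℓ) : s.gateOp g = s.ops.gateOp g := by
  cases g <;> rfl

/-! ### The verifier's qubits inside the register of the Pauli prover -/

namespace ProtocolCircuit

variable {k : ℕ} (c : ProtocolCircuit k)

theorem ind_injective : Function.Injective c.ind := fun u v h => by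
  by_contra hne
  exact c.ind_ne hne h

/-- The qubits of the Pauli prover that are not identified with a qubit of the verifier. -/
abbrev Spare : Type := {x : Fin c.size // x ∉ Set.range c.ind}

noncomputable instance : DecidablePred fun x : Fin c.size => x ∈ Set.range c.ind :=
  Classical.decPred _

/-- A basis state of the register of the Pauli prover consists of a basis state of the verifier's
qubits and a basis state of the spare qubits. -/
noncomputable def splitQubits : (Fin c.size → Bool) ≃ (c.W → Bool) × (c.Spare → Bool) :=
  (Equiv.piEquivPiSubtypeProd (fun x => x ∈ Set.range c.ind) fun _ => Bool).trans
    (Equiv.prodCongr (Equiv.arrowCongr (Equiv.ofInjective _ c.ind_injective).symm (Equiv.refl _))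
      (Equiv.refl _))

theorem splitQubits_fst (y : Fin c.size → Bool) (w : c.W) :
    (c.splitQubits y).1 w = y (c.ind w) := rfl

/-- An operator on the verifier's qubits, as an operator on the register of the Pauli prover. -/
noncomputable def lift (B : Matrix (c.W → Bool) (c.W → Bool) ℂ) :
    Matrix (Fin c.size → Bool) (Fin c.size → Bool) ℂ :=
  (B ⊗ₖ (1 : Matrix (c.Spare → Bool) (c.Spare → Bool) ℂ)).submatrix c.splitQubits c.splitQubits

theorem lift_mul (B B' : Matrix (c.W → Bool) (c.W → Bool) ℂ) :
    c.lift (B * B') = c.lift B * c.lift B' := by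
  rw [lift, lift, lift, Matrix.submatrix_mul_equiv, ← Matrix.mul_kronecker_mul, one_mul]

theorem lift_one : c.lift 1 = 1 := by
  rw [lift, Matrix.one_kronecker_one, Matrix.submatrix_one_equiv]

theorem lift_add (B B' : Matrix (c.W → Bool) (c.W → Bool) ℂ) :
    c.lift (B + B') = c.lift B + c.lift B' := by
  rw [lift, Matrix.add_kronecker]; rfl

theorem lift_smul (r : ℂ) (B : Matrix (c.W → Bool) (c.W → Bool) ℂ) :
    c.lift (r • B) = r • c.lift B := by
  rw [lift, Matrix.smul_kronecker]; rfl

theorem lift_onQubit (w : c.W) (A : Matrix Bool Bool ℂ) :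
    c.lift (onQubit w A) = onQubit (c.ind w) A := by
  ext x y
  rw [lift, Matrix.submatrix_apply, Matrix.kroneckerMap_apply, onQubit_apply, onQubit_apply]
  by_cases h : ∀ j, j ≠ c.ind w → x j = y j
  · have h2 : (c.splitQubits x).2 = (c.splitQubits y).2 :=
      funext fun j => h j fun e => j.2 ⟨w, e.symm⟩
    have h1 : ∀ v, v ≠ w → (c.splitQubits x).1 v = (c.splitQubits y).1 v :=
      fun v hv => h _ fun e => hv (c.ind_injective e)
    rw [if_pos h, if_pos h1, h2, Matrix.one_apply_eq,
      mul_one, splitQubits_fst, splitQubits_fst]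
  · rw [if_neg h]
    push Not at h
    obtain ⟨j, hj, hne⟩ := h
    by_cases hr : j ∈ Set.range c.ind
    · obtain ⟨v, rfl⟩ := hr
      have h1 : ¬ ∀ v, v ≠ w → (c.splitQubits x).1 v = (c.splitQubits y).1 v :=
        fun h => hne (h v fun e => hj (e ▸ rfl))
      rw [if_neg h1, zero_mul]
    · rw [Matrix.one_apply_ne fun h => hne (congrFun h ⟨j, hr⟩), mul_zero]

theorem pauliOp_pauliOne {S : ℕ} (u : Fin S) (P : Pauli) :
    pauliOp (pauliOne u P) = onQubit u P.mat := by
  unfold pauliOp onQubit onSite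
  congr 1
  ext1 i
  by_cases h : i = u
  · subst h; simp [pauliOne]
  · simp [pauliOne, h, Pauli.mat]

theorem pauliOp_pauliTwo {S : ℕ} {u v : Fin S} (h : u ≠ v) (P P' : Pauli) :
    pauliOp (pauliTwo u P v P') = onQubit u P.mat * onQubit v P'.mat := by
  unfold onQubit
  rw [onSite_mul_onSite_of_ne h]
  unfold pauliOp
  congr 1
  ext1 i
  by_cases hv : i = v
  · subst hv; simp [pauliTwo]
  · by_cases hu : i = u
    · subst hu; simp [pauliTwo, pauliOne, hv]
    · simp [pauliTwo, pauliOne, hv, hu, Pauli.mat]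

end ProtocolCircuit

/-! ### Expectations in a state with a clock register -/

/-- Coordinates for the registers of an honest Pauli strategy: the verifier's qubits and the
registers of the other provers come first, the reference register and the spare qubits of the Pauli
prover last. -/
noncomputable def ProtocolCircuit.regEquiv {k : ℕ} (c : ProtocolCircuit k)
    {P : Option (Fin k) → Type} (e : P none ≃ (Fin c.size → Bool)) (R : Type) :
    (∀ i, P i) × R ≃ ((c.W → Bool) × (∀ i : Fin k, P (some i))) × (R × (c.Spare → Bool)) where
  toFun x := (((c.splitQubits (e (x.1 none))).1, fun i => x.1 (some i)),
    (x.2, (c.splitQubits (e (x.1 none))).2))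
  invFun y := (fun i => match i with
    | none => e.symm (c.splitQubits.symm (y.1.1, y.2.2))
    | some i => y.1.2 i, y.2.1)
  left_inv x := by
    refine Prod.ext (funext fun i => ?_) rfl
    cases i <;> simp
  right_inv y := by simp

theorem tensor_kronecker_one_eq {k : ℕ} (c : ProtocolCircuit k)
    {P : Option (Fin k) → Type} (e : P none ≃ (Fin c.size → Bool)) (R : Type) [DecidableEq R]
    (M : ∀ i, Matrix (P i) (P i) ℂ)
    (B : Matrix (c.W → Bool) (c.W → Bool) ℂ) (hB : M none = (c.lift B).submatrix e e) :
    tensor M ⊗ₖ (1 : Matrix R R ℂ) =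
      ((B ⊗ₖ tensor fun i => M (some i)) ⊗ₖ
        (1 : Matrix (R × (c.Spare → Bool)) (R × (c.Spare → Bool)) ℂ)).submatrix
          (c.regEquiv e R) (c.regEquiv e R) := by
  ext x y
  simp only [Matrix.submatrix_apply, Matrix.kroneckerMap_apply, tensor, Matrix.of_apply,
    Fintype.prod_option, hB, ProtocolCircuit.lift, ProtocolCircuit.regEquiv, Equiv.coe_fn_mk,
    Matrix.one_apply, Prod.mk.injEq]
  by_cases h1 : x.2 = y.2 <;>
    by_cases h2 : (c.splitQubits (e (x.1 none))).2 = (c.splitQubits (e (y.1 none))).2 <;>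
    simp [h1, h2]

/-- A measurement of the clock with outcome `|v⟩` leaves the vector `⟨v|ψ⟩`. -/
theorem dotProduct_vecMulVec_kronecker {C I J : Type} [Fintype C] [Fintype I] [Fintype J]
    (E : I ≃ J) (ψ : C × I → ℂ) (v : C → ℂ) (M : Matrix I I ℂ) (K : Matrix J J ℂ)
    (hM : M = K.submatrix E E) :
    star ψ ⬝ᵥ ((Matrix.vecMulVec v (star v) ⊗ₖ M) *ᵥ ψ) =
      star (fun y => ∑ t, star (v t) * ψ (t, E.symm y)) ⬝ᵥ
        (K *ᵥ fun y => ∑ t, star (v t) * ψ (t, E.symm y)) := by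
  subst hM
  have hR : ∀ z, (K *ᵥ fun y => ∑ t, star (v t) * ψ (t, E.symm y)) z =
      ∑ t', ∑ y, K z (E y) * (star (v t') * ψ (t', y)) := by
    intro z
    simp only [Matrix.mulVec, dotProduct, Finset.mul_sum]
    rw [← E.sum_comp, Finset.sum_comm]
    simp
  rw [dotProduct, dotProduct, ← E.sum_comp]
  simp only [hR]
  rw [Fintype.sum_prod_type, Finset.sum_comm]
  refine Finset.sum_congr rfl fun x _ => ?_
  simp only [Pi.star_apply, star_sum, star_mul', star_star, Equiv.symm_apply_apply,
    Finset.sum_mul]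
  refine Finset.sum_congr rfl fun t _ => ?_
  simp only [Matrix.mulVec, dotProduct, Fintype.sum_prod_type, Finset.mul_sum,
    Matrix.kroneckerMap_apply, Matrix.vecMulVec_apply, Pi.star_apply, Matrix.submatrix_apply]
  refine Finset.sum_congr rfl fun t' _ => Finset.sum_congr rfl fun y _ => ?_
  ring

/-! ### The effects of the tests -/

section SumLemmas

theorem sum_bool_fin_zero {M : Type} [AddCommMonoid M] (f : (Fin 0 → Bool) → M) :
    ∑ a, f a = f ![] := by
  rw [Fintype.sum_unique]
  congr 1

theorem sum_bool_fin_succ {M : Type} [AddCommMonoid M] {n : ℕ} (f : (Fin (n + 1) → Bool) → M) :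
    ∑ a, f a = ∑ a : Fin n → Bool, (f (Matrix.vecCons false a) + f (Matrix.vecCons true a)) := by
  rw [← (Fin.consEquiv fun _ : Fin (n + 1) => Bool).sum_comp, Fintype.sum_prod_type,
    Finset.sum_comm]
  refine Finset.sum_congr rfl fun a _ => ?_
  rw [Fintype.sum_bool, add_comm]
  rfl

variable {ι : Type} [Fintype ι] [DecidableEq ι] {d : ι → Type} [∀ i, Fintype (d i)]
  [∀ i, DecidableEq (d i)]

theorem sum_tensor_eq_one (N : ∀ i, Bool → Matrix (d i) (d i) ℂ) (hN : ∀ i, ∑ b, N i b = 1) :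
    ∑ b : ι → Bool, tensor (fun i => N i (b i)) = 1 := by
  rw [sum_tensor N]
  simp only [hN, tensor_one]

/-- If only the answer of site `i` matters, the measurements at the other sites sum to `1`. -/
theorem sum_tensor_ite (N : ∀ i, Bool → Matrix (d i) (d i) ℂ) (hN : ∀ i, ∑ b, N i b = 1) (i : ι)
    (h : Bool → Bool) :
    ∑ b : ι → Bool, (if h (b i) then tensor (fun i' => N i' (b i')) else 0) =
      onSite i ((if h false then N i false else 0) + (if h true then N i true else 0)) := by
  let N' : ∀ i', Bool → Matrix (d i') (d i') ℂ := fun i' b =>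
    if i' = i then (if h b then N i' b else 0) else N i' b
  have e : ∀ b : ι → Bool, (if h (b i) then tensor (fun i' => N i' (b i')) else 0) =
      tensor fun i' => N' i' (b i') := by
    intro b
    by_cases hb : h (b i) = true
    · rw [if_pos hb]
      congr 1
      ext1 i'
      by_cases hi : i' = i
      · subst hi; simp [N', hb]
      · simp [N', hi]
    · rw [if_neg hb]
      ext x y
      rw [tensor, Matrix.of_apply, Finset.prod_eq_zero (Finset.mem_univ i)]
      · rfl
      · simp [N', hb]
  rw [Finset.sum_congr rfl fun b _ => e b, sum_tensor, onSite]
  congr 1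
  ext1 i'
  by_cases hi : i' = i
  · subst hi; simp [N', add_comm]
  · simp [N', hi, ← hN i', add_comm]

end SumLemmas

namespace HPStrategy

variable {k : ℕ} {c : ProtocolCircuit k} (s : c.HonestStrategy)

/-- The measurement operators of the provers for given answers. -/
def testOps (T : Test c.size k c.ℓ) (aV : Fin T.qV.num → Bool) (b : Fin k → Bool) :
    ∀ i, Matrix (s.P i) (s.P i) ℂ
  | none => s.M none T.qV aV
  | some i => s.M (some i) (T.qP i) (b i)

/-- The effect of the event that the test accepts. -/
def acceptOp (T : Test c.size k c.ℓ) : Matrix (∀ i, s.P i) (∀ i, s.P i) ℂ :=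
  ∑ aV, ∑ b, if T.accept aV b then tensor (testOps s T aV b) else 0

theorem value_eq : s.value c.honestPauliGame =
    ∑ b : c.HonestBranch, (star s.ψ ⬝ᵥ ((c.honestEffect b ⊗ₖ
      (acceptOp s (c.honestTest b) ⊗ₖ (1 : Matrix s.R s.R ℂ))) *ᵥ s.ψ)).re := by
  unfold MeasurementStrategy.value
  refine Finset.sum_congr rfl fun b _ => ?_
  set T := c.honestTest b with hT
  have e1 : c.honestEffect b ⊗ₖ (acceptOp s T ⊗ₖ (1 : Matrix s.R s.R ℂ)) =
      ∑ aV, ∑ bb, (if T.accept aV bb then c.honestEffect b else 0) ⊗ₖ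
        (tensor (testOps s T aV bb) ⊗ₖ (1 : Matrix s.R s.R ℂ)) := by
    ext x y
    simp only [acceptOp, Matrix.kroneckerMap_apply, Matrix.sum_apply, Finset.mul_sum,
      Finset.sum_mul]
    refine Finset.sum_congr rfl fun aV _ => Finset.sum_congr rfl fun bb _ => ?_
    split_ifs <;> simp
  rw [e1]
  simp only [Matrix.sum_mulVec, dotProduct_sum, Complex.re_sum]
  rw [← Fintype.sum_prod_type' (f := fun aV bb => (star s.ψ ⬝ᵥ
    ((if T.accept aV bb then c.honestEffect b else 0) ⊗ₖ
        (tensor (testOps s T aV bb) ⊗ₖ (1 : Matrix s.R s.R ℂ))) *ᵥ s.ψ).re)]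
  refine Fintype.sum_equiv Equiv.piOptionEquivProd _ _ fun a => ?_
  congr 6
  ext1 i
  cases i <;> rfl

/-- The observables of the provers other than the Pauli prover. -/
def obs : ProverOps c.toVerifier fun i => s.P (some i) where
  Q i j := s.M (some i) (.query j) false - s.M (some i) (.query j) true
  P i := s.M (some i) .star false - s.M (some i) .star true
  A i j := s.M (some i) (.answer j) false - s.M (some i) (.answer j) true

theorem M_add (i : Fin k) (q : ProverQuestion c.ℓ) :
    s.M (some i) q false + s.M (some i) q true = 1 := by
  rw [← s.sum_eq_one (some i) q]
  exact (add_comm _ _).trans (Fintype.sum_bool _).symm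

end HPStrategy

/-- The projector `(1 + (-1)^a O) / 2` on an eigenspace of a reflection `O`. -/
noncomputable def eigenProj {n : Type} [DecidableEq n] (a : Bool) (O : Matrix n n ℂ) :
    Matrix n n ℂ :=
  (2⁻¹ : ℂ) • (1 + (if a then (-1 : ℂ) else 1) • O)

theorem eigenProj_false {n : Type} [DecidableEq n] (O : Matrix n n ℂ) :
    eigenProj false O = 1 - eigenProj true O := by
  simp only [eigenProj, if_true, Bool.false_eq_true, if_false]; module

theorem eigenProj_true {n : Type} [DecidableEq n] (O : Matrix n n ℂ) :
    eigenProj true O = (2⁻¹ : ℂ) • (1 - O) := by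
  simp only [eigenProj, if_true]; module

theorem eigenProj_Z {W : Type} [Fintype W] [DecidableEq W] (a : Bool) (u : W) :
    eigenProj a (onQubit u Pauli.Z.mat) = onQubit u (proj a) := by
  rw [onQubit_proj, eigenProj]

namespace ProtocolCircuit

variable {k : ℕ} (c : ProtocolCircuit k)

theorem lift_eigenProj (a : Bool) (O : Matrix (c.W → Bool) (c.W → Bool) ℂ) :
    c.lift (eigenProj a O) = eigenProj a (c.lift O) := by
  rw [eigenProj, lift_smul, lift_add, lift_one, lift_smul, eigenProj]

theorem measure_one (w : c.W) (P : Pauli) (a : Fin 1 → Bool) :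
    (PauliQuestion.one (c.ind w) P).measure a = c.lift (eigenProj (a 0) (onQubit w P.mat)) := by
  rw [lift_eigenProj, lift_onQubit, ← pauliOp_pauliOne]
  exact mul_one _

theorem measure_zzx (u v w : c.W) (huv : u ≠ v) (huw : u ≠ w) (hvw : v ≠ w) (a : Fin 3 → Bool) :
    (PauliQuestion.zzx _ _ _ (c.ind_ne huv) (c.ind_ne huw) (c.ind_ne hvw)).measure a =
      c.lift (eigenProj (a 0) (onQubit u Pauli.Z.mat) * (eigenProj (a 1) (onQubit v Pauli.Z.mat) *
        eigenProj (a 2) (onQubit w Pauli.X.mat))) := by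
  rw [lift_mul, lift_mul, lift_eigenProj, lift_eigenProj, lift_eigenProj, lift_onQubit,
    lift_onQubit, lift_onQubit, ← pauliOp_pauliOne, ← pauliOp_pauliOne, ← pauliOp_pauliOne]
  change _ * (_ * (_ * 1)) = _
  rw [mul_one]
  rfl

theorem measure_xxzz (u v : c.W) (huv : u ≠ v) (a : Fin 2 → Bool) :
    (PauliQuestion.xxzz _ _ (c.ind_ne huv)).measure a =
      c.lift (eigenProj (a 0) (onQubit u Pauli.X.mat * onQubit v Pauli.X.mat) *
        eigenProj (a 1) (onQubit u Pauli.Z.mat * onQubit v Pauli.Z.mat)) := by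
  rw [lift_mul, lift_eigenProj, lift_eigenProj, lift_mul, lift_mul, lift_onQubit,
    lift_onQubit, lift_onQubit, lift_onQubit, ← pauliOp_pauliTwo (c.ind_ne huv),
    ← pauliOp_pauliTwo (c.ind_ne huv)]
  change _ * (_ * 1) = _
  rw [mul_one]
  rfl

theorem measure_xzzx (u v : c.W) (huv : u ≠ v) (a : Fin 2 → Bool) :
    (PauliQuestion.xzzx _ _ (c.ind_ne huv)).measure a =
      c.lift (eigenProj (a 0) (onQubit u Pauli.X.mat * onQubit v Pauli.Z.mat) *
        eigenProj (a 1) (onQubit u Pauli.Z.mat * onQubit v Pauli.X.mat)) := by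
  rw [lift_mul, lift_eigenProj, lift_eigenProj, lift_mul, lift_mul, lift_onQubit,
    lift_onQubit, lift_onQubit, lift_onQubit, ← pauliOp_pauliTwo (c.ind_ne huv),
    ← pauliOp_pauliTwo (c.ind_ne huv)]
  change _ * (_ * 1) = _
  rw [mul_one]
  rfl

end ProtocolCircuit

/-- `H ⊗ H` in terms of Pauli observables. -/
theorem hadamard_op_eq {W : Type} [Fintype W] [DecidableEq W] (u v : W) (huv : u ≠ v) :
    (VGate.hadamard u v huv).op = (2⁻¹ : ℂ) •
      (onQubit u Pauli.X.mat * onQubit v Pauli.X.mat + onQubit u Pauli.Z.mat * onQubit v Pauli.Z.mat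
      + (onQubit u Pauli.X.mat * onQubit v Pauli.Z.mat
        + onQubit u Pauli.Z.mat * onQubit v Pauli.X.mat)) := by
  rw [VGate.op, hadamardMat_eq, onQubit_smul, onQubit_smul, Matrix.smul_mul, Matrix.mul_smul,
    smul_smul, inv_sqrt_two_sq, onQubit_add, onQubit_add, add_mul, mul_add, mul_add]
  congr 1
  abel

theorem X_mul_Z : Pauli.X.mat * Pauli.Z.mat = -(Pauli.Z.mat * Pauli.X.mat) := by
  rw [Pauli.mat_mul_mat]
  simp [Pauli.sign]

/-- The products of the observables in the two questions of Hadamard Check cancel. -/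
theorem xx_mul_zz_add_xz_mul_zx {W : Type} [Fintype W] [DecidableEq W] (u v : W) (huv : u ≠ v) :
    (onQubit u Pauli.X.mat * onQubit v Pauli.X.mat) *
        (onQubit u Pauli.Z.mat * onQubit v Pauli.Z.mat) +
      (onQubit u Pauli.X.mat * onQubit v Pauli.Z.mat) *
        (onQubit u Pauli.Z.mat * onQubit v Pauli.X.mat) = 0 := by
  rw [(onQubit_commute huv.symm Pauli.X.mat Pauli.Z.mat).mul_mul_mul_comm,
    (onQubit_commute huv.symm Pauli.Z.mat Pauli.Z.mat).mul_mul_mul_comm, ← onQubit_mul v,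
    ← onQubit_mul v, ← mul_add, ← onQubit_add, X_mul_Z, neg_add_cancel]
  convert mul_zero _
  ext x y
  rw [onQubit_apply]
  simp

namespace HPStrategy

variable {k : ℕ} {c : ProtocolCircuit k} (s : c.HonestStrategy)
  (e : s.P none ≃ (Fin c.size → Bool))

/-- The operator `A` on the registers of all the provers acts as `K` on the verifier's qubits and
the registers of the provers other than the Pauli prover. -/
def Represents (A : Matrix (∀ i, s.P i) (∀ i, s.P i) ℂ)
    (K : Matrix ((c.W → Bool) × ∀ i : Fin k, s.P (some i))
      ((c.W → Bool) × ∀ i : Fin k, s.P (some i)) ℂ) : Prop :=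
  A ⊗ₖ (1 : Matrix s.R s.R ℂ) =
    (K ⊗ₖ (1 : Matrix (s.R × (c.Spare → Bool)) (s.R × (c.Spare → Bool)) ℂ)).submatrix
      (c.regEquiv e s.R) (c.regEquiv e s.R)

variable {s e}

theorem Represents.add {A A' K K'} (h : Represents s e A K) (h' : Represents s e A' K') :
    Represents s e (A + A') (K + K') := by
  unfold Represents at *
  rw [Matrix.add_kronecker, Matrix.add_kronecker, h, h']; rfl

theorem Represents.sub {A A' K K'} (h : Represents s e A K) (h' : Represents s e A' K') :
    Represents s e (A - A') (K - K') := by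
  unfold Represents at *
  rw [sub_kronecker, sub_kronecker, h, h']; rfl

theorem Represents.zero : Represents s e 0 0 := by
  unfold Represents
  rw [Matrix.zero_kronecker, Matrix.zero_kronecker]; rfl

theorem Represents.one : Represents s e 1 1 := by
  unfold Represents
  rw [Matrix.one_kronecker_one, Matrix.one_kronecker_one, Matrix.submatrix_one_equiv]

theorem Represents.sum {ι : Type} [Fintype ι] {A : ι → _} {K : ι → _}
    (h : ∀ i, Represents s e (A i) (K i)) : Represents s e (∑ i, A i) (∑ i, K i) := by
  classical
  induction (Finset.univ : Finset ι) using Finset.induction_on with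
  | empty => exact .zero
  | insert i t hi ih => rw [Finset.sum_insert hi, Finset.sum_insert hi]; exact (h i).add ih

theorem represents_acceptOp (T : Test c.size k c.ℓ) (BV : (Fin T.qV.num → Bool) → _)
    (hBV : ∀ aV, s.M none T.qV aV = (c.lift (BV aV)).submatrix e e) :
    Represents s e (acceptOp s T) (∑ aV, BV aV ⊗ₖ ∑ b : Fin k → Bool,
      if T.accept aV b then tensor (fun i => s.M (some i) (T.qP i) (b i)) else 0) := by
  refine .sum fun aV => ?_
  have : (BV aV ⊗ₖ ∑ b : Fin k → Bool,
      if T.accept aV b then tensor (fun i => s.M (some i) (T.qP i) (b i)) else 0) =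
      ∑ b : Fin k → Bool, if T.accept aV b then
        BV aV ⊗ₖ tensor (fun i => s.M (some i) (T.qP i) (b i)) else 0 := by
    ext x y
    simp only [Matrix.kroneckerMap_apply, Matrix.sum_apply, Finset.mul_sum]
    refine Finset.sum_congr rfl fun b _ => ?_
    split_ifs <;> simp
  rw [this]
  refine .sum fun b => ?_
  split_ifs
  · exact tensor_kronecker_one_eq c e s.R (testOps s T aV b) (BV aV) (hBV aV)
  · exact .zero

/-- A test in which only the Pauli prover is asked a question. -/
theorem represents_acceptOp_of_pauli (T : Test c.size k c.ℓ) (BV : (Fin T.qV.num → Bool) → _)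
    (hBV : ∀ aV, s.M none T.qV aV = (c.lift (BV aV)).submatrix e e)
    (h : (Fin T.qV.num → Bool) → Bool) (hT : ∀ a b, T.accept a b = h a) :
    Represents s e (acceptOp s T) ((∑ aV, if h aV then BV aV else 0) ⊗ₖ 1) := by
  convert represents_acceptOp T BV hBV
  have e1 : ∀ aV, (∑ b : Fin k → Bool,
      if T.accept aV b then tensor (fun i => s.M (some i) (T.qP i) (b i)) else 0) =
      if h aV then 1 else 0 := by
    intro aV
    simp only [hT]
    split_ifs
    · exact sum_tensor_eq_one (fun i b => s.M (some i) (T.qP i) b) fun i => s.sum_eq_one _ _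
    · simp
  simp only [e1]
  ext x y
  simp only [Matrix.kroneckerMap_apply, Matrix.sum_apply, Finset.sum_mul]
  refine Finset.sum_congr rfl fun aV _ => ?_
  split_ifs <;> simp

/-- A test in which the answers of only one prover other than the Pauli prover matter. -/
theorem represents_acceptOp_of_prover (T : Test c.size k c.ℓ) (BV : (Fin T.qV.num → Bool) → _)
    (hBV : ∀ aV, s.M none T.qV aV = (c.lift (BV aV)).submatrix e e)
    (i : Fin k) (q : ProverQuestion c.ℓ) (hq : T.qP i = q)
    (h : (Fin T.qV.num → Bool) → Bool → Bool) (hT : ∀ a b, T.accept a b = h a (b i)) :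
    Represents s e (acceptOp s T) (∑ aV, BV aV ⊗ₖ onSite i
      ((if h aV false then s.M (some i) q false else 0) +
        (if h aV true then s.M (some i) q true else 0))) := by
  subst hq
  convert represents_acceptOp T BV hBV with aV
  simp only [hT]
  exact (sum_tensor_ite (fun i b => s.M (some i) (T.qP i) b) (fun i => s.sum_eq_one _ _) i
    (h aV)).symm

end HPStrategy

section Algebra

variable {n : Type} [Fintype n] [DecidableEq n]

/-- The sum of the acceptance effects of the two questions of Hadamard Check. -/
theorem hadamard_effects (xx zz xz zx : Matrix n n ℂ) (h : xx * zz + xz * zx = 0) (t : Bool) :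
    (∑ a : Fin 2 → Bool, if !((t ^^ a 0) && (t ^^ a 1)) then
        eigenProj (a 0) xx * eigenProj (a 1) zz else 0) +
      (∑ a : Fin 2 → Bool, if !((t ^^ a 0) && (t ^^ a 1)) then
        eigenProj (a 0) xz * eigenProj (a 1) zx else 0) =
    1 + (2⁻¹ : ℂ) • (1 + (if t then (-1 : ℂ) else 1) •
      ((2⁻¹ : ℂ) • (xx + zz + (xz + zx)))) := by
  have h' : xx * zz = -(xz * zx) := eq_neg_of_add_eq_zero_left h
  simp only [sum_bool_fin_succ, sum_bool_fin_zero]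
  cases t <;>
    simp [eigenProj, mul_add, add_mul, sub_mul, mul_sub, h'] <;> module

/-- The acceptance effect of Toffoli Check. -/
theorem toffoli_effects (u v x : Matrix n n ℂ) (t : Bool) (U V : Bool → Matrix n n ℂ)
    (hU : ∀ a, U a = if a then u else 1 - u) (hV : ∀ a, V a = if a then v else 1 - v) :
    (∑ a : Fin 3 → Bool, if !((a 0 && a 1 && (t ^^ a 2)) || (!(a 0 && a 1) && t)) then
        U (a 0) * (V (a 1) * eigenProj (a 2) x) else 0) =
    (2⁻¹ : ℂ) • (1 + (if t then (-1 : ℂ) else 1) • (1 - u * v * (1 - x))) := by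
  simp only [sum_bool_fin_succ, sum_bool_fin_zero]
  cases t <;>
    simp [eigenProj, hU, hV, mul_add, add_mul, sub_mul, mul_sub, mul_assoc] <;> module

end Algebra

namespace HPStrategy

variable {k : ℕ} {c : ProtocolCircuit k} {s : c.HonestStrategy}
  {e : s.P none ≃ (Fin c.size → Bool)}

/-- The measurement operators of a two-outcome measurement in terms of the observable. -/
theorem exists_observable (i : Fin k) (q : ProverQuestion c.ℓ) :
    ∃ O, s.M (some i) q false - s.M (some i) q true = O ∧
      s.M (some i) q false = (2⁻¹ : ℂ) • (1 + O) ∧ s.M (some i) q true = (2⁻¹ : ℂ) • (1 - O) := by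
  refine ⟨_, rfl, ?_, ?_⟩ <;> rw [← M_add s i q] <;> module

/-- A test without questions accepts with certainty. -/
theorem represents_acceptAll (he : ∀ (q : PauliQuestion c.size) (a : Fin q.num → Bool),
      s.M none q a = (q.measure a).submatrix e e) :
    Represents s e (acceptOp s (.acceptAll _ _ _)) 1 := by
  convert represents_acceptOp_of_pauli (s := s) (e := e) (.acceptAll _ _ _) (fun _ => 1)
    (fun aV => ?_) (fun _ => true) (fun _ _ => rfl)
  · change 1 = (∑ aV : Fin 0 → Bool, _) ⊗ₖ 1
    rw [sum_bool_fin_zero, if_pos rfl, Matrix.one_kronecker_one]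
  · rw [c.lift_one]
    exact he (.none _) aV

/-- Input Check and Output Check project to the tested value of the qubit. -/
theorem represents_valueTest (he : ∀ (q : PauliQuestion c.size) (a : Fin q.num → Bool),
      s.M none q a = (q.measure a).submatrix e e) (w : c.W) (b : Bool) :
    Represents s e (acceptOp s (valueTest (c.ind w) b)) (onQubit w (proj b) ⊗ₖ 1) := by
  convert represents_acceptOp_of_pauli (s := s) (e := e) (valueTest (c.ind w) b)
    (fun aV : Fin 1 → Bool => onQubit w (proj (aV 0)))
    (fun aV => ?_) (fun aV : Fin 1 → Bool => aV 0 == b) (fun _ _ => rfl)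
  · change _ = ∑ aV : Fin 1 → Bool, _
    simp only [sum_bool_fin_succ, sum_bool_fin_zero]
    cases b <;> simp
  · rw [← eigenProj_Z]
    exact (he _ aV).trans (congrArg (fun A => A.submatrix e e) (c.measure_one w .Z aV))

/-- Gate Check measures the reflection of the gate: its effect, summed over the two values of the
coin, is that of accepting when the coin is `1` and comparing the outcome of the reflection with
the clock outcome when the coin is `0`. -/
theorem represents_gateTest (he : ∀ (q : PauliQuestion c.size) (a : Fin q.num → Bool),
      s.M none q a = (q.measure a).submatrix e e) (g : Gate c.W k c.ℓ) (t : Bool) :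
    Represents s e (acceptOp s (c.gateTest g t false) + acceptOp s (c.gateTest g t true))
      (1 + (2⁻¹ : ℂ) • (1 + (if t then (-1 : ℂ) else 1) • (obs s).gateOp g)) := by
  rcases g with (⟨u, v, huv⟩ | ⟨u, v, w, huv, huw, hvw⟩) | ⟨i, j⟩ | ⟨i, j⟩ | i
  · have h1 := represents_acceptOp_of_pauli (s := s) (e := e)
      (c.gateTest (.verifier (.hadamard u v huv)) t false)
      (fun a : Fin 2 → Bool => eigenProj (a 0) (onQubit u Pauli.X.mat * onQubit v Pauli.X.mat) *
        eigenProj (a 1) (onQubit u Pauli.Z.mat * onQubit v Pauli.Z.mat))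
      (fun aV => (he _ aV).trans (congrArg (fun A => A.submatrix e e) (c.measure_xxzz u v huv aV)))
      (fun a : Fin 2 → Bool => !((t ^^ a 0) && (t ^^ a 1))) (fun _ _ => rfl)
    have h2 := represents_acceptOp_of_pauli (s := s) (e := e)
      (c.gateTest (.verifier (.hadamard u v huv)) t true)
      (fun a : Fin 2 → Bool => eigenProj (a 0) (onQubit u Pauli.X.mat * onQubit v Pauli.Z.mat) *
        eigenProj (a 1) (onQubit u Pauli.Z.mat * onQubit v Pauli.X.mat))
      (fun aV => (he _ aV).trans (congrArg (fun A => A.submatrix e e) (c.measure_xzzx u v huv aV)))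
      (fun a : Fin 2 → Bool => !((t ^^ a 0) && (t ^^ a 1))) (fun _ _ => rfl)
    convert h1.add h2 using 1
    rw [← Matrix.add_kronecker, ProverOps.gateOp, hadamard_op_eq]
    have h := hadamard_effects _ _ _ _ (xx_mul_zz_add_xz_mul_zx u v huv) t
    refine Eq.trans ?_ (congrArg (fun A => A ⊗ₖ 1) h.symm)
    simp only [Matrix.add_kronecker, Matrix.smul_kronecker, Matrix.one_kronecker_one]
  · refine Eq.subst (motive := Represents s e _) (add_comm _ _)
      (Represents.add ?_ (represents_acceptAll he))
    convert represents_acceptOp_of_pauli (s := s) (e := e)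
      (c.gateTest (.verifier (.toffoli u v w huv huw hvw)) t false)
      (fun a : Fin 3 → Bool => eigenProj (a 0) (onQubit u Pauli.Z.mat) *
        (eigenProj (a 1) (onQubit v Pauli.Z.mat) * eigenProj (a 2) (onQubit w Pauli.X.mat)))
      (fun aV => (he _ aV).trans
        (congrArg (fun A => A.submatrix e e) (c.measure_zzx u v w huv huw hvw aV)))
      (fun a : Fin 3 → Bool => !((a 0 && a 1 && (t ^^ a 2)) || (!(a 0 && a 1) && t)))
      (fun _ _ => rfl) using 1
    have hp : ∀ (x : c.W) (a : Bool), eigenProj a (onQubit x Pauli.Z.mat) =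
        if a then onQubit x (proj true) else 1 - onQubit x (proj true) := by
      intro x a
      rw [eigenProj_Z]
      cases a <;> simp [onQubit_proj_false]
    have h := toffoli_effects (onQubit u (proj true)) (onQubit v (proj true))
      (onQubit w Pauli.X.mat) t (fun a => eigenProj a (onQubit u Pauli.Z.mat))
      (fun a => eigenProj a (onQubit v Pauli.Z.mat)) (hp u) (hp v)
    refine Eq.trans ?_ (congrArg (fun A => A ⊗ₖ 1) h.symm)
    simp only [Matrix.add_kronecker, Matrix.smul_kronecker, Matrix.one_kronecker_one,
      ProverOps.gateOp, VGate.op]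
  · refine Eq.subst (motive := Represents s e _) (add_comm _ _)
      (Represents.add ?_ (represents_acceptAll he))
    convert represents_acceptOp_of_prover (s := s) (e := e)
      (c.gateTest (.query i j) t false)
      (fun a : Fin 1 → Bool => onQubit (c.msgWire i j) (proj (a 0)))
      (fun aV => by
        rw [← eigenProj_Z]
        exact (he _ aV).trans
          (congrArg (fun A => A.submatrix e e) (c.measure_one (c.msgWire i j) .Z aV)))
      i (.query j) (if_pos rfl)
      (fun (a : Fin 1 → Bool) b => !((a 0 && (t ^^ b)) || (!(a 0) && t)))
      (fun _ _ => rfl) using 1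
    change _ = ∑ a : Fin 1 → Bool, _
    simp only [sum_bool_fin_succ, sum_bool_fin_zero]
    obtain ⟨O, hO, h1, h2⟩ := exists_observable (s := s) i (.query j)
    have hO' : (obs s).Q i j = O := hO
    have e1 : (1 : Matrix ((c.W → Bool) × ∀ i : Fin k, s.P (some i))
        ((c.W → Bool) × ∀ i : Fin k, s.P (some i)) ℂ) =
        onQubit (c.msgWire i j) (proj false) ⊗ₖ 1 + onQubit (c.msgWire i j) (proj true) ⊗ₖ 1 := by
      rw [← Matrix.add_kronecker, ← onQubit_add, proj_add, onQubit_one, Matrix.one_kronecker_one]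
    rw [ProverOps.gateOp, hO', e1]
    cases t <;>
    simp [h1, h2, onSite_smul, onSite_add, onSite_sub, onSite_one, onSite_zero,
      Matrix.kronecker_smul, Matrix.kronecker_add, kronecker_sub] <;>
    module
  · refine Eq.subst (motive := Represents s e _) (add_comm _ _)
      (Represents.add ?_ (represents_acceptAll he))
    convert represents_acceptOp_of_prover (s := s) (e := e)
      (c.gateTest (.answer i j) t false)
      (fun a : Fin 1 → Bool => eigenProj (a 0) (onQubit (c.msgWire i j) Pauli.X.mat))
      (fun aV => (he _ aV).trans
          (congrArg (fun A => A.submatrix e e) (c.measure_one (c.msgWire i j) .X aV)))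
      i (.answer j) (if_pos rfl)
      (fun (a : Fin 1 → Bool) b => !((b && (t ^^ a 0)) || (!b && t)))
      (fun _ _ => rfl) using 1
    change _ = ∑ a : Fin 1 → Bool, _
    simp only [sum_bool_fin_succ, sum_bool_fin_zero]
    obtain ⟨O, hO, h1, h2⟩ := exists_observable (s := s) i (.answer j)
    have hO' : (obs s).A i j = O := hO
    have h0 : eigenProj false (onQubit (c.msgWire i j) Pauli.X.mat) =
        (2⁻¹ : ℂ) • (1 + onQubit (c.msgWire i j) Pauli.X.mat) := by simp [eigenProj]
    rw [ProverOps.gateOp, hO']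
    cases t <;>
    simp [h1, h2, onSite_smul, onSite_add, onSite_sub, onSite_one, onSite_zero, eigenProj_true, h0,
      Matrix.kronecker_smul, Matrix.kronecker_add, kronecker_sub, Matrix.add_kronecker,
      Matrix.smul_kronecker, sub_kronecker] <;>
    module
  · refine Eq.subst (motive := Represents s e _) (add_comm _ _)
      (Represents.add ?_ (represents_acceptAll he))
    convert represents_acceptOp_of_prover (s := s) (e := e)
      (c.gateTest (.reflect i) t false) (fun _ => 1)
      (fun aV => by rw [c.lift_one]; exact he (.none _) aV)
      i .star (if_pos rfl) (fun _ b => b == t)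
      (fun _ _ => rfl) using 1
    change _ = ∑ a : Fin 0 → Bool, _
    simp only [sum_bool_fin_zero]
    obtain ⟨O, hO, h1, h2⟩ := exists_observable (s := s) i .star
    have hO' : (obs s).P i = O := hO
    rw [ProverOps.gateOp, hO']
    cases t <;>
    simp [h1, h2, onSite_smul, onSite_add, onSite_sub, onSite_one,
      Matrix.kronecker_smul, Matrix.kronecker_add, kronecker_sub] <;>
    module

end HPStrategy

/-! ### The rejection probability of an honest Pauli strategy -/

theorem star_dotProduct_self_re {J : Type} [Fintype J] (v : J → ℂ) :
    (star v ⬝ᵥ v).re = ∑ y, ‖v y‖ ^ 2 := by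
  simp only [dotProduct, Complex.re_sum, Pi.star_apply]
  refine Finset.sum_congr rfl fun y _ => ?_
  rw [Complex.star_def, ← Complex.normSq_eq_conj_mul_self, Complex.ofReal_re,
    Complex.normSq_eq_norm_sq]

/-- The clock states `|±⟩` turn the two eigenprojectors of `G` into a propagation term. -/
theorem propagation_form {J : Type} [Fintype J] [DecidableEq J] (G : Matrix J J ℂ) (u v : J → ℂ)
    (a : ℂ) (ha : star a * a = 2⁻¹) :
    star (a • (u + v)) ⬝ᵥ (((2⁻¹ : ℂ) • (1 - G)) *ᵥ (a • (u + v))) +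
      star (a • (u - v)) ⬝ᵥ (((2⁻¹ : ℂ) • (1 + G)) *ᵥ (a • (u - v))) =
    2⁻¹ * (star u ⬝ᵥ u + star v ⬝ᵥ v - star u ⬝ᵥ (G *ᵥ v) - star v ⬝ᵥ (G *ᵥ u)) := by
  simp only [star_smul, star_add, star_sub, Matrix.smul_mulVec, Matrix.mulVec_smul,
    Matrix.sub_mulVec, Matrix.add_mulVec, Matrix.mulVec_add, Matrix.mulVec_sub,
    Matrix.one_mulVec, smul_dotProduct, dotProduct_smul, add_dotProduct, sub_dotProduct,
    dotProduct_add, dotProduct_sub, smul_eq_mul]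
  linear_combination (star u ⬝ᵥ u + star v ⬝ᵥ v - star u ⬝ᵥ (G *ᵥ v) - star v ⬝ᵥ (G *ᵥ u)) * ha

theorem onQubit_proj_form {W D R : Type} [Fintype W] [DecidableEq W] [Fintype D] [DecidableEq D]
    [Fintype R] [DecidableEq R] (w : W) (b : Bool) (v : ((W → Bool) × D) × R → ℂ) :
    (star v ⬝ᵥ (((onQubit w (proj b) ⊗ₖ (1 : Matrix D D ℂ)) ⊗ₖ (1 : Matrix R R ℂ)) *ᵥ v)).re =
      ∑ y, if y.1.1 w = b then ‖v y‖ ^ 2 else 0 := by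
  have h : ((onQubit w (proj b) ⊗ₖ (1 : Matrix D D ℂ)) ⊗ₖ (1 : Matrix R R ℂ)) =
      Matrix.diagonal fun y => if y.1.1 w = b then 1 else 0 := by
    have h1 : onQubit w (proj b) = Matrix.diagonal fun x => if x w = b then 1 else 0 := by
      ext x y
      rw [onQubit_apply, Matrix.diagonal_apply]
      by_cases hxy : x = y
      · subst hxy
        rw [if_pos rfl]
        by_cases hb : x w = b
        · simp [hb, proj]
        · simp [hb, proj, Matrix.single_apply, Ne.symm hb]
      · rw [if_neg hxy]
        by_cases hj : ∀ j, j ≠ w → x j = y j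
        · have hw : x w ≠ y w := fun hw => hxy <| funext fun j => by
            by_cases hj' : j = w
            · rw [hj', hw]
            · exact hj j hj'
          rw [if_pos hj, proj, Matrix.single_apply, if_neg]
          rintro ⟨h1, h2⟩
          exact hw (h1.symm.trans h2)
        · rw [if_neg hj]
    rw [h1, ← Matrix.diagonal_one, ← Matrix.diagonal_one, Matrix.diagonal_kronecker_diagonal,
      Matrix.diagonal_kronecker_diagonal]
    simp
  rw [h, dotProduct, Complex.re_sum]
  refine Finset.sum_congr rfl fun y _ => ?_
  rw [Matrix.mulVec_diagonal]
  split_ifs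
  · rw [one_mul, Pi.star_apply, Complex.star_def, ← Complex.normSq_eq_conj_mul_self,
      Complex.ofReal_re, Complex.normSq_eq_norm_sq]
  · simp

namespace ProtocolCircuit

variable {k : ℕ} (c : ProtocolCircuit k)

theorem size_pos : 0 < c.size := (c.ind c.outWire).pos

/-- The probabilities of the records of the compressed verifier sum to one. -/
theorem sum_honestEffect : ∑ b, c.honestEffect b = 1 := by
  have hp : (c.size : ℂ) ≠ 0 := Nat.cast_ne_zero.2 c.size_pos.ne'
  have hm : ((c.nV + k * c.ℓ : ℕ) : ℂ) ≠ 0 := Nat.cast_ne_zero.2 (by have := c.nV_pos; omega)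
  have hs : ∑ t : c.Clock, Matrix.single t t (1 : ℂ) = 1 := by
    ext x y
    simp [Matrix.sum_apply, Matrix.single_apply, Matrix.one_apply, ite_and]
  rw [Fintype.sum_sum_type, Fintype.sum_sum_type]
  simp only [honestEffect, Fintype.sum_prod_type, Finset.sum_const, Finset.card_univ,
    Fintype.card_bool, Fintype.card_sum, Fintype.card_prod, Fintype.card_fin,
    ← Finset.smul_sum, Fintype.sum_option, Fintype.sum_bool, clockEffect, hs]
  have e : ∀ t : Fin c.size, (1 - c.clockProj t false - c.clockProj t true +
    (c.clockProj t true + c.clockProj t false)) = 1 := fun t => by abel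
  simp only [← Nat.cast_smul_eq_nsmul ℂ, smul_smul, ← smul_add, e, Finset.sum_const,
    Finset.card_univ, Fintype.card_fin]
  rw [← add_smul, ← add_smul]
  convert one_smul ℂ _
  field_simp
  norm_num

end ProtocolCircuit

namespace HPStrategy

variable {k : ℕ} {c : ProtocolCircuit k} (s : c.HonestStrategy)
  (e : s.P none ≃ (Fin c.size → Bool))

/-- The component of the shared state at a clock time. -/
noncomputable def slice (t : c.Clock) :
    ((c.W → Bool) × (∀ i : Fin k, s.P (some i))) × (s.R × (c.Spare → Bool)) → ℂ :=
  fun y => s.ψ (t, (c.regEquiv e s.R).symm y)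

/-- The expectation of an effect on the clock and an operator on the provers' registers. -/
def clockForm (B : Matrix c.Clock c.Clock ℂ) (A : Matrix (∀ i, s.P i) (∀ i, s.P i) ℂ) : ℂ :=
  star s.ψ ⬝ᵥ ((B ⊗ₖ (A ⊗ₖ (1 : Matrix s.R s.R ℂ))) *ᵥ s.ψ)

theorem clockForm_smul (r : ℂ) (B A) : clockForm s (r • B) A = r * clockForm s B A := by
  rw [clockForm, Matrix.smul_kronecker, Matrix.smul_mulVec, dotProduct_smul, smul_eq_mul]; rfl

theorem clockForm_add (B A A') : clockForm s B (A + A') = clockForm s B A + clockForm s B A' := by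
  rw [clockForm, Matrix.add_kronecker, Matrix.kronecker_add, Matrix.add_mulVec, dotProduct_add]
  rfl

theorem clockForm_sub (B A A') : clockForm s B (A - A') = clockForm s B A - clockForm s B A' := by
  rw [eq_sub_iff_add_eq, ← clockForm_add, sub_add_cancel]

theorem clockForm_sum {ι : Type} [Fintype ι] (B : ι → _) (A) :
    ∑ b, clockForm s (B b) A = clockForm s (∑ b, B b) A := by
  unfold clockForm
  rw [← dotProduct_sum, ← Matrix.sum_mulVec]
  congr 2
  ext x y
  simp [Matrix.sum_apply, Finset.sum_mul]

theorem clockForm_one : clockForm s 1 1 = 1 := by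
  have : (clockForm s 1 1) = ((∑ x, ‖s.ψ x‖ ^ 2 : ℝ) : ℂ) := by
    rw [clockForm, Matrix.one_kronecker_one, Matrix.one_kronecker_one, Matrix.one_mulVec,
      dotProduct, Complex.ofReal_sum]
    refine Finset.sum_congr rfl fun y _ => ?_
    rw [Pi.star_apply, Complex.star_def, ← Complex.normSq_eq_conj_mul_self,
      Complex.normSq_eq_norm_sq]
  rw [this, s.norm_ψ, Complex.ofReal_one]

variable {s e}

theorem clockForm_vecMulVec {A K} (h : Represents s e A K) (v : c.Clock → ℂ) :
    clockForm s (Matrix.vecMulVec v (star v)) A =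
      star (fun y => ∑ t, star (v t) * slice s e t y) ⬝ᵥ
        ((K ⊗ₖ (1 : Matrix (s.R × (c.Spare → Bool)) (s.R × (c.Spare → Bool)) ℂ)) *ᵥ
          fun y => ∑ t, star (v t) * slice s e t y) :=
  dotProduct_vecMulVec_kronecker _ s.ψ v _ _ h

theorem clockForm_single {A K} (h : Represents s e A K) (t : c.Clock) :
    clockForm s (Matrix.single t t 1) A = star (slice s e t) ⬝ᵥ
        ((K ⊗ₖ (1 : Matrix (s.R × (c.Spare → Bool)) (s.R × (c.Spare → Bool)) ℂ)) *ᵥ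
          slice s e t) := by
  have h1 : Matrix.single t t (1 : ℂ) =
      Matrix.vecMulVec (Pi.single t 1) (star (Pi.single t 1)) := by
    rw [← Pi.single_star, star_one, ← Matrix.single_eq_single_vecMulVec_single]
  have h2 : (fun y => ∑ t', star ((Pi.single t 1 : c.Clock → ℂ) t') * slice s e t' y) =
      slice s e t := by
    ext y
    simp [Pi.single_apply]
  rw [h1, clockForm_vecMulVec h, h2]

theorem clockForm_zero {A} (h : Represents s e A 0) (B) : clockForm s B A = 0 := by
  have : A ⊗ₖ (1 : Matrix s.R s.R ℂ) = 0 := by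
    rw [h, Matrix.zero_kronecker]; rfl
  rw [clockForm, this, Matrix.kronecker_zero, Matrix.zero_mulVec, dotProduct_zero]

/-- The two conclusive clock outcomes of Gate Check. -/
theorem clockForm_clockProj {A : Bool → _} {G} (t : Fin c.size)
    (h : ∀ b, Represents s e (A b) ((2⁻¹ : ℂ) • (1 - (if b then (-1 : ℂ) else 1) • G))) :
    clockForm s (c.clockProj t false) (A false) + clockForm s (c.clockProj t true) (A true) =
      2⁻¹ * (star (slice s e t.castSucc) ⬝ᵥ slice s e t.castSucc +
        star (slice s e t.succ) ⬝ᵥ slice s e t.succ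
        - star (slice s e t.castSucc) ⬝ᵥ
          ((G ⊗ₖ (1 : Matrix (s.R × (c.Spare → Bool)) (s.R × (c.Spare → Bool)) ℂ)) *ᵥ
            slice s e t.succ)
        - star (slice s e t.succ) ⬝ᵥ
          ((G ⊗ₖ (1 : Matrix (s.R × (c.Spare → Bool)) (s.R × (c.Spare → Bool)) ℂ)) *ᵥ
            slice s e t.castSucc)) := by
  have hne : t.succ ≠ t.castSucc := (Fin.castSucc_lt_succ).ne'
  have hχ : ∀ b : Bool, (fun y => ∑ t', star (c.clockPM t b t') * slice s e t' y) =
      (((√2 : ℝ) : ℂ)⁻¹) • (slice s e t.castSucc +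
        (if b then (-1 : ℂ) else 1) • slice s e t.succ) := by
    intro b
    ext y
    rw [Fintype.sum_eq_add t.castSucc t.succ hne.symm]
    · simp only [ProtocolCircuit.clockPM, if_true, if_neg hne]
      cases b <;> simp <;> ring
    · intro x hx
      simp [ProtocolCircuit.clockPM, hx.1, hx.2]
  rw [← propagation_form _ _ _ (((√2 : ℝ) : ℂ)⁻¹)]
  · rw [ProtocolCircuit.clockProj, ProtocolCircuit.clockProj, clockForm_vecMulVec (h false),
      clockForm_vecMulVec (h true), hχ, hχ]
    simp only [Matrix.smul_kronecker, sub_kronecker, Matrix.one_kronecker_one, if_true,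
      Bool.false_eq_true, if_false, one_smul, neg_smul, sub_neg_eq_add, ← sub_eq_add_neg]
    rw [Matrix.add_kronecker, Matrix.one_kronecker_one]
  · rw [star_inv₀, Complex.star_def, Complex.conj_ofReal, inv_sqrt_two_sq]

/-- The rejection probability of an honest Pauli strategy: a propagation term for every gate, the
weight outside the initial space at time `0`, and the weight on output `0` at the final time. -/
theorem one_sub_value (he : ∀ (q : PauliQuestion c.size) (a : Fin q.num → Bool),
      s.M none q a = (q.measure a).submatrix e e) :
    1 - s.value c.honestPauliGame =
      (12 * (c.size : ℝ))⁻¹ * ∑ t : Fin c.size,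
        (∑ y, ‖slice s e t.castSucc y‖ ^ 2 + ∑ y, ‖slice s e t.succ y‖ ^ 2
          - (star (slice s e t.castSucc) ⬝ᵥ (((obs s).gateOp (c.gates.get t) ⊗ₖ
              (1 : Matrix (s.R × (c.Spare → Bool)) (s.R × (c.Spare → Bool)) ℂ)) *ᵥ
                slice s e t.succ)).re
          - (star (slice s e t.succ) ⬝ᵥ (((obs s).gateOp (c.gates.get t) ⊗ₖ
              (1 : Matrix (s.R × (c.Spare → Bool)) (s.R × (c.Spare → Bool)) ℂ)) *ᵥ
                slice s e t.castSucc)).re)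
      + (3 * ((c.nV + k * c.ℓ : ℕ) : ℝ))⁻¹ * ∑ j, ∑ y,
          (if y.1.1 (.inr j) = true then ‖slice s e 0 y‖ ^ 2 else 0)
      + 3⁻¹ * ∑ y, if y.1.1 c.outWire = false then ‖slice s e (Fin.last _) y‖ ^ 2 else 0 := by
  have hacc := Represents.one.sub (represents_acceptAll he)
  rw [sub_self] at hacc
  have hval : 1 - s.value c.honestPauliGame =
      (∑ b, clockForm s (c.honestEffect b) (1 - acceptOp s (c.honestTest b))).re := by
    simp only [clockForm_sub, Finset.sum_sub_distrib, clockForm_sum, c.sum_honestEffect,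
      clockForm_one, Complex.sub_re, Complex.one_re, Complex.re_sum]
    rw [value_eq]; rfl
  rw [hval, Fintype.sum_sum_type, Fintype.sum_sum_type, ← add_assoc, Complex.add_re,
    Complex.add_re]
  congr 1
  · congr 1
    · rw [Fintype.sum_prod_type, Finset.mul_sum, Complex.re_sum]
      refine Finset.sum_congr rfl fun t _ => ?_
      have hg : ∀ b, Represents s e
          ((1 - acceptOp s (c.gateTest (c.gates.get t) b false)) +
            (1 - acceptOp s (c.gateTest (c.gates.get t) b true)))
          ((2⁻¹ : ℂ) • (1 - (if b then (-1 : ℂ) else 1) • (obs s).gateOp (c.gates.get t))) := by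
        intro b
        have h := (Represents.one.add Represents.one).sub
          (represents_gateTest he (c.gates.get t) b)
        convert h using 1
        · abel
        · module
      have h := clockForm_clockProj t hg
      rw [Fintype.sum_prod_type, Fintype.sum_option]
      simp only [Fintype.sum_bool, ProtocolCircuit.honestTest, ProtocolCircuit.honestEffect,
        ProtocolCircuit.clockEffect, clockForm_zero hacc, clockForm_smul, zero_add, add_zero,
        mul_zero]
      rw [← mul_add, ← mul_add, ← clockForm_add, ← clockForm_add, ← mul_add,
        add_comm (1 - acceptOp s _), add_comm (1 - acceptOp s (c.gateTest _ false true)),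
        add_comm (clockForm s _ _), h]
      have hr : (3⁻¹ : ℂ) * (c.size : ℂ)⁻¹ * 2⁻¹ = (((3⁻¹ * (c.size : ℝ)⁻¹ * 2⁻¹ : ℝ)) : ℂ) := by
        push_cast; ring
      have h2 : (2⁻¹ : ℂ) = ((2⁻¹ : ℝ) : ℂ) := by push_cast; ring
      rw [hr, h2, Complex.re_ofReal_mul, Complex.re_ofReal_mul, Complex.sub_re, Complex.sub_re,
        Complex.add_re, star_dotProduct_self_re, star_dotProduct_self_re, mul_inv]
      ring
    · rw [Fintype.sum_prod_type, Fintype.sum_eq_single 0, Finset.mul_sum, Complex.re_sum]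
      · refine Finset.sum_congr rfl fun j _ => ?_
        have h := Represents.one.sub (represents_valueTest he (.inr j) false)
        have h1 : 1 - (onQubit (.inr j : c.W) (proj false) ⊗ₖ 1) =
            onQubit (.inr j : c.W) (proj true) ⊗ₖ
              (1 : Matrix (∀ i : Fin k, s.P (some i)) (∀ i : Fin k, s.P (some i)) ℂ) := by
          rw [onQubit_proj_false, sub_kronecker, Matrix.one_kronecker_one]; abel
        rw [h1] at h
        simp only [ProtocolCircuit.honestTest, ProtocolCircuit.honestEffect, if_true]
        have hr : (3⁻¹ : ℂ) * ((c.nV + k * c.ℓ : ℕ) : ℂ)⁻¹ =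
            (((3 * ((c.nV + k * c.ℓ : ℕ) : ℝ))⁻¹ : ℝ) : ℂ) := by
          rw [← mul_inv]; push_cast; rfl
        rw [clockForm_smul, hr, Complex.re_ofReal_mul, clockForm_single h, onQubit_proj_form]
      · intro t ht
        refine Finset.sum_eq_zero fun j _ => ?_
        simp only [ProtocolCircuit.honestTest, if_neg ht, clockForm_zero hacc]
  · rw [Fintype.sum_eq_single (Fin.last _)]
    · have h := Represents.one.sub (represents_valueTest he c.outWire true)
      have h1 : 1 - (onQubit c.outWire (proj true) ⊗ₖ 1) =
          onQubit c.outWire (proj false) ⊗ₖ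
            (1 : Matrix (∀ i : Fin k, s.P (some i)) (∀ i : Fin k, s.P (some i)) ℂ) := by
        rw [onQubit_proj_false, sub_kronecker, Matrix.one_kronecker_one]
      rw [h1] at h
      simp only [ProtocolCircuit.honestTest, ProtocolCircuit.honestEffect, if_true]
      have hr : (3⁻¹ : ℂ) = ((3⁻¹ : ℝ) : ℂ) := by push_cast; ring
      rw [clockForm_smul, hr, Complex.re_ofReal_mul, clockForm_single h, onQubit_proj_form]
    · intro t ht
      simp only [ProtocolCircuit.honestTest, if_neg ht, clockForm_zero hacc]

end HPStrategy

/-! ### Measurements as reflections on a larger space -/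

section Dilation

variable {n m : Type} [Fintype n] [DecidableEq n] [Fintype m] [DecidableEq m]

open scoped MatrixOrder in
theorem exists_conjTranspose_mul_self {M : Matrix n n ℂ} (h : M.PosSemidef) :
    ∃ K : Matrix n n ℂ, M = Kᴴ * K :=
  CStarAlgebra.nonneg_iff_eq_star_mul_self.mp h.nonneg

/-- The reflection of `n ⊕ m` that agrees with the isometry `V` on the summand `n`. -/
def isoReflection (V : Matrix m n ℂ) : Matrix (n ⊕ m) (n ⊕ m) ℂ :=
  Matrix.fromBlocks 0 Vᴴ V (1 - V * Vᴴ)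

theorem isReflection_isoReflection {V : Matrix m n ℂ} (hV : Vᴴ * V = 1) :
    IsReflection (isoReflection V) := by
  refine ⟨?_, ?_⟩
  · rw [Matrix.IsHermitian, isoReflection, Matrix.fromBlocks_conjTranspose]
    simp
  · have h1 : (V * Vᴴ) * (V * Vᴴ) = V * Vᴴ := by
      rw [Matrix.mul_assoc, ← Matrix.mul_assoc Vᴴ, hV, Matrix.one_mul]
    rw [isoReflection, Matrix.fromBlocks_multiply, ← Matrix.fromBlocks_one]
    congr 1
    · rw [hV, Matrix.zero_mul, zero_add]
    · rw [Matrix.zero_mul, Matrix.mul_sub, ← Matrix.mul_assoc, hV, Matrix.mul_one, Matrix.one_mul,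
        sub_self, add_zero]
    · rw [Matrix.mul_zero, Matrix.sub_mul, Matrix.mul_assoc, hV, Matrix.mul_one, Matrix.one_mul,
        sub_self, add_zero]
    · simp only [Matrix.sub_mul, Matrix.mul_sub, h1, Matrix.one_mul, Matrix.mul_one]
      abel

/-- The isometry `∑ a, K a ⊗ |a⟩` of a measurement with Kraus operators `K a`. -/
def krausIso {A : Type} (K : A → Matrix n n ℂ) : Matrix (n × A) n ℂ :=
  Matrix.of fun x d => K x.2 x.1 d

theorem krausIso_isometry {A : Type} [Fintype A] (K : A → Matrix n n ℂ)
    (hK : ∑ a, (K a)ᴴ * K a = 1) : (krausIso K)ᴴ * krausIso K = 1 := by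
  rw [← hK]
  ext x y
  simp only [krausIso, Matrix.mul_apply, Matrix.conjTranspose_apply, Matrix.of_apply,
    Matrix.sum_apply, Fintype.sum_prod_type]
  exact Finset.sum_comm

/-- Naimark dilation of a two-outcome measurement: its observable is the compression of a
reflection. -/
theorem exists_reflection_dilation {M : Bool → Matrix n n ℂ} (hM : ∀ b, (M b).PosSemidef)
    (h1 : M false + M true = 1) :
    ∃ R : Matrix (n ⊕ n × Bool) (n ⊕ n × Bool) ℂ, IsReflection R ∧
      R.submatrix Sum.inl Sum.inl = M false - M true := by
  choose K hK using fun b => exists_conjTranspose_mul_self (hM b)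
  have hV := krausIso_isometry K (by rw [Fintype.sum_bool, ← hK, ← hK, add_comm, h1])
  have hU := isReflection_isoReflection hV
  let T : Matrix (n ⊕ n × Bool) (n ⊕ n × Bool) ℂ :=
    Matrix.fromBlocks 1 0 0 (Matrix.diagonal fun x => if x.2 then -1 else 1)
  have hT : IsReflection T := by
    refine ⟨?_, ?_⟩
    · rw [Matrix.IsHermitian, Matrix.fromBlocks_conjTranspose, Matrix.conjTranspose_one,
        Matrix.conjTranspose_zero, Matrix.conjTranspose_zero, Matrix.diagonal_conjTranspose]
      congr 2
      ext x
      by_cases hx : x.2 = true <;> simp [hx]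
    · rw [Matrix.fromBlocks_multiply, ← Matrix.fromBlocks_one, Matrix.diagonal_mul_diagonal,
        ← Matrix.diagonal_one]
      congr 1
      · simp
      · simp
      · simp
      · rw [Matrix.zero_mul, zero_add]
        congr 1
        ext x
        by_cases hx : x.2 = true <;> simp [hx]
  -- Apply the isometry `∑ b, K b ⊗ |b⟩`, the sign of the outcome `b`, and the isometry backwards.
  refine ⟨isoReflection (krausIso K) * T * isoReflection (krausIso K), ⟨?_, ?_⟩, ?_⟩
  · rw [Matrix.IsHermitian, Matrix.conjTranspose_mul, Matrix.conjTranspose_mul, hU.1.eq, hT.1.eq,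
      mul_assoc]
  · rw [mul_assoc, mul_assoc, mul_assoc, ← mul_assoc (isoReflection _) (isoReflection _), hU.2,
      one_mul, ← mul_assoc T, hT.2, one_mul, hU.2]
  · rw [isoReflection, Matrix.fromBlocks_multiply, Matrix.fromBlocks_multiply]
    ext x y
    simp only [Matrix.submatrix_apply, Matrix.fromBlocks_apply₁₁, Matrix.zero_mul, Matrix.mul_zero,
      add_zero, zero_add, hK, Matrix.sub_apply]
    rw [Matrix.mul_apply]
    simp only [Matrix.mul_diagonal]
    simp only [Matrix.mul_apply, krausIso, Matrix.conjTranspose_apply, Matrix.of_apply,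
      Fintype.sum_prod_type, Fintype.sum_bool, ← Finset.sum_sub_distrib]
    refine Finset.sum_congr rfl fun d _ => ?_
    simp
    ring

end Dilation

/-! ### Norms of vectors -/

section Norm

variable {J J' : Type} [Fintype J] [DecidableEq J] [Fintype J'] [DecidableEq J']

theorem IsReflection.sum_norm_sq {A : Matrix J J ℂ} (hA : IsReflection A) (v : J → ℂ) :
    ∑ y, ‖(A *ᵥ v) y‖ ^ 2 = ∑ y, ‖v y‖ ^ 2 := by
  rw [← star_dotProduct_self_re, ← star_dotProduct_self_re, hA.star_mulVec]

theorem norm_toLp_sq (v : J → ℂ) : ‖WithLp.toLp 2 v‖ ^ 2 = ∑ y, ‖v y‖ ^ 2 :=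
  EuclideanSpace.norm_sq_eq _

theorem sum_norm_sq_sub_mulVec {A : Matrix J J ℂ} (hA : IsReflection A) (u v : J → ℂ) :
    ∑ y, ‖(u - A *ᵥ v) y‖ ^ 2 = ∑ y, ‖u y‖ ^ 2 + ∑ y, ‖v y‖ ^ 2
      - (star v ⬝ᵥ (A *ᵥ u)).re - (star u ⬝ᵥ (A *ᵥ v)).re := by
  have h : star (A *ᵥ v) ⬝ᵥ u = star v ⬝ᵥ (A *ᵥ u) := by
    rw [Matrix.star_mulVec, ← Matrix.dotProduct_mulVec, hA.1.eq]
  rw [← star_dotProduct_self_re, ← star_dotProduct_self_re, ← star_dotProduct_self_re, star_sub,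
    sub_dotProduct, dotProduct_sub, dotProduct_sub, hA.star_mulVec, h, Complex.sub_re,
    Complex.sub_re, Complex.sub_re]
  ring

/-- Extending vectors by zero compresses operators to a subset of the basis. -/
theorem star_extend_dotProduct {ι : J → J'} (hι : Function.Injective ι) (A : Matrix J' J' ℂ)
    (u v : J → ℂ) :
    star (Function.extend ι u 0) ⬝ᵥ (A *ᵥ Function.extend ι v 0) =
      star u ⬝ᵥ (A.submatrix ι ι *ᵥ v) := by
  symm
  refine Fintype.sum_of_injective ι hι _ _ (fun i hi => ?_) fun i => ?_
  · rw [Pi.star_apply, Function.extend_apply' _ _ _ hi]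
    simp
  · rw [Pi.star_apply, Pi.star_apply, hι.extend_apply]
    congr 1
    refine Fintype.sum_of_injective ι hι _ _ (fun i hi => ?_) fun i => ?_
    · rw [Function.extend_apply' _ _ _ hi]
      simp
    · rw [hι.extend_apply]
      rfl

end Norm

/-! ### Running the protocol circuit -/

namespace ProverOps

variable {k : ℕ} {c : Verifier k} {D : Fin k → Type} [∀ i, Fintype (D i)]
  [∀ i, DecidableEq (D i)] (o : ProverOps c D) {R : Type} [Fintype R] [DecidableEq R]

/-- The operator of a gate on all the registers, the reference register included. -/
noncomputable def fullOp (R : Type) [DecidableEq R] (g : Gate c.W k c.ℓ) :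
    Matrix (((c.W → Bool) × (∀ i, D i)) × R) (((c.W → Bool) × (∀ i, D i)) × R) ℂ :=
  o.gateOp g ⊗ₖ (1 : Matrix R R ℂ)

theorem IsReflective.fullOp {o : ProverOps c D} (h : o.IsReflective) (g : Gate c.W k c.ℓ) :
    IsReflection (o.fullOp R g) := (h.gateOp g).kronecker .one

/-- The state after a list of gates has been applied. -/
noncomputable def run (l : List (Gate c.W k c.ℓ)) (v : ((c.W → Bool) × (∀ i, D i)) × R → ℂ) :
    ((c.W → Bool) × (∀ i, D i)) × R → ℂ :=
  l.foldl (fun v g => o.fullOp R g *ᵥ v) v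

theorem run_cons (g : Gate c.W k c.ℓ) (l : List (Gate c.W k c.ℓ))
    (v : ((c.W → Bool) × (∀ i, D i)) × R → ℂ) : o.run (g :: l) v = o.run l (o.fullOp R g *ᵥ v) :=
  rfl

theorem run_append (l l' : List (Gate c.W k c.ℓ)) (v : ((c.W → Bool) × (∀ i, D i)) × R → ℂ) :
    o.run (l ++ l') v = o.run l' (o.run l v) := List.foldl_append

theorem run_smul (l : List (Gate c.W k c.ℓ)) (r : ℂ) (v : ((c.W → Bool) × (∀ i, D i)) × R → ℂ) :
    o.run l (r • v) = r • o.run l v := by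
  induction l generalizing v with
  | nil => rfl
  | cons g l ih =>
    rw [run_cons, run_cons, Matrix.mulVec_smul, ih]

theorem run_take_succ (l : List (Gate c.W k c.ℓ)) (t : ℕ) (ht : t < l.length)
    (v : ((c.W → Bool) × (∀ i, D i)) × R → ℂ) :
    o.run (l.take (t + 1)) v = o.fullOp R (l.get ⟨t, ht⟩) *ᵥ o.run (l.take t) v := by
  rw [List.take_succ_eq_append_getElem ht, run_append]
  rfl

theorem IsReflective.sum_norm_sq_run {o : ProverOps c D} (h : o.IsReflective)
    (l : List (Gate c.W k c.ℓ)) (v : ((c.W → Bool) × (∀ i, D i)) × R → ℂ) :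
    ∑ y, ‖o.run l v y‖ ^ 2 = ∑ y, ‖v y‖ ^ 2 := by
  induction l generalizing v with
  | nil => rfl
  | cons g l ih =>
    rw [run_cons, ih, (h.fullOp g).sum_norm_sq]

end ProverOps

namespace NormalFormStrategy

variable {k : ℕ} {c : Verifier k} (s : NormalFormStrategy c)

theorem final_eq : s.final = s.ops.run c.gates s.initial := by
  unfold final ProverOps.run ProverOps.fullOp
  simp only [s.gateOp_eq]

/-- The basis state of all the registers, with the qubits of `V` and `M` set to `|0⟩`, of a basis
state of the shared registers. -/
def embed {D R : Type} (x : (Fin c.nC → Bool) × D × R) : ((c.W → Bool) × D) × R :=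
  ((Sum.elim x.1 fun _ => false, x.2.1), x.2.2)

theorem embed_injective {D R : Type} : Function.Injective (embed (c := c) (D := D) (R := R)) := by
  rintro ⟨x, d, r⟩ ⟨x', d', r'⟩ h
  simp only [embed, Prod.mk.injEq] at h
  obtain ⟨⟨h1, rfl⟩, rfl⟩ := h
  congr
  ext i
  exact congrFun h1 (.inl i)

theorem embed_of_zero {D R : Type} (y : ((c.W → Bool) × D) × R)
    (h : ∀ w, y.1.1 (.inr w) = false) : embed (fun i => y.1.1 (.inl i), y.1.2, y.2) = y := by
  refine Prod.ext (Prod.ext (funext fun w => ?_) rfl) rfl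
  cases w with
  | inl i => rfl
  | inr w => exact (h w).symm

theorem sum_norm_sq_initial : ∑ y, ‖s.initial y‖ ^ 2 = 1 := by
  rw [← s.norm_ψ]
  symm
  refine Fintype.sum_of_injective embed embed_injective _ _ (fun y hy => ?_) fun x => ?_
  · rw [initial, if_neg]
    · simp
    · exact fun h => hy ⟨_, embed_of_zero y h⟩
  · have h : ∀ w, (embed (c := c) x).1.1 (.inr w) = false := fun w => rfl
    rw [initial, if_pos h]
    rfl

theorem sum_norm_sq_final : ∑ y, ‖s.final y‖ ^ 2 = 1 := by
  rw [final_eq, s.ops_isReflective.sum_norm_sq_run, sum_norm_sq_initial]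

theorem value_eq_one_sub :
    s.value = 1 - ∑ y, if y.1.1 c.outWire = false then ‖s.final y‖ ^ 2 else 0 := by
  rw [eq_sub_iff_add_eq, ← s.sum_norm_sq_final, value, ← Finset.sum_add_distrib]
  refine Finset.sum_congr rfl fun y _ => ?_
  cases y.1.1 c.outWire <;> simp

theorem value_nonneg : 0 ≤ s.value :=
  Finset.sum_nonneg fun y _ => by split_ifs <;> positivity

theorem value_le_one : s.value ≤ 1 := by
  rw [value_eq_one_sub, sub_le_self_iff]
  exact Finset.sum_nonneg fun y _ => by split_ifs <;> positivity

end NormalFormStrategy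

/-! ### Monomial matrices -/

/-- Every row `x` of the matrix `A` has at most one nonzero entry, namely `d x` at column `σ x`. -/
def IsMonomial {n : Type} [DecidableEq n] (A : Matrix n n ℂ) (d : n → ℂ) (σ : n → n) : Prop :=
  ∀ x y, A x y = if y = σ x then d x else 0

namespace IsMonomial

variable {n m : Type} [Fintype n] [DecidableEq n] [Fintype m] [DecidableEq m]

theorem mulVec {A : Matrix n n ℂ} {d σ} (h : IsMonomial A d σ) (v : n → ℂ) (x : n) :
    (A *ᵥ v) x = d x * v (σ x) := by
  simp [Matrix.mulVec, dotProduct, h x]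

theorem diagonal (d : n → ℂ) : IsMonomial (Matrix.diagonal d) d id := fun x y => by
  rw [Matrix.diagonal_apply]
  simp [eq_comm]

theorem one : IsMonomial (1 : Matrix n n ℂ) (fun _ => 1) id := by
  rw [← Matrix.diagonal_one]
  exact diagonal _

theorem kronecker {A : Matrix n n ℂ} {d σ} (h : IsMonomial A d σ) {B : Matrix m m ℂ} {d' τ}
    (h' : IsMonomial B d' τ) :
    IsMonomial (A ⊗ₖ B) (fun x => d x.1 * d' x.2) (Prod.map σ τ) := fun x y => by
  rw [Matrix.kroneckerMap_apply, h, h']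
  by_cases h1 : y.1 = σ x.1 <;> by_cases h2 : y.2 = τ x.2 <;> simp [Prod.ext_iff, h1, h2]

theorem onSite {ι : Type} [Fintype ι] [DecidableEq ι] {d : ι → Type}
    [∀ i, Fintype (d i)] [∀ i, DecidableEq (d i)] {i : ι} {A : Matrix (d i) (d i) ℂ} {f σ}
    (h : IsMonomial A f σ) : IsMonomial (ENL.onSite i A) (fun x => f (x i))
      (fun x => Function.update x i (σ (x i))) := fun x y => by
  rw [onSite_apply, h]
  by_cases hj : ∀ j, j ≠ i → x j = y j
  · rw [if_pos hj]
    congr 1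
    rw [eq_iff_iff]
    constructor
    · intro hy
      ext j
      by_cases h : j = i
      · subst h; simp [hy]
      · simp [h, hj j h]
    · rintro rfl
      simp
  · rw [if_neg hj, if_neg]
    rintro rfl
    exact hj fun j hj => by simp [hj]

theorem X : IsMonomial Pauli.X.mat (fun _ => 1) (fun b => !b) := fun x y => by
  cases x <;> cases y <;> simp [Pauli.mat]

theorem proj (b : Bool) : IsMonomial (ENL.proj b) (fun x => if x = b then 1 else 0) id :=
  fun x y => by
    cases x <;> cases y <;> cases b <;> simp [ENL.proj]

end IsMonomial

theorem IsMonomial.onQubit {W : Type} [Fintype W] [DecidableEq W] {u : W}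
    {A : Matrix Bool Bool ℂ} {f σ} (h : IsMonomial A f σ) :
    IsMonomial (ENL.onQubit u A) (fun x => f (x u)) (fun x => Function.update x u (σ (x u))) :=
  IsMonomial.onSite (d := fun _ : W => Bool) h

theorem IsMonomial.onQubit_proj {W : Type} [Fintype W] [DecidableEq W] (u : W) (b : Bool) :
    IsMonomial (ENL.onQubit u (ENL.proj b)) (fun x => if x u = b then 1 else 0) id := by
  convert (IsMonomial.proj b).onQubit (u := u) using 1
  ext1 x
  simp

/-! ### Layers of the protocol circuit -/

section Kron

variable {n m l : Type} [Fintype n] [DecidableEq n] [Fintype m] [DecidableEq m] [Fintype l]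
  [DecidableEq l]

theorem kronecker_one_one_mulVec (B : Matrix n n ℂ) (v : (n × m) × l → ℂ) (w : n) (x : m) (r : l) :
    (((B ⊗ₖ (1 : Matrix m m ℂ)) ⊗ₖ (1 : Matrix l l ℂ)) *ᵥ v) ((w, x), r) =
      (B *ᵥ fun w' => v ((w', x), r)) w := by
  simp [Matrix.mulVec, dotProduct, Fintype.sum_prod_type, Matrix.one_apply]

theorem one_kronecker_one_mulVec (B : Matrix m m ℂ) (v : (n × m) × l → ℂ) (w : n) (x : m) (r : l) :
    ((((1 : Matrix n n ℂ) ⊗ₖ B) ⊗ₖ (1 : Matrix l l ℂ)) *ᵥ v) ((w, x), r) =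
      (B *ᵥ fun x' => v ((w, x'), r)) x := by
  simp [Matrix.mulVec, dotProduct, Fintype.sum_prod_type, Matrix.one_apply]

end Kron

namespace ProverOps

variable {k : ℕ} {c : Verifier k} {D : Fin k → Type} [∀ i, Fintype (D i)]
  [∀ i, DecidableEq (D i)] (o : ProverOps c D) {R : Type} [Fintype R] [DecidableEq R]

/-- A verifier circuit acts on the verifier's qubits only. -/
theorem run_verifier (l : List (VGate c.W)) (v : ((c.W → Bool) × (∀ i, D i)) × R → ℂ) :
    o.run (l.map .verifier) v =
      ((circuitOp l ⊗ₖ (1 : Matrix (∀ i, D i) (∀ i, D i) ℂ)) ⊗ₖ (1 : Matrix R R ℂ)) *ᵥ v := by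
  have h : ∀ U : Matrix (c.W → Bool) (c.W → Bool) ℂ, o.run (l.map .verifier)
      (((U ⊗ₖ (1 : Matrix (∀ i, D i) (∀ i, D i) ℂ)) ⊗ₖ (1 : Matrix R R ℂ)) *ᵥ v) =
      ((l.foldl (fun U g => g.op * U) U ⊗ₖ (1 : Matrix (∀ i, D i) (∀ i, D i) ℂ)) ⊗ₖ
        (1 : Matrix R R ℂ)) *ᵥ v := by
    induction l with
    | nil => exact fun U => rfl
    | cons g l ih =>
      intro U
      rw [List.foldl_cons, ← ih, List.map_cons, run_cons, fullOp, gateOp,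
        Matrix.mulVec_mulVec, ← Matrix.mul_kronecker_mul, ← Matrix.mul_kronecker_mul, mul_one,
        mul_one]
  have h1 := h 1
  rw [Matrix.one_kronecker_one, Matrix.one_kronecker_one, Matrix.one_mulVec] at h1
  exact h1

theorem onSite_mul_tensor (i : Fin k) (A : Matrix (D i) (D i) ℂ)
    (N : ∀ i, Matrix (D i) (D i) ℂ) :
    onSite i A * tensor N = tensor (Function.update N i (A * N i)) := by
  unfold onSite
  rw [tensor_mul]
  congr 1
  ext1 j
  by_cases h : j = i
  · subst h; simp
  · simp [h]

/-- The reflections `P_i` of different provers are applied in parallel. -/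
theorem run_reflect (v : ((c.W → Bool) × (∀ i, D i)) × R → ℂ) :
    o.run ((List.finRange k).map .reflect) v =
      (((1 : Matrix (c.W → Bool) (c.W → Bool) ℂ) ⊗ₖ tensor o.P) ⊗ₖ (1 : Matrix R R ℂ)) *ᵥ v := by
  have h : ∀ (l : List (Fin k)) (hl : l.Nodup) (N : ∀ i, Matrix (D i) (D i) ℂ)
      (hN : ∀ i ∈ l, N i = 1), o.run (l.map .reflect)
        ((((1 : Matrix (c.W → Bool) (c.W → Bool) ℂ) ⊗ₖ tensor N) ⊗ₖ (1 : Matrix R R ℂ)) *ᵥ v) =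
      (((1 : Matrix (c.W → Bool) (c.W → Bool) ℂ) ⊗ₖ tensor fun i => if i ∈ l then o.P i else N i) ⊗ₖ
        (1 : Matrix R R ℂ)) *ᵥ v := by
    intro l
    induction l with
    | nil => intro _ N _; simp [run]
    | cons i l ih =>
      intro hl N hN
      rw [List.nodup_cons] at hl
      rw [List.map_cons, run_cons, fullOp, gateOp,
        Matrix.mulVec_mulVec, ← Matrix.mul_kronecker_mul, ← Matrix.mul_kronecker_mul, mul_one,
        mul_one, onSite_mul_tensor, ih hl.2]
      · congr 4
        ext1 j
        by_cases h : j = i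
        · subst h; simp [hl.1, hN j]
        · simp [h]
      · intro j hj
        have : j ≠ i := fun e => hl.1 (e ▸ hj)
        simp [this, hN j (List.mem_cons_of_mem _ hj)]
  have h1 := h _ (List.nodup_finRange k) (fun _ => 1) fun _ _ => rfl
  rw [tensor_one, Matrix.one_kronecker_one, Matrix.one_kronecker_one, Matrix.one_mulVec] at h1
  rw [h1]
  simp

end ProverOps

/-- All the pairs of a prover and a position in its messages. -/
def allPairs (k ℓ : ℕ) : List (Fin k × Fin ℓ) := List.finRange k ×ˢ List.finRange ℓ

theorem nodup_allPairs (k ℓ : ℕ) : (allPairs k ℓ).Nodup :=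
  (List.nodup_finRange k).product (List.nodup_finRange ℓ)

theorem mem_allPairs {k ℓ : ℕ} (p : Fin k × Fin ℓ) : p ∈ allPairs k ℓ :=
  List.mem_product.2 ⟨List.mem_finRange _, List.mem_finRange _⟩

theorem flatMap_map_eq {k ℓ : ℕ} {α : Type} (f : Fin k → Fin ℓ → α) :
    (List.finRange k).flatMap (fun i => (List.finRange ℓ).map (f i)) =
      (allPairs k ℓ).map fun p => f p.1 p.2 := by
  change _ = ((List.finRange k).flatMap fun i => (List.finRange ℓ).map (Prod.mk i)).map _
  rw [List.map_flatMap]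
  simp only [List.map_map]
  rfl

/-! ### From measurement strategies to normal form strategies -/

theorem isReflection_blockDiagonal {n m : Type} [Fintype n] [DecidableEq n] [Fintype m]
    [DecidableEq m] {M : m → Matrix n n ℂ} (h : ∀ i, IsReflection (M i)) :
    IsReflection (Matrix.blockDiagonal M) := by
  refine ⟨?_, ?_⟩
  · rw [Matrix.IsHermitian, Matrix.blockDiagonal_conjTranspose]
    simp only [(h _).1.eq]
  · rw [← Matrix.blockDiagonal_mul]
    simp only [(h _).2]
    exact Matrix.blockDiagonal_one

theorem isReflection_diagonal {n : Type} [Fintype n] [DecidableEq n] (f : n → Bool) :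
    IsReflection (Matrix.diagonal fun x => if f x then (-1 : ℂ) else 1) := by
  refine ⟨?_, ?_⟩
  · rw [Matrix.IsHermitian, Matrix.diagonal_conjTranspose]
    congr 1
    ext x
    cases h : f x <;> simp [h]
  · rw [Matrix.diagonal_mul_diagonal, ← Matrix.diagonal_one]
    congr 1
    ext x
    cases h : f x <;> simp

/-- The register of a prover that answers coherently: the original register, possibly with a
recorded answer, and a copy of the question. -/
abbrev CoherentReg (P : Type) (ℓ : ℕ) : Type := (P ⊕ P × (Fin ℓ → Bool)) × (Fin ℓ → Bool)

/-- Whether the recorded answer differs from the question in position `j`. -/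
def CoherentReg.differs {P : Type} {ℓ : ℕ} (j : Fin ℓ) : CoherentReg P ℓ → Bool
  | (.inl _, _) => false
  | (.inr (_, a), q) => a j ^^ q j

/-- The reflections of provers with Kraus operators `K i q a`: `Q_ij` flips a bit of the copy of
the question, `P_i` measures and records the answer, and `A_ij` reads the bit by which the answer
differs from the question. -/
noncomputable def coherentOps {k : ℕ} {c : Verifier k} {P : Fin k → Type} [∀ i, Fintype (P i)]
    [∀ i, DecidableEq (P i)]
    (K : ∀ i, (Fin c.ℓ → Bool) → (Fin c.ℓ → Bool) → Matrix (P i) (P i) ℂ) :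
    ProverOps c (fun i => CoherentReg (P i) c.ℓ) where
  Q _ j := 1 ⊗ₖ onQubit j Pauli.X.mat
  P i := Matrix.blockDiagonal fun q => isoReflection (krausIso (K i q))
  A _ j := Matrix.diagonal fun x => if x.differs j then (-1 : ℂ) else 1

section Coherent

variable {k : ℕ} {c : Verifier k} {P : Fin k → Type} [∀ i, Fintype (P i)]
  [∀ i, DecidableEq (P i)] {R : Type} [Fintype R] [DecidableEq R]
  (K : ∀ i, (Fin c.ℓ → Bool) → (Fin c.ℓ → Bool) → Matrix (P i) (P i) ℂ)

theorem coherentOps_isReflective (hK : ∀ i q, ∑ a, (K i q a)ᴴ * K i q a = 1) :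
    (coherentOps K).IsReflective where
  Q _ _ := IsReflection.one.kronecker ((Pauli.isReflection_mat .X).onQubit _)
  P i := isReflection_blockDiagonal fun q =>
    isReflection_isoReflection (krausIso_isometry _ (hK i q))
  A _ _ := isReflection_diagonal _

theorem fullOp_query_mulVec (i : Fin k) (j : Fin c.ℓ)
    (v : ((c.W → Bool) × (∀ i, CoherentReg (P i) c.ℓ)) × R → ℂ) (w x r) :
    ((coherentOps K).fullOp R (.query i j) *ᵥ v) ((w, x), r) =
      v ((w, if w (c.msgWire i j) then
        Function.update x i ((x i).1, Function.update (x i).2 j (!(x i).2 j)) else x), r) := by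
  have h0 := ((IsMonomial.onQubit_proj (c.msgWire i j) false).kronecker
    (IsMonomial.one (n := ∀ i, CoherentReg (P i) c.ℓ))).kronecker (IsMonomial.one (n := R))
  have h1 := ((IsMonomial.onQubit_proj (c.msgWire i j) true).kronecker
    (((IsMonomial.one (n := P i ⊕ P i × (Fin c.ℓ → Bool))).kronecker
      (IsMonomial.X.onQubit (u := j))).onSite (d := fun i => CoherentReg (P i) c.ℓ)
        (i := i))).kronecker (IsMonomial.one (n := R))
  rw [ProverOps.fullOp, ProverOps.gateOp, Matrix.add_kronecker, Matrix.add_mulVec, Pi.add_apply]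
  refine (congrArg₂ (· + ·) (h0.mulVec v _) (h1.mulVec v _)).trans ?_
  cases hw : w (c.msgWire i j) <;> simp [hw, Prod.map]

theorem fullOp_answer_mulVec (i : Fin k) (j : Fin c.ℓ)
    (v : ((c.W → Bool) × (∀ i, CoherentReg (P i) c.ℓ)) × R → ℂ) (w x r) :
    ((coherentOps K).fullOp R (.answer i j) *ᵥ v) ((w, x), r) =
      v ((if (x i).differs j then
        Function.update w (c.msgWire i j) (!w (c.msgWire i j)) else w, x), r) := by
  have hA := (IsMonomial.diagonal fun x : CoherentReg (P i) c.ℓ =>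
    if x.differs j then (-1 : ℂ) else 1).onSite (d := fun i => CoherentReg (P i) c.ℓ) (i := i)
  have e0 : IsMonomial
      ((2⁻¹ : ℂ) • (1 + onSite (d := fun i => CoherentReg (P i) c.ℓ) i ((coherentOps K).A i j)))
      (fun x => if (x i).differs j then 0 else 1) id := by
    intro x y
    rw [Matrix.smul_apply, Matrix.add_apply, IsMonomial.one, coherentOps, hA]
    by_cases hd : (x i).differs j = true <;> by_cases hy : y = x <;> simp [hd, hy]
    norm_num
  have e1 : IsMonomial
      ((2⁻¹ : ℂ) • (1 - onSite (d := fun i => CoherentReg (P i) c.ℓ) i ((coherentOps K).A i j)))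
      (fun x => if (x i).differs j then 1 else 0) id := by
    intro x y
    rw [Matrix.smul_apply, Matrix.sub_apply, IsMonomial.one, coherentOps, hA]
    by_cases hd : (x i).differs j = true <;> by_cases hy : y = x <;> simp [hd, hy]
    norm_num
  have h0 := ((IsMonomial.one (n := c.W → Bool)).kronecker e0).kronecker (IsMonomial.one (n := R))
  have h1 := ((IsMonomial.X.onQubit (u := c.msgWire i j)).kronecker e1).kronecker
    (IsMonomial.one (n := R))
  rw [ProverOps.fullOp, ProverOps.gateOp, Matrix.add_kronecker, Matrix.add_mulVec, Pi.add_apply]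
  refine (congrArg₂ (· + ·) (h0.mulVec v _) (h1.mulVec v _)).trans ?_
  cases hd : (x i).differs j <;> simp [hd, Prod.map]

/-- The gates `CTL-Q_ij` add the messages to the copies of the questions. -/
theorem run_query (v : ((c.W → Bool) × (∀ i, CoherentReg (P i) c.ℓ)) × R → ℂ) (w x r) :
    (coherentOps K).run ((allPairs k c.ℓ).map fun p => .query p.1 p.2) v ((w, x), r) =
      v ((w, fun i => ((x i).1, fun j => (x i).2 j ^^ w (c.msgWire i j))), r) := by
  have h : ∀ l : List (Fin k × Fin c.ℓ), l.Nodup → ∀ v,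
      (coherentOps K).run (R := R) (l.map fun p => .query p.1 p.2) v ((w, x), r) =
        v ((w, fun i => ((x i).1, fun j =>
          (x i).2 j ^^ (decide ((i, j) ∈ l) && w (c.msgWire i j)))), r) := by
    intro l
    induction l with
    | nil => intro _ v; simp [ProverOps.run]
    | cons p l ih =>
      intro hl v
      rw [List.nodup_cons] at hl
      rw [List.map_cons, ProverOps.run_cons, ih hl.2, fullOp_query_mulVec]
      obtain ⟨i₀, j₀⟩ := p
      refine congrArg v (Prod.ext (Prod.ext rfl (funext fun i => ?_)) rfl)
      by_cases hi : i = i₀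
      · subst hi
        refine Prod.ext (by split_ifs <;> simp) (funext fun j => ?_)
        by_cases hj : j = j₀
        · subst hj
          cases hw : w (c.msgWire i j) <;> simp [hl.1, hw]
        · have : (i, j) ≠ (i, j₀) := fun e => hj (Prod.ext_iff.1 e).2
          cases hw : w (c.msgWire i j₀) <;> simp [hj, this, hw]
      · have : ∀ j, (i, j) ≠ (i₀, j₀) := fun j e => hi (Prod.ext_iff.1 e).1
        split_ifs <;> simp [hi, this]
  rw [h _ (nodup_allPairs k c.ℓ)]
  simp [mem_allPairs]

/-- Adding the bits by which the recorded answers differ from the questions to the messages. -/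
def addDiffs (x : ∀ i, CoherentReg (P i) c.ℓ) (w : c.W → Bool) : c.W → Bool
  | .inr (.inr (i, j)) => w (c.msgWire i j) ^^ (x i).differs j
  | u => w u

/-- The gates `TGT-A_ij` turn the questions in the message registers into the recorded answers. -/
theorem run_answer (v : ((c.W → Bool) × (∀ i, CoherentReg (P i) c.ℓ)) × R → ℂ) (w x r) :
    (coherentOps K).run ((allPairs k c.ℓ).map fun p => .answer p.1 p.2) v ((w, x), r) =
      v ((addDiffs x w, x), r) := by
  have h : ∀ l : List (Fin k × Fin c.ℓ), l.Nodup → ∀ v,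
      (coherentOps K).run (R := R) (l.map fun p => .answer p.1 p.2) v ((w, x), r) =
        v ((fun u => match u with
          | .inr (.inr (i, j)) => w (c.msgWire i j) ^^ (decide ((i, j) ∈ l) && (x i).differs j)
          | u => w u, x), r) := by
    intro l
    induction l with
    | nil =>
      intro _ v
      refine congrArg v (Prod.ext (Prod.ext (funext fun u => ?_) rfl) rfl)
      rcases u with u | u | ⟨i, j⟩ <;> simp [Verifier.msgWire]
    | cons p l ih =>
      intro hl v
      rw [List.nodup_cons] at hl
      rw [List.map_cons, ProverOps.run_cons, ih hl.2, fullOp_answer_mulVec]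
      refine congrArg v (Prod.ext (Prod.ext (funext fun u => ?_) rfl) rfl)
      rcases u with u | u | ⟨i, j⟩
      · split_ifs <;> simp [Verifier.msgWire]
      · split_ifs <;> simp [Verifier.msgWire]
      · by_cases hp : (i, j) = p
        · subst hp
          cases hd : (x i).differs j <;> simp [Verifier.msgWire, hl.1, hd]
        · have hp' : (Sum.inr (Sum.inr (i, j)) : c.W) ≠ c.msgWire p.1 p.2 := by
            intro e
            exact hp (Sum.inr_injective (Sum.inr_injective e))
          split_ifs <;> simp [hp, hp']
  rw [h _ (nodup_allPairs k c.ℓ)]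
  refine congrArg v (Prod.ext (Prod.ext (funext fun u => ?_) rfl) rfl)
  rcases u with u | u | ⟨i, j⟩ <;> simp [addDiffs, mem_allPairs]

end Coherent

section Coherent

variable {k : ℕ} {c : Verifier k} {P : Fin k → Type} [∀ i, Fintype (P i)]
  [∀ i, DecidableEq (P i)] {R : Type} [Fintype R] [DecidableEq R]
  (K : ∀ i, (Fin c.ℓ → Bool) → (Fin c.ℓ → Bool) → Matrix (P i) (P i) ℂ)
  (ψ : (Fin c.nC → Bool) × (∀ i, P i) × R → ℂ)

/-- Provers that hold a copy of the questions and have not recorded an answer. -/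
def askedReg (d : ∀ i, P i) (q : Fin k → Fin c.ℓ → Bool) (i : Fin k) : CoherentReg (P i) c.ℓ :=
  (.inl (d i), q i)

/-- Provers that hold a copy of the questions and have recorded their answers. -/
def answeredReg (d : ∀ i, P i) (a q : Fin k → Fin c.ℓ → Bool) (i : Fin k) :
    CoherentReg (P i) c.ℓ :=
  (.inr (d i, a i), q i)

/-- A basis state of the original registers, with empty copies of the questions. -/
def freshReg (x : (Fin c.nC → Bool) × (∀ i, P i) × R) :
    (Fin c.nC → Bool) × (∀ i, CoherentReg (P i) c.ℓ) × R :=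
  (x.1, askedReg x.2.1 (fun _ _ => false), x.2.2)

/-- The shared state on the enlarged registers. -/
noncomputable def coherentState :
    (Fin c.nC → Bool) × (∀ i, CoherentReg (P i) c.ℓ) × R → ℂ :=
  Function.extend freshReg ψ 0

theorem askedReg_injective {d d' : ∀ i, P i} {q q' : Fin k → Fin c.ℓ → Bool}
    (h : askedReg d q = askedReg d' q') : d = d' ∧ q = q' := by
  constructor <;> ext i : 1
  · exact Sum.inl_injective (Prod.ext_iff.1 (congrFun h i)).1
  · exact (Prod.ext_iff.1 (congrFun h i)).2

theorem freshReg_injective :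
    Function.Injective (freshReg (c := c) (P := P) (R := R)) := by
  rintro ⟨x, d, r⟩ ⟨x', d', r'⟩ h
  simp only [freshReg, Prod.mk.injEq] at h
  obtain ⟨rfl, h, rfl⟩ := h
  rw [(askedReg_injective h).1]

theorem coherentState_asked (x d q r) : coherentState ψ (x, askedReg d q, r) =
    if ∀ i j, q i j = false then ψ (x, d, r) else 0 := by
  split_ifs with h
  · have : q = fun _ _ => false := funext fun i => funext fun j => h i j
    rw [this]
    exact freshReg_injective.extend_apply ψ 0 (x, d, r)
  · refine Function.extend_apply' _ _ _ ?_
    rintro ⟨⟨x', d', r'⟩, hy⟩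
    simp only [freshReg, Prod.mk.injEq] at hy
    refine h fun i j => ?_
    rw [← (askedReg_injective hy.2.1).2]

theorem coherentState_of_answered (x) (y : ∀ i, CoherentReg (P i) c.ℓ) (r)
    (h : ∃ i z, (y i).1 = .inr z) : coherentState ψ (x, y, r) = 0 := by
  refine Function.extend_apply' _ _ _ ?_
  rintro ⟨⟨x', d', r'⟩, hy⟩
  simp only [freshReg, Prod.mk.injEq] at hy
  obtain ⟨i, z, hz⟩ := h
  rw [← hy.2.1] at hz
  simp [askedReg] at hz

theorem sum_norm_sq_coherentState : ∑ x, ‖coherentState ψ x‖ ^ 2 = ∑ x, ‖ψ x‖ ^ 2 := by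
  symm
  refine Fintype.sum_of_injective freshReg freshReg_injective _ _ (fun y hy => ?_) fun x => ?_
  · rw [coherentState, Function.extend_apply' _ _ _ hy]
    simp
  · rw [coherentState, freshReg_injective.extend_apply]

theorem coherentOps_P_apply (i : Fin k) (x y : CoherentReg (P i) c.ℓ) :
    (coherentOps K).P i x y =
      if x.2 = y.2 then isoReflection (krausIso (K i x.2)) x.1 y.1 else 0 :=
  Matrix.blockDiagonal_apply (fun q => isoReflection (krausIso (K i q))) x y

theorem initMap_mulVec (F : (Fin c.nC → Bool) → ℂ) (w : c.W → Bool) :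
    (c.initMap *ᵥ F) w = if ∀ v, w (.inr v) = false then F (fun i => w (.inl i)) else 0 := by
  rw [Matrix.mulVec, dotProduct, Fintype.sum_eq_single (fun i => w (.inl i))]
  · simp [Verifier.initMap]
  · intro x hx
    rw [Verifier.initMap, Matrix.of_apply, if_neg, zero_mul]
    exact fun h => hx (funext fun i => (h.1 i).symm)

/-- The joint state when the verifier has applied `C_Q`. -/
noncomputable def queryState (w : c.W → Bool) (d : ∀ i, P i) (r : R) : ℂ :=
  ((circuitOp c.queryCircuit * c.initMap) *ᵥ fun x => ψ (x, d, r)) w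

/-- The initial state with the enlarged registers. -/
noncomputable def coherentInitial : ((c.W → Bool) × (∀ i, CoherentReg (P i) c.ℓ)) × R → ℂ :=
  fun y => if ∀ w, y.1.1 (.inr w) = false then
    coherentState ψ (fun i => y.1.1 (.inl i), y.1.2, y.2) else 0

/-- The state when the questions have been sent. -/
noncomputable def stateAsked : ((c.W → Bool) × (∀ i, CoherentReg (P i) c.ℓ)) × R → ℂ :=
  (coherentOps K).run ((allPairs k c.ℓ).map fun p => .query p.1 p.2)
    ((coherentOps K).run (c.queryCircuit.map .verifier) (coherentInitial ψ))

theorem run_queryCircuit (w : c.W → Bool) (x : ∀ i, CoherentReg (P i) c.ℓ) (r : R) :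
    (coherentOps K).run (c.queryCircuit.map .verifier) (coherentInitial ψ) ((w, x), r) =
      ((circuitOp c.queryCircuit * c.initMap) *ᵥ fun y => coherentState ψ (y, x, r)) w := by
  rw [ProverOps.run_verifier, kronecker_one_one_mulVec, ← Matrix.mulVec_mulVec]
  congr 2
  ext w'
  rw [initMap_mulVec]
  rfl

/-- The copies of the questions agree with the message registers. -/
theorem stateAsked_asked (w d q) (r : R) : stateAsked K ψ ((w, askedReg d q), r) =
    if ∀ i j, w (c.msgWire i j) = q i j then queryState ψ w d r else 0 := by
  have h : (fun i => ((askedReg d q i).1, fun j => (askedReg d q i).2 j ^^ w (c.msgWire i j))) =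
      askedReg d fun i j => q i j ^^ w (c.msgWire i j) := rfl
  rw [stateAsked, run_query, h, run_queryCircuit]
  simp only [coherentState_asked, bne_eq_false_iff_eq, eq_comm (a := q _ _)]
  split_ifs with hq
  · rfl
  · exact congrFun (Matrix.mulVec_zero _) w

theorem stateAsked_of_answered (w) (y : ∀ i, CoherentReg (P i) c.ℓ) (r : R)
    (h : ∃ i z, (y i).1 = .inr z) : stateAsked K ψ ((w, y), r) = 0 := by
  rw [stateAsked, run_query, run_queryCircuit]
  have : (fun x => coherentState ψ (x, (fun i => ((y i).1, fun j =>
      (y i).2 j ^^ w (c.msgWire i j))), r)) = 0 :=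
    funext fun x => coherentState_of_answered ψ x _ r h
  rw [this, Matrix.mulVec_zero, Pi.zero_apply]

/-- The state when the provers have recorded their answers. -/
noncomputable def stateAnswered : ((c.W → Bool) × (∀ i, CoherentReg (P i) c.ℓ)) × R → ℂ :=
  (coherentOps K).run ((List.finRange k).map .reflect) (stateAsked K ψ)

/-- The provers apply the Kraus operators of their questions and answers. -/
theorem stateAnswered_answered (w d a q) (r : R) :
    stateAnswered K ψ ((w, answeredReg d a q), r) =
      ∑ d', tensor (fun i => K i (q i) (a i)) d d' * stateAsked K ψ ((w, askedReg d' q), r) := by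
  rw [stateAnswered, ProverOps.run_reflect, one_kronecker_one_mulVec]
  symm
  refine Fintype.sum_of_injective (fun d' => askedReg d' q)
    (fun d' d'' h => (askedReg_injective h).1) _ _ (fun x hx => ?_) fun d' => ?_
  · by_cases h : ∃ i z, (x i).1 = .inr z
    · simp only [stateAsked_of_answered K ψ w x r h, mul_zero]
    · push Not at h
      have hl : ∀ i, ∃ z, (x i).1 = .inl z := fun i => by
        rcases hx : (x i).1 with z | z
        · exact ⟨z, rfl⟩
        · exact absurd hx (h i z)
      choose d' hd' using hl
      have : ∃ i, (x i).2 ≠ q i := by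
        by_contra hq
        push Not at hq
        exact hx ⟨d', funext fun i => Prod.ext (hd' i).symm (hq i).symm⟩
      obtain ⟨i, hi⟩ := this
      have h0 : tensor (coherentOps K).P (answeredReg d a q) x = 0 := by
        rw [tensor, Matrix.of_apply, Finset.prod_eq_zero (Finset.mem_univ i)]
        rw [coherentOps_P_apply, if_neg]
        exact fun h => hi h.symm
      change tensor (coherentOps K).P (answeredReg d a q) x * _ = 0
      rw [h0, zero_mul]
  · have : tensor (coherentOps K).P (answeredReg d a q) (askedReg d' q) =
        tensor (fun i => K i (q i) (a i)) d d' := by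
      simp only [tensor, Matrix.of_apply]
      refine Finset.prod_congr rfl fun i _ => ?_
      have hq : (answeredReg d a q i).2 = (askedReg d' q i).2 := rfl
      rw [coherentOps_P_apply, if_pos hq]
      rfl
    change _ = tensor (coherentOps K).P (answeredReg d a q) (askedReg d' q) * _
    rw [this]

/-- Every prover has recorded an answer. -/
theorem stateAnswered_of_asked (w) (y : ∀ i, CoherentReg (P i) c.ℓ) (r : R)
    (h : ∃ i z, (y i).1 = .inl z) : stateAnswered K ψ ((w, y), r) = 0 := by
  rw [stateAnswered, ProverOps.run_reflect, one_kronecker_one_mulVec]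
  refine Finset.sum_eq_zero fun x _ => ?_
  by_cases hx : ∃ i z, (x i).1 = .inr z
  · simp only [stateAsked_of_answered K ψ w x r hx, mul_zero]
  · push Not at hx
    obtain ⟨i, z, hz⟩ := h
    have h0 : tensor (coherentOps K).P y x = 0 := by
      rw [tensor, Matrix.of_apply, Finset.prod_eq_zero (Finset.mem_univ i)]
      rcases hxi : (x i).1 with z' | z'
      · rw [coherentOps_P_apply, hz, hxi]
        split_ifs <;> rfl
      · exact absurd hxi (hx i z')
    change tensor (coherentOps K).P y x * _ = 0
    rw [h0, zero_mul]

/-- Adding the recorded differences to the messages acts as replacing the questions by the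
answers. -/
theorem isMonomial_replaceMsg (d : ∀ i, P i) (a q : Fin k → Fin c.ℓ → Bool) :
    IsMonomial (c.replaceMsg q a) (fun w => if ∀ i j, w (c.msgWire i j) = a i j then 1 else 0)
      (addDiffs (answeredReg d a q)) := by
  intro x y
  rw [Verifier.replaceMsg, Matrix.of_apply, ← ite_and]
  congr 1
  rw [eq_iff_iff]
  constructor
  · rintro ⟨h1, h2, h3, h4⟩
    refine ⟨funext fun u => ?_, h2⟩
    rcases u with u | u | ⟨i, j⟩
    · exact (h3 u).symm
    · exact (h4 u).symm
    · have h := h2 i j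
      rw [addDiffs, h]
      simp only [answeredReg, CoherentReg.differs]
      rw [← Bool.xor_assoc, Bool.xor_self, Bool.false_xor]
      exact h1 i j
  · rintro ⟨rfl, h2⟩
    refine ⟨fun i j => ?_, h2, fun _ => rfl, fun _ => rfl⟩
    have h := h2 i j
    rw [Verifier.msgWire, addDiffs, h]
    simp only [answeredReg, CoherentReg.differs]
    rw [← Bool.xor_assoc, Bool.xor_self, Bool.false_xor]

/-- The state when the answers have been received. -/
noncomputable def stateReceived : ((c.W → Bool) × (∀ i, CoherentReg (P i) c.ℓ)) × R → ℂ :=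
  (coherentOps K).run ((allPairs k c.ℓ).map fun p => .answer p.1 p.2) (stateAnswered K ψ)

theorem stateReceived_answered (w d a q) (r : R) :
    stateReceived K ψ ((w, answeredReg d a q), r) =
      ∑ d', tensor (fun i => K i (q i) (a i)) d d' *
        (c.replaceMsg q a *ᵥ fun w' => queryState ψ w' d' r) w := by
  rw [stateReceived, run_answer, stateAnswered_answered]
  refine Finset.sum_congr rfl fun d' _ => ?_
  rw [(isMonomial_replaceMsg d a q).mulVec, stateAsked_asked]
  have h : (∀ i j, addDiffs (answeredReg d a q) w (c.msgWire i j) = q i j) ↔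
      ∀ i j, w (c.msgWire i j) = a i j := by
    refine forall_congr' fun i => forall_congr' fun j => ?_
    rw [Verifier.msgWire, addDiffs, Verifier.msgWire]
    simp only [answeredReg, CoherentReg.differs]
    cases w (.inr (.inr (i, j))) <;> cases a i j <;> cases q i j <;> simp
  simp only [h]
  split_ifs <;> simp

/-- The final state of the protocol circuit, with the output qubit projected to `|1⟩`, is given by
the accepting Kraus operators of the game. -/
theorem final_answered (w d a q) (r : R) :
    (if w c.outWire = true then (coherentOps K).run (c.answerCircuit.map .verifier)
      (stateReceived K ψ) ((w, answeredReg d a q), r) else 0) =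
    ((c.acceptKraus q a ⊗ₖ (tensor (fun i => K i (q i) (a i)) ⊗ₖ (1 : Matrix R R ℂ))) *ᵥ ψ)
      (w, d, r) := by
  have h1 : ((c.acceptKraus q a ⊗ₖ (tensor (fun i => K i (q i) (a i)) ⊗ₖ (1 : Matrix R R ℂ))) *ᵥ
      ψ) (w, d, r) = ∑ d', tensor (fun i => K i (q i) (a i)) d d' *
        (c.acceptKraus q a *ᵥ fun x => ψ (x, d', r)) w := by
    simp only [Matrix.mulVec, dotProduct, Fintype.sum_prod_type, Matrix.kroneckerMap_apply,
      Matrix.one_apply, mul_ite, mul_one, mul_zero, ite_mul, zero_mul, Finset.sum_ite_eq,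
      Finset.mem_univ, if_true, Finset.mul_sum]
    rw [Finset.sum_comm]
    refine Finset.sum_congr rfl fun d' _ => Finset.sum_congr rfl fun x _ => ?_
    ring
  have h2 : ∀ d', (c.acceptKraus q a *ᵥ fun x => ψ (x, d', r)) w =
      if w c.outWire = true then (circuitOp c.answerCircuit *ᵥ
        (c.replaceMsg q a *ᵥ fun w' => queryState ψ w' d' r)) w else 0 := by
    intro d'
    have e : (c.acceptKraus q a *ᵥ fun x => ψ (x, d', r)) =
        onQubit c.outWire (proj true) *ᵥ (circuitOp c.answerCircuit *ᵥ
          (c.replaceMsg q a *ᵥ fun w' => queryState ψ w' d' r)) := by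
      have : (fun w' => queryState ψ w' d' r) =
          (circuitOp c.queryCircuit * c.initMap) *ᵥ fun x => ψ (x, d', r) := rfl
      rw [this, Matrix.mulVec_mulVec, Matrix.mulVec_mulVec, Matrix.mulVec_mulVec,
        Verifier.acceptKraus]
      simp only [Matrix.mul_assoc]
    rw [e, (IsMonomial.onQubit_proj c.outWire true).mulVec]
    simp
  rw [h1]
  simp only [h2]
  split_ifs
  · rw [ProverOps.run_verifier, kronecker_one_one_mulVec]
    simp only [stateReceived_answered]
    simp only [Matrix.mulVec, dotProduct, Finset.mul_sum]
    rw [Finset.sum_comm]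
    refine Finset.sum_congr rfl fun d' _ => Finset.sum_congr rfl fun w' _ =>
      Finset.sum_congr rfl fun w'' _ => ?_
    ring
  · simp

theorem final_of_asked (w) (y : ∀ i, CoherentReg (P i) c.ℓ) (r : R)
    (h : ∃ i z, (y i).1 = .inl z) : (coherentOps K).run (c.answerCircuit.map .verifier)
      (stateReceived K ψ) ((w, y), r) = 0 := by
  rw [ProverOps.run_verifier, kronecker_one_one_mulVec]
  have : (fun w' => stateReceived K ψ ((w', y), r)) = 0 := funext fun w' => by
    rw [stateReceived, run_answer, stateAnswered_of_asked K ψ _ y r h, Pi.zero_apply]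
  rw [this, Matrix.mulVec_zero, Pi.zero_apply]

end Coherent

namespace Verifier

variable {k : ℕ} (c : Verifier k)

/-- The measurement strategies of the game of a verifier. -/
abbrev GameStrategy : Type 1 := MeasurementStrategy (Fin k) (Fin c.nC → Bool)
  (fun _ => Fin c.ℓ → Bool) (fun _ _ => Fin c.ℓ → Bool)

variable {c}

/-- The normal form strategy in which the provers measure coherently. -/
noncomputable def coherentStrategy (s : c.GameStrategy)
    (K : ∀ i, (Fin c.ℓ → Bool) → (Fin c.ℓ → Bool) → Matrix (s.P i) (s.P i) ℂ)
    (hK : ∀ i q, ∑ a, (K i q a)ᴴ * K i q a = 1) : NormalFormStrategy c where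
  D i := CoherentReg (s.P i) c.ℓ
  R := s.R
  ψ := coherentState s.ψ
  norm_ψ := (sum_norm_sq_coherentState s.ψ).trans s.norm_ψ
  Q := (coherentOps K).Q
  P := (coherentOps K).P
  A := (coherentOps K).A
  Q_refl := (coherentOps_isReflective K hK).Q
  P_refl := (coherentOps_isReflective K hK).P
  A_refl := (coherentOps_isReflective K hK).A

theorem coherentStrategy_final (s : c.GameStrategy) (K) (hK) :
    (coherentStrategy s K hK).final =
      (coherentOps K).run (c.answerCircuit.map .verifier) (stateReceived K s.ψ) := by
  rw [NormalFormStrategy.final_eq, Verifier.gates, flatMap_map_eq, flatMap_map_eq,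
    ProverOps.run_append, ProverOps.run_append, ProverOps.run_append, ProverOps.run_append]
  rfl

/-- Every measurement strategy has the value of a normal form strategy. -/
theorem exists_normalForm_value_eq (s : c.GameStrategy) :
    ∃ s' : NormalFormStrategy c, s'.value = s.value c.game := by
  choose K hK using fun i q a => exists_conjTranspose_mul_self (s.posSemidef i q a)
  have hK1 : ∀ i q, ∑ a, (K i q a)ᴴ * K i q a = 1 := fun i q => by
    rw [← s.sum_eq_one i q]
    exact Finset.sum_congr rfl fun a _ => (hK i q a).symm
  refine ⟨coherentStrategy s K hK1, ?_⟩
  have hs : s.value c.game = ∑ q : Fin k → Fin c.ℓ → Bool, ∑ a : Fin k → Fin c.ℓ → Bool,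
      ∑ x, ‖((c.acceptKraus q a ⊗ₖ (tensor (fun i => K i (q i) (a i)) ⊗ₖ
        (1 : Matrix s.R s.R ℂ))) *ᵥ s.ψ) x‖ ^ 2 := by
    refine Finset.sum_congr rfl fun q _ => Finset.sum_congr rfl fun a _ => ?_
    rw [← star_dotProduct_self_re, Matrix.star_mulVec, ← Matrix.dotProduct_mulVec,
      Matrix.mulVec_mulVec, Matrix.conjTranspose_kronecker, Matrix.conjTranspose_kronecker,
      ← Matrix.mul_kronecker_mul, ← Matrix.mul_kronecker_mul, tensor_conjTranspose, tensor_mul,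
      Matrix.conjTranspose_one, one_mul]
    simp only [← hK]
    rfl
  -- The questions, the answers and the original registers are all recorded in the final basis
  -- state, so that the outcomes contribute independently to its norm.
  have hι : Function.Injective (fun z : (Fin k → Fin c.ℓ → Bool) × (Fin k → Fin c.ℓ → Bool) ×
      ((c.W → Bool) × (∀ i, s.P i) × s.R) =>
      (((z.2.2.1, answeredReg z.2.2.2.1 z.2.1 z.1), z.2.2.2.2) :
        ((c.W → Bool) × ∀ i, CoherentReg (s.P i) c.ℓ) × s.R)) := by
    rintro ⟨q, a, w, d, r⟩ ⟨q', a', w', d', r'⟩ h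
    simp only [Prod.mk.injEq] at h
    obtain ⟨⟨rfl, h⟩, rfl⟩ := h
    have h1 := fun i => Prod.ext_iff.1 (congrFun h i)
    have h2 := fun i => Prod.ext_iff.1 (Sum.inr_injective (h1 i).1)
    have hq : q = q' := funext fun i => (h1 i).2
    have hd : d = d' := funext fun i => (h2 i).1
    have ha : a = a' := funext fun i => (h2 i).2
    rw [hq, hd, ha]
  rw [hs, NormalFormStrategy.value, coherentStrategy_final]
  simp only [← Fintype.sum_prod_type']
  symm
  refine Fintype.sum_of_injective _ hι _ _ (fun y hy => ?_) ?_
  · have : ∃ i z, (y.1.2 i).1 = .inl z := by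
      by_contra h
      push Not at h
      have hr : ∀ i, ∃ z, (y.1.2 i).1 = .inr z := fun i => by
        rcases hx : (y.1.2 i).1 with z | z
        · exact absurd hx (h i z)
        · exact ⟨z, rfl⟩
      choose z hz using hr
      exact hy ⟨⟨fun i => (y.1.2 i).2, fun i => (z i).2, y.1.1, fun i => (z i).1, y.2⟩,
        Prod.ext (Prod.ext rfl (funext fun i => Prod.ext (hz i).symm rfl)) rfl⟩
    have h0 := final_of_asked K s.ψ y.1.1 y.1.2 y.2 this
    change (if _ then ‖(coherentOps K).run (c.answerCircuit.map .verifier)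
      (stateReceived K s.ψ) ((y.1.1, y.1.2), y.2)‖ ^ 2 else 0) = 0
    rw [h0]
    simp
  · rintro ⟨q, a, w, d, r⟩
    rw [← final_answered K s.ψ w d a q r]
    split_ifs <;> simp

/-! ### The value of the game -/

/-- A normal form strategy without entanglement whose reflections are trivial. -/
noncomputable def trivialStrategy (c : Verifier k) : NormalFormStrategy c where
  D _ := Unit
  R := Unit
  ψ := Pi.single (fun _ => false, fun _ => (), ()) 1
  norm_ψ := by
    rw [Fintype.sum_eq_single (fun _ => false, fun _ => (), ())]
    · simp
    · intro x hx
      simp [hx]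
  Q _ _ := 1
  P _ := 1
  A _ _ := 1
  Q_refl _ _ := .one
  P_refl _ := .one
  A_refl _ _ := .one

/-- Normal form strategies alone determine the value of the game. -/
theorem omega_eq (c : Verifier k) :
    c.omega = sSup {v | ∃ s : NormalFormStrategy c, v = s.value} := by
  rw [omega]
  congr 1
  refine Set.union_eq_right.2 ?_
  rintro v ⟨s, rfl⟩
  obtain ⟨s', hs'⟩ := exists_normalForm_value_eq s
  exact ⟨s', hs'.symm⟩

theorem value_le_omega (s : NormalFormStrategy c) : s.value ≤ c.omega := by
  rw [omega_eq]
  refine le_csSup ⟨1, ?_⟩ ⟨s, rfl⟩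
  rintro v ⟨s', rfl⟩
  exact s'.value_le_one

theorem omega_le_one (c : Verifier k) : c.omega ≤ 1 := by
  rw [omega_eq]
  refine csSup_le ⟨_, c.trivialStrategy, rfl⟩ ?_
  rintro v ⟨s', rfl⟩
  exact s'.value_le_one

theorem omega_nonneg (c : Verifier k) : 0 ≤ c.omega :=
  c.trivialStrategy.value_nonneg.trans (value_le_omega _)

theorem exists_lt_value (c : Verifier k) {x : ℝ} (hx : x < c.omega) :
    ∃ s : NormalFormStrategy c, x < s.value := by
  rw [omega_eq] at hx
  have hne : {v | ∃ s : NormalFormStrategy c, v = s.value}.Nonempty :=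
    ⟨_, c.trivialStrategy, rfl⟩
  obtain ⟨v, ⟨s, rfl⟩, hv⟩ := exists_lt_of_lt_csSup hne hx
  exact ⟨s, hv⟩

end Verifier

/-! ### Soundness -/

section Norm

variable {J : Type} [Fintype J]

theorem sum_norm_sq_nonneg (v : J → ℂ) : 0 ≤ ∑ y, ‖v y‖ ^ 2 :=
  Finset.sum_nonneg fun _ _ => by positivity

theorem sum_norm_sq_ite_nonneg (p : J → Prop) [DecidablePred p] (v : J → ℂ) :
    0 ≤ ∑ y, if p y then ‖v y‖ ^ 2 else 0 :=
  Finset.sum_nonneg fun y _ => by split_ifs <;> positivity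

theorem norm_sq_le_two_mul (a b : ℂ) : ‖a‖ ^ 2 ≤ 2 * ‖b‖ ^ 2 + 2 * ‖b - a‖ ^ 2 := by
  have h : ‖a‖ ≤ ‖b‖ + ‖b - a‖ := by
    rw [norm_sub_rev]
    simpa using norm_add_le b (a - b)
  nlinarith [norm_nonneg a, norm_nonneg b, norm_nonneg (b - a), sq_nonneg (‖b‖ - ‖b - a‖)]

theorem sum_ite_norm_sq_le (p : J → Prop) [DecidablePred p] (u v : J → ℂ) :
    (∑ y, if p y then ‖u y‖ ^ 2 else 0) ≤
      2 * (∑ y, if p y then ‖v y‖ ^ 2 else 0) + 2 * ∑ y, ‖(v - u) y‖ ^ 2 := by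
  rw [Finset.mul_sum, Finset.mul_sum, ← Finset.sum_add_distrib]
  refine Finset.sum_le_sum fun y _ => ?_
  split_ifs
  · exact norm_sq_le_two_mul _ _
  · rw [mul_zero, zero_add]; positivity

end Norm

/-- The arithmetic of the soundness bound. Here `x` is the gap of the value of the game, `A` and
`Δ` are the squared norm of the start of the simulated run and its squared distance from the clock
components of the strategy, and `S`, `I`, `O` are the propagation, input and output terms. -/
theorem soundness_arith {p m x A Δ S I O ε : ℝ} (hp : 1 ≤ p) (hm : 0 < m) (hmp : m ≤ p)
    (hx0 : 0 ≤ x) (hx1 : x ≤ 1) (hS : 0 ≤ S) (hI : 0 ≤ I) (hO : 0 ≤ O)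
    (hε : ε = (12 * p)⁻¹ * S + (3 * m)⁻¹ * I + 3⁻¹ * O)
    (hΔ : Δ ≤ 2 * I + 2 * (p * S)) (hA : x * A ≤ 2 * O + 2 * Δ)
    (h1 : 1 ≤ (p + 1) * (2 * A + 2 * Δ)) : x ≤ 1000 * p ^ 3 * ε := by
  have hp0 : 0 < p := by linarith
  have hS' : 0 ≤ (12 * p)⁻¹ * S := by positivity
  have hI' : 0 ≤ (3 * m)⁻¹ * I := by positivity
  have hO' : 0 ≤ 3⁻¹ * O := by positivity
  have hε0 : 0 ≤ ε := by rw [hε]; positivity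
  have hSε : S ≤ 12 * p * ε := by
    have : S = 12 * p * ((12 * p)⁻¹ * S) := by field_simp
    rw [this]
    exact mul_le_mul_of_nonneg_left (by linarith) (by positivity)
  have hIε : I ≤ 3 * p * ε := by
    have : I = 3 * m * ((3 * m)⁻¹ * I) := by field_simp
    calc I = 3 * m * ((3 * m)⁻¹ * I) := this
      _ ≤ 3 * m * ε := mul_le_mul_of_nonneg_left (by linarith) (by positivity)
      _ ≤ 3 * p * ε := by gcongr
  have hOε : O ≤ 3 * ε := by linarith
  have hpp : p * ε ≤ p ^ 2 * ε := mul_le_mul_of_nonneg_right (by nlinarith) hε0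
  have hp1 : ε ≤ p ^ 2 * ε := by nlinarith
  have hΔε : Δ ≤ 30 * (p ^ 2 * ε) := by
    have : p * S ≤ 12 * (p ^ 2 * ε) := by nlinarith
    linarith
  have hAε : x * A ≤ 66 * (p ^ 2 * ε) := by linarith
  have hxΔ : x * Δ ≤ 30 * (p ^ 2 * ε) := by
    have : 0 ≤ 30 * (p ^ 2 * ε) := by positivity
    nlinarith
  calc x = x * 1 := (mul_one x).symm
    _ ≤ x * ((p + 1) * (2 * A + 2 * Δ)) := mul_le_mul_of_nonneg_left h1 hx0
    _ = (p + 1) * (2 * (x * A) + 2 * (x * Δ)) := by ring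
    _ ≤ (p + 1) * (192 * (p ^ 2 * ε)) := mul_le_mul_of_nonneg_left (by linarith) (by linarith)
    _ ≤ (2 * p) * (192 * (p ^ 2 * ε)) :=
      mul_le_mul_of_nonneg_right (by linarith) (by positivity)
    _ ≤ 1000 * p ^ 3 * ε := by nlinarith [show 0 ≤ p ^ 3 * ε by positivity]

/-- Two histories that are propagated by isometries drift apart by the propagation errors. -/
theorem norm_sub_le_add_sum {E : Type} [NormedAddCommGroup E] (f g : ℕ → E) (U : ℕ → E → E)
    (hU : ∀ t u v, ‖U t u - U t v‖ = ‖u - v‖) (p : ℕ) (hg : ∀ t < p, g (t + 1) = U t (g t)) (t : ℕ)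
    (ht : t ≤ p) :
    ‖f t - g t‖ ≤ ‖f 0 - g 0‖ + ∑ i ∈ Finset.range p, ‖f (i + 1) - U i (f i)‖ := by
  have h : ∀ t ≤ p, ‖f t - g t‖ ≤
      ‖f 0 - g 0‖ + ∑ i ∈ Finset.range t, ‖f (i + 1) - U i (f i)‖ := by
    intro t
    induction t with
    | zero => intro _; simp
    | succ t ih =>
      intro ht
      rw [Finset.sum_range_succ, hg t ht]
      have h1 := norm_sub_le_norm_sub_add_norm_sub (f (t + 1)) (U t (f t)) (U t (g t))
      rw [hU] at h1
      have := ih (by omega)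
      linarith
  refine (h t ht).trans (add_le_add_right ?_ _)
  exact Finset.sum_le_sum_of_subset_of_nonneg (Finset.range_mono ht) fun _ _ _ => norm_nonneg _

namespace ProverOps

variable {k : ℕ} {c : ProtocolCircuit k} {D : Fin k → Type} [∀ i, Fintype (D i)]
  [∀ i, DecidableEq (D i)] (o : ProverOps c.toVerifier D) {R : Type} [Fintype R] [DecidableEq R]

/-- The projection to the space of initial states. -/
noncomputable def projInitial (v : ((c.W → Bool) × (∀ i, D i)) × R → ℂ) :
    ((c.W → Bool) × (∀ i, D i)) × R → ℂ :=
  fun y => if ∀ w, y.1.1 (.inr w) = false then v y else 0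

variable {o}

/-- The run of the protocol circuit that starts in the projection of any vector to the space of
initial states outputs `0` with at least the weight prescribed by the value of the game. -/
theorem IsReflective.omega_gap (ho : o.IsReflective) (v : ((c.W → Bool) × (∀ i, D i)) × R → ℂ) :
    (1 - c.omega) * ∑ y, ‖projInitial v y‖ ^ 2 ≤
      ∑ y, if y.1.1 c.outWire = false then ‖o.run c.gates (projInitial v) y‖ ^ 2 else 0 := by
  set A := ∑ y, ‖projInitial v y‖ ^ 2 with hA
  have hA0 : 0 ≤ A := sum_norm_sq_nonneg _
  rcases hA0.eq_or_lt with h0 | hpos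
  · rw [← h0, mul_zero]
    exact sum_norm_sq_ite_nonneg _ _
  have hr : ‖((√A : ℝ) : ℂ)⁻¹‖ ^ 2 = A⁻¹ := by
    rw [norm_inv, Complex.norm_real, Real.norm_eq_abs, inv_pow, sq_abs, Real.sq_sqrt hA0]
  have hsum : ∑ x, ‖v (NormalFormStrategy.embed x)‖ ^ 2 = A := by
    refine Fintype.sum_of_injective NormalFormStrategy.embed
      NormalFormStrategy.embed_injective _ _ (fun y hy => ?_) fun x => ?_
    · rw [projInitial, if_neg]
      · simp
      · exact fun h => hy ⟨_, NormalFormStrategy.embed_of_zero y h⟩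
    · have h : ∀ w, (NormalFormStrategy.embed (c := c.toVerifier) x).1.1 (.inr w) = false :=
        fun w => rfl
      rw [projInitial, if_pos h]
  let s : NormalFormStrategy c.toVerifier :=
    { D := D
      R := R
      ψ := fun x => ((√A : ℝ) : ℂ)⁻¹ * v (NormalFormStrategy.embed x)
      norm_ψ := by
        simp only [norm_mul, mul_pow, hr]
        rw [← Finset.mul_sum, hsum, inv_mul_cancel₀ hpos.ne']
      Q := o.Q
      P := o.P
      A := o.A
      Q_refl := ho.Q
      P_refl := ho.P
      A_refl := ho.A }
  have hi : s.initial = ((√A : ℝ) : ℂ)⁻¹ • projInitial v := by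
    ext y
    rw [Pi.smul_apply, smul_eq_mul, NormalFormStrategy.initial, projInitial]
    split_ifs with h
    · change _ * v (NormalFormStrategy.embed _) = _
      rw [NormalFormStrategy.embed_of_zero y h]
    · rw [mul_zero]
  have hf : s.final = ((√A : ℝ) : ℂ)⁻¹ • o.run c.gates (projInitial v) := by
    rw [s.final_eq, hi]
    exact o.run_smul _ _ _
  have hv := Verifier.value_le_omega s
  rw [s.value_eq_one_sub, hf] at hv
  simp only [Pi.smul_apply, smul_eq_mul, norm_mul, mul_pow, hr] at hv
  have he : (∑ y, if y.1.1 c.outWire = false then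
      A⁻¹ * ‖o.run c.gates (projInitial v) y‖ ^ 2 else 0) = A⁻¹ * ∑ y,
        if y.1.1 c.outWire = false then ‖o.run c.gates (projInitial v) y‖ ^ 2 else 0 := by
    rw [Finset.mul_sum]
    refine Finset.sum_congr rfl fun y _ => ?_
    split_ifs <;> simp
  have hv' : 1 - c.omega ≤ A⁻¹ * ∑ y,
      if y.1.1 c.outWire = false then ‖o.run c.gates (projInitial v) y‖ ^ 2 else 0 := by
    rw [← he]; linarith
  rwa [inv_mul_eq_div, le_div_iff₀ hpos] at hv'

/-- The weight outside the space of initial states is at most the sum over the qubits of `V` and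
`M` of the weights on `|1⟩`. -/
theorem sum_norm_sq_sub_projInitial_le (v : ((c.W → Bool) × (∀ i, D i)) × R → ℂ) :
    ∑ y, ‖(v - projInitial v) y‖ ^ 2 ≤
      ∑ j, ∑ y, if y.1.1 (.inr j) = true then ‖v y‖ ^ 2 else 0 := by
  rw [Finset.sum_comm]
  refine Finset.sum_le_sum fun y _ => ?_
  rw [Pi.sub_apply, projInitial]
  split_ifs with h
  · rw [sub_self, norm_zero, zero_pow two_ne_zero]
    exact Finset.sum_nonneg fun j _ => by split_ifs <;> positivity
  · push Not at h
    obtain ⟨j, hj⟩ := h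
    rw [Bool.ne_false_iff] at hj
    rw [sub_zero]
    refine le_trans ?_ (Finset.single_le_sum (f := fun j => if y.1.1 (.inr j) = true then
      ‖v y‖ ^ 2 else 0) (fun i _ => ?_) (Finset.mem_univ j))
    · simp only [if_pos hj]; exact le_rfl
    · positivity

/-- A vector with small propagation, input and output terms is close to the history of a run of
the protocol circuit, so that the value of the game is close to `1`. -/
theorem IsReflective.one_sub_omega_le (ho : o.IsReflective)
    (φ : c.Clock → ((c.W → Bool) × (∀ i, D i)) × R → ℂ) (hφ : ∑ t, ∑ y, ‖φ t y‖ ^ 2 = 1) :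
    1 - c.omega ≤ 1000 * (c.size : ℝ) ^ 3 *
      ((12 * (c.size : ℝ))⁻¹ * ∑ t : Fin c.size,
        ∑ y, ‖(φ t.succ - o.fullOp R (c.gates.get t) *ᵥ φ t.castSucc) y‖ ^ 2
      + (3 * ((c.nV + k * c.ℓ : ℕ) : ℝ))⁻¹ * ∑ j, ∑ y,
          (if y.1.1 (.inr j) = true then ‖φ 0 y‖ ^ 2 else 0)
      + 3⁻¹ * ∑ y, if y.1.1 c.outWire = false then ‖φ (Fin.last _) y‖ ^ 2 else 0) := by
  let f : ℕ → EuclideanSpace ℂ (((c.W → Bool) × (∀ i, D i)) × R) := fun t =>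
    if h : t < c.size + 1 then WithLp.toLp 2 (φ ⟨t, h⟩) else 0
  let g : ℕ → EuclideanSpace ℂ (((c.W → Bool) × (∀ i, D i)) × R) := fun t =>
    WithLp.toLp 2 (o.run (c.gates.take t) (projInitial (φ 0)))
  let U : ℕ → EuclideanSpace ℂ (((c.W → Bool) × (∀ i, D i)) × R) →
      EuclideanSpace ℂ (((c.W → Bool) × (∀ i, D i)) × R) := fun t v =>
    if h : t < c.size then WithLp.toLp 2 (o.fullOp R (c.gates.get ⟨t, h⟩) *ᵥ v.ofLp) else v
  have hU : ∀ t u v, ‖U t u - U t v‖ = ‖u - v‖ := by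
    intro t u v
    by_cases h : t < c.size
    · simp only [U, dif_pos h]
      rw [← sq_eq_sq₀ (norm_nonneg _) (norm_nonneg _), ← WithLp.toLp_sub, ← Matrix.mulVec_sub,
        norm_toLp_sq, (ho.fullOp _).sum_norm_sq, EuclideanSpace.norm_sq_eq]
      rfl
    · simp only [U, dif_neg h]
  have hg : ∀ t < c.size, g (t + 1) = U t (g t) := by
    intro t ht
    simp only [g, U, dif_pos ht]
    rw [o.run_take_succ _ t ht]
  have hdrift := norm_sub_le_add_sum f g U hU c.size hg
  set Δ := (‖f 0 - g 0‖ + ∑ i ∈ Finset.range c.size, ‖f (i + 1) - U i (f i)‖) ^ 2 with hΔ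
  have hdist : ∀ t : c.Clock,
      ∑ y, ‖(φ t - o.run (c.gates.take t) (projInitial (φ 0))) y‖ ^ 2 ≤ Δ := by
    intro t
    have h := hdrift t (Nat.lt_succ_iff.1 t.2)
    have h2 := pow_le_pow_left₀ (norm_nonneg _) h 2
    rw [← hΔ] at h2
    simp only [f, g, dif_pos t.2] at h2
    rwa [← WithLp.toLp_sub, norm_toLp_sq] at h2
  have hm0 : 0 < c.nV + k * c.ℓ := by have := c.nV_pos; omega
  have hmp : c.nV + k * c.ℓ ≤ c.size := by
    have := c.wires_le_size
    rw [Verifier.numVerifierWires] at this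
    exact le_trans (by omega) this
  refine soundness_arith (p := c.size) (A := ∑ y, ‖projInitial (φ 0) y‖ ^ 2) (Δ := Δ)
    (by exact_mod_cast c.size_pos) (by exact_mod_cast hm0) (by exact_mod_cast hmp)
    (sub_nonneg.2 c.omega_le_one) (sub_le_self _ c.omega_nonneg)
    (Finset.sum_nonneg fun t _ => sum_norm_sq_nonneg _)
    (Finset.sum_nonneg fun j _ => sum_norm_sq_ite_nonneg _ _) (sum_norm_sq_ite_nonneg _ _) rfl
    ?_ ?_ ?_
  · have h0 : ‖f 0 - g 0‖ ^ 2 ≤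
        ∑ j, ∑ y, if y.1.1 (.inr j) = true then ‖φ 0 y‖ ^ 2 else 0 := by
      refine le_trans (le_of_eq ?_) (sum_norm_sq_sub_projInitial_le (φ 0))
      simp only [f, g, dif_pos (Nat.succ_pos c.size)]
      rw [← WithLp.toLp_sub, norm_toLp_sq]
      rfl
    have h1 : (∑ i ∈ Finset.range c.size, ‖f (i + 1) - U i (f i)‖) ^ 2 ≤
        c.size * ∑ t : Fin c.size,
          ∑ y, ‖(φ t.succ - o.fullOp R (c.gates.get t) *ᵥ φ t.castSucc) y‖ ^ 2 := by
      refine sq_sum_le_card_mul_sum_sq.trans (le_of_eq ?_)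
      rw [Finset.card_range, Finset.sum_range]
      congr 1
      refine Finset.sum_congr rfl fun t _ => ?_
      have ht1 : (t : ℕ) + 1 < c.size + 1 := Nat.succ_lt_succ t.2
      have ht0 : (t : ℕ) < c.size + 1 := t.2.trans (Nat.lt_succ_self _)
      simp only [f, U, dif_pos ht1, dif_pos ht0, dif_pos t.2]
      rw [← WithLp.toLp_sub, norm_toLp_sq]
      rfl
    rw [hΔ]
    nlinarith [sq_nonneg (‖f 0 - g 0‖ - ∑ i ∈ Finset.range c.size, ‖f (i + 1) - U i (f i)‖)]
  · refine (ho.omega_gap (φ 0)).trans ((sum_ite_norm_sq_le _ _ (φ (Fin.last _))).trans ?_)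
    have h := hdist (Fin.last _)
    have e : c.gates.take ((Fin.last c.size : c.Clock) : ℕ) = c.gates := List.take_length
    rw [e] at h
    linarith
  · calc (1 : ℝ) = ∑ t : c.Clock, ∑ y, ‖φ t y‖ ^ 2 := hφ.symm
      _ ≤ ∑ _t : c.Clock, (2 * ∑ y, ‖projInitial (φ 0) y‖ ^ 2 + 2 * Δ) := by
        refine Finset.sum_le_sum fun t _ => ?_
        have h := sum_ite_norm_sq_le (fun _ => True) (φ t)
          (o.run (c.gates.take t) (projInitial (φ 0)))
        simp only [if_true] at h
        rw [ho.sum_norm_sq_run] at h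
        have h2 := hdist t
        have h3 : ∑ y, ‖(o.run (c.gates.take t) (projInitial (φ 0)) - φ t) y‖ ^ 2 =
            ∑ y, ‖(φ t - o.run (c.gates.take t) (projInitial (φ 0))) y‖ ^ 2 :=
          Finset.sum_congr rfl fun y _ => by rw [Pi.sub_apply, norm_sub_rev, Pi.sub_apply]
        linarith
      _ = _ := by
        rw [Finset.sum_const, Finset.card_univ, Fintype.card_fin, nsmul_eq_mul]
        push_cast
        ring

end ProverOps

section Submatrix

variable {ι : Type} [Fintype ι] [DecidableEq ι] {d d' : ι → Type} [∀ i, DecidableEq (d i)]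
  [∀ i, DecidableEq (d' i)] [∀ i, Fintype (d i)] [∀ i, Fintype (d' i)]

theorem onSite_submatrix {f : ∀ i, d i → d' i} (hf : ∀ i, Function.Injective (f i)) (i : ι)
    (A : Matrix (d' i) (d' i) ℂ) :
    (onSite i A).submatrix (Pi.map f) (Pi.map f) = onSite i (A.submatrix (f i) (f i)) := by
  ext x y
  simp only [Matrix.submatrix_apply, onSite_apply, Pi.map_apply, (hf _).eq_iff]

end Submatrix

namespace ProverOps

variable {k : ℕ} {c : Verifier k} {D D' : Fin k → Type} [∀ i, Fintype (D i)]
  [∀ i, DecidableEq (D i)] [∀ i, Fintype (D' i)] [∀ i, DecidableEq (D' i)]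

/-- Gates whose observables are compressions of others are compressions themselves, as every gate
is affine in a single observable. -/
theorem gateOp_submatrix {f : ∀ i, D i → D' i} (hf : ∀ i, Function.Injective (f i))
    {o : ProverOps c D} {o' : ProverOps c D'}
    (hQ : ∀ i j, (o'.Q i j).submatrix (f i) (f i) = o.Q i j)
    (hP : ∀ i, (o'.P i).submatrix (f i) (f i) = o.P i)
    (hA : ∀ i j, (o'.A i j).submatrix (f i) (f i) = o.A i j) (g : Gate c.W k c.ℓ) :
    (o'.gateOp g).submatrix (Prod.map id (Pi.map f)) (Prod.map id (Pi.map f)) = o.gateOp g := by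
  have h1 : (1 : Matrix (∀ i, D' i) (∀ i, D' i) ℂ).submatrix (Pi.map f) (Pi.map f) = 1 :=
    Matrix.submatrix_one _ (Function.Injective.piMap hf)
  cases g with
  | verifier g =>
    rw [gateOp, gateOp, ← h1]
    rfl
  | query i j =>
    rw [gateOp, gateOp, ← h1, ← hQ, ← onSite_submatrix hf]
    rfl
  | answer i j =>
    rw [gateOp, gateOp, ← h1, ← hA, ← onSite_submatrix hf]
    rfl
  | reflect i =>
    rw [gateOp, gateOp, ← hP, ← onSite_submatrix hf]
    rfl

end ProverOps

namespace HPStrategy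

variable {k : ℕ} {c : ProtocolCircuit k} (s : c.HonestStrategy)

/-- The observables of the provers are compressions of reflections. -/
theorem exists_dilation : ∃ o : ProverOps c.toVerifier
      (fun i => s.P (some i) ⊕ s.P (some i) × Bool), o.IsReflective ∧
    ∀ g, (o.gateOp g).submatrix (Prod.map id (Pi.map fun _ => Sum.inl))
      (Prod.map id (Pi.map fun _ => Sum.inl)) = (obs s).gateOp g := by
  have h : ∀ (i : Fin k) (q : ProverQuestion c.ℓ), ∃ R : Matrix (s.P (some i) ⊕ s.P (some i) × Bool)
      (s.P (some i) ⊕ s.P (some i) × Bool) ℂ, IsReflection R ∧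
      R.submatrix Sum.inl Sum.inl = s.M (some i) q false - s.M (some i) q true := fun i q =>
    exists_reflection_dilation (M := s.M (some i) q) (s.posSemidef (some i) q) (s.M_add i q)
  choose R hR hM using h
  refine ⟨⟨fun i j => R i (.query j), fun i => R i .star, fun i j => R i (.answer j)⟩,
    ⟨fun i j => hR _ _, fun i => hR _ _, fun i j => hR _ _⟩, fun g => ?_⟩
  exact ProverOps.gateOp_submatrix (fun _ => Sum.inl_injective) (fun i j => hM _ _)
    (fun i => hM _ _) (fun i j => hM _ _) g

theorem sum_norm_sq_slice (e : s.P none ≃ (Fin c.size → Bool)) :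
    ∑ t, ∑ y, ‖slice s e t y‖ ^ 2 = 1 := by
  rw [← s.norm_ψ, Fintype.sum_prod_type (f := fun x => ‖s.ψ x‖ ^ 2)]
  exact Finset.sum_congr rfl fun t _ =>
    (c.regEquiv e s.R).symm.sum_comp fun x => ‖s.ψ (t, x)‖ ^ 2

/-- The clock components of an honest Pauli strategy, extended by zero to the dilated registers,
have the propagation, input and output terms of the strategy itself. -/
theorem one_sub_omega_le {e : s.P none ≃ (Fin c.size → Bool)}
    (he : ∀ (q : PauliQuestion c.size) (a : Fin q.num → Bool),
      s.M none q a = (q.measure a).submatrix e e) :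
    1 - c.omega ≤ 1000 * (c.size : ℝ) ^ 3 * (1 - s.value c.honestPauliGame) := by
  obtain ⟨o, ho, hg⟩ := exists_dilation s
  let ι : ((c.W → Bool) × (∀ i : Fin k, s.P (some i))) × (s.R × (c.Spare → Bool)) →
      ((c.W → Bool) × (∀ i : Fin k, s.P (some i) ⊕ s.P (some i) × Bool)) ×
        (s.R × (c.Spare → Bool)) := Prod.map (Prod.map id (Pi.map fun _ => Sum.inl)) id
  have hι : Function.Injective ι := ((Function.injective_id.prodMap
    (Function.Injective.piMap fun _ => Sum.inl_injective)).prodMap Function.injective_id)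
  have hop : ∀ g, (o.fullOp (s.R × (c.Spare → Bool)) g).submatrix ι ι =
      (obs s).gateOp g ⊗ₖ 1 := by
    intro g
    rw [← hg]
    rfl
  let φ : c.Clock → _ → ℂ := fun t => Function.extend ι (slice s e t) 0
  have hsum : ∀ (q : (c.W → Bool) → Prop) [DecidablePred q] (t : c.Clock),
      ∑ y, (if q y.1.1 then ‖φ t y‖ ^ 2 else 0) =
        ∑ y, if q y.1.1 then ‖slice s e t y‖ ^ 2 else 0 := by
    intro q _ t
    symm
    refine Fintype.sum_of_injective ι hι _ _ (fun y hy => ?_) fun y => ?_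
    · simp only [φ, Function.extend_apply' _ _ _ hy, Pi.zero_apply, norm_zero]
      simp
    · simp only [φ, hι.extend_apply]
      rfl
  have hnorm : ∀ t, ∑ y, ‖φ t y‖ ^ 2 = ∑ y, ‖slice s e t y‖ ^ 2 := by
    intro t
    simpa using hsum (fun _ => True) t
  have h1 : ∑ t, ∑ y, ‖φ t y‖ ^ 2 = 1 := by
    rw [← sum_norm_sq_slice s e]
    exact Finset.sum_congr rfl fun t _ => hnorm t
  have hA : ∀ t : Fin c.size,
      ∑ y, ‖(φ t.succ - o.fullOp _ (c.gates.get t) *ᵥ φ t.castSucc) y‖ ^ 2 =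
        ∑ y, ‖slice s e t.castSucc y‖ ^ 2 + ∑ y, ‖slice s e t.succ y‖ ^ 2
          - (star (slice s e t.castSucc) ⬝ᵥ (((obs s).gateOp (c.gates.get t) ⊗ₖ
              (1 : Matrix (s.R × (c.Spare → Bool)) (s.R × (c.Spare → Bool)) ℂ)) *ᵥ
                slice s e t.succ)).re
          - (star (slice s e t.succ) ⬝ᵥ (((obs s).gateOp (c.gates.get t) ⊗ₖ
              (1 : Matrix (s.R × (c.Spare → Bool)) (s.R × (c.Spare → Bool)) ℂ)) *ᵥ
                slice s e t.castSucc)).re := by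
    intro t
    rw [sum_norm_sq_sub_mulVec (ho.fullOp _), hnorm, hnorm, star_extend_dotProduct hι,
      star_extend_dotProduct hι, hop]
    ring
  have hB : ∀ j, ∑ y, (if y.1.1 (.inr j) = true then ‖φ 0 y‖ ^ 2 else 0) =
      ∑ y, (if y.1.1 (.inr j) = true then ‖slice s e 0 y‖ ^ 2 else 0) :=
    fun j => hsum (fun x => x (.inr j) = true) 0
  have hC := hsum (fun x => x c.outWire = false) (Fin.last _)
  have h := ho.one_sub_omega_le φ h1
  rw [Finset.sum_congr rfl fun t _ => hA t, Finset.sum_congr rfl fun j _ => hB j, hC] at h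
  rwa [one_sub_value he]

/-- The soundness bound. It is weaker than `one_sub_omega_le`, as `(1 - ω)³ ≤ 1 - ω`. -/
theorem IsHonest.value_le {s : c.HonestStrategy} (h : HPStrategy.IsHonest s) :
    s.value c.honestPauliGame ≤ 1 - ((1 - c.omega) / (10 * (c.size : ℝ))) ^ (3 : ℝ) := by
  obtain ⟨e, he⟩ := h
  have h1 := one_sub_omega_le s he
  have hp : (0 : ℝ) < c.size := Nat.cast_pos.2 c.size_pos
  have h0 : 0 ≤ 1 - c.omega := sub_nonneg.2 c.omega_le_one
  have h3 : (1 - c.omega) ^ 3 ≤ 1 - c.omega :=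
    pow_le_of_le_one h0 (sub_le_self _ c.omega_nonneg) (by norm_num)
  have e3 : ((1 - c.omega) / (10 * (c.size : ℝ))) ^ (3 : ℝ) =
      (1 - c.omega) ^ 3 / (1000 * (c.size : ℝ) ^ 3) := by
    rw [show (3 : ℝ) = ((3 : ℕ) : ℝ) by norm_num, Real.rpow_natCast, div_pow, mul_pow]
    norm_num
  rw [e3, le_sub_comm, div_le_iff₀ (by positivity)]
  linarith

end HPStrategy

/-! ### Projective measurements -/

section Measurements

variable {n : Type} [Fintype n] [DecidableEq n]

theorem eigenProj_isStarProjection {O : Matrix n n ℂ} (h : IsReflection O) (a : Bool) :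
    IsStarProjection (eigenProj a O) := by
  have hs : star O = O := h.1.eq
  have h2 : O * O = 1 := h.2
  refine ⟨?_, ?_⟩
  · rw [IsIdempotentElem, eigenProj]
    simp only [Matrix.smul_mul, Matrix.mul_smul, add_mul, mul_add, h2, one_mul, mul_one]
    cases a <;> simp only [if_true, Bool.false_eq_true, if_false] <;> module
  · rw [IsSelfAdjoint, eigenProj, star_smul, star_add, star_smul, hs, star_one]
    cases a <;> simp

theorem eigenProj_add (O : Matrix n n ℂ) : eigenProj false O + eigenProj true O = 1 := by
  rw [eigenProj_false, sub_add_cancel]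

theorem eigenProj_sub (O : Matrix n n ℂ) : eigenProj false O - eigenProj true O = O := by
  rw [eigenProj_false, eigenProj_true]; module

theorem posSemidef_of_isStarProjection {A : Matrix n n ℂ} (h : IsStarProjection A) :
    A.PosSemidef := by
  have e : Aᴴ * A = A := by
    rw [← Matrix.star_eq_conjTranspose, h.isSelfAdjoint.star_eq, h.isIdempotentElem.eq]
  rw [← e]
  exact Matrix.posSemidef_conjTranspose_mul_self A

theorem eigenProj_commute {O O' : Matrix n n ℂ} (h : Commute O O') (a b : Bool) :
    Commute (eigenProj a O) (eigenProj b O') :=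
  (((Commute.one_left _).add_left (((Commute.one_right _).add_right (h.smul_right _)).smul_left _)
    ).smul_left _).smul_right _

/-- A product of commuting projectors is a projector. -/
theorem isStarProjection_list_prod {J : Type} (f : J → Matrix n n ℂ)
    (hf : ∀ j, IsStarProjection (f j)) (hc : ∀ j j', Commute (f j) (f j')) (l : List J) :
    IsStarProjection (l.map f).prod := by
  induction l with
  | nil => exact .one _
  | cons j l ih =>
    rw [List.map_cons, List.prod_cons]
    refine (hf j).mul ih ?_
    refine Commute.list_prod_right _ _ fun x hx => ?_
    obtain ⟨j', _, rfl⟩ := List.mem_map.1 hx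
    exact hc j j'

/-- The joint measurement given by a list of two-outcome measurements is complete. -/
theorem sum_list_prod_eq_one {m : ℕ} (F : Fin m → Bool → Matrix n n ℂ)
    (hF : ∀ j, F j false + F j true = 1) :
    ∑ a : Fin m → Bool, ((List.finRange m).map fun j => F j (a j)).prod = 1 := by
  induction m with
  | zero => rw [sum_bool_fin_zero]; rfl
  | succ m ih =>
    rw [sum_bool_fin_succ, ← ih (fun j => F j.succ) fun j => hF j.succ]
    refine Finset.sum_congr rfl fun a _ => ?_
    rw [List.finRange_succ, List.map_cons, List.map_cons, List.prod_cons, List.prod_cons,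
      List.map_map, List.map_map]
    simp only [Matrix.cons_val_zero]
    change F 0 false * (List.map (fun j : Fin m => F j.succ (a j)) _).prod +
      F 0 true * (List.map (fun j : Fin m => F j.succ (a j)) _).prod = _
    rw [← add_mul, hF, one_mul]

end Measurements

theorem isReflection_pauliOp {S : ℕ} (W : Fin S → Pauli) : IsReflection (pauliOp W) := by
  constructor
  · rw [Matrix.IsHermitian, pauliOp, tensor_conjTranspose]
    simp only [(Pauli.isReflection_mat _).1.eq]
  · rw [pauliOp, tensor_mul]
    simp only [(Pauli.isReflection_mat _).2]
    exact tensor_one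

namespace PauliQuestion

variable {S : ℕ} (q : PauliQuestion S)

theorem measure_posSemidef (a : Fin q.num → Bool) : (q.measure a).PosSemidef :=
  posSemidef_of_isStarProjection <|
    isStarProjection_list_prod (fun j => eigenProj (a j) (pauliOp (q.obs j)))
      (fun _ => eigenProj_isStarProjection (isReflection_pauliOp _) _)
      (fun j j' => eigenProj_commute (q.commute j j') _ _) _

theorem sum_measure : ∑ a, q.measure a = 1 :=
  sum_list_prod_eq_one (fun j b => eigenProj b (pauliOp (q.obs j))) fun _ => eigenProj_add _

end PauliQuestion

/-! ### Honest Pauli strategies from normal form strategies -/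

namespace NormalFormStrategy

variable {k : ℕ} {c : ProtocolCircuit k} (s : NormalFormStrategy c.toVerifier)

/-- The reflection with which a prover answers a question. -/
def reflection (i : Fin k) : ProverQuestion c.ℓ → Matrix (s.D i) (s.D i) ℂ
  | .star => s.P i
  | .query j => s.Q i j
  | .answer j => s.A i j
  | .bot => 1

theorem isReflection_reflection (i : Fin k) (q : ProverQuestion c.ℓ) :
    IsReflection (s.reflection i q) := by
  cases q with
  | star => exact s.P_refl i
  | query j => exact s.Q_refl i j
  | answer j => exact s.A_refl i j
  | bot => exact .one

/-- The registers of the provers: qubits for the Pauli prover, and the registers of the given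
strategy. -/
def honestRegister : Option (Fin k) → Type
  | none => Fin c.size → Bool
  | some i => s.D i

instance : ∀ i, Fintype (s.honestRegister i)
  | none => inferInstanceAs (Fintype (Fin c.size → Bool))
  | some i => s.fintypeD i

instance : ∀ i, DecidableEq (s.honestRegister i)
  | none => inferInstanceAs (DecidableEq (Fin c.size → Bool))
  | some i => s.decEqD i

/-- The measurements of the provers: the Pauli prover is honest, and the other provers measure their
reflections. -/
noncomputable def honestMeasure : ∀ i (q : HPQuestion k c.size (ProverQuestion c.ℓ) i),
    HPAnswer k c.size (ProverQuestion c.ℓ) Bool i q →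
      Matrix (s.honestRegister i) (s.honestRegister i) ℂ
  | none, q, a => PauliQuestion.measure q a
  | some i, q, b => eigenProj (n := s.D i) b (s.reflection i q)

/-- The honest Pauli strategy with the reflections of a normal form strategy, and a given state. The
state is given by its components at the clock times, the qubits of the Pauli prover being split into
the verifier's qubits and the spare qubits. -/
noncomputable def honestStrategy
    (χ : c.Clock → ((c.W → Bool) × (∀ i, s.D i)) × (s.R × (c.Spare → Bool)) → ℂ)
    (hχ : ∑ t, ∑ y, ‖χ t y‖ ^ 2 = 1) : c.HonestStrategy where
  P := s.honestRegister
  R := s.R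
  ψ x := χ x.1 (c.regEquiv (P := s.honestRegister) (Equiv.refl _) s.R x.2)
  norm_ψ := by
    rw [← hχ, Fintype.sum_prod_type]
    exact Finset.sum_congr rfl fun t _ =>
      (c.regEquiv (P := s.honestRegister) (Equiv.refl _) s.R).sum_comp fun y => ‖χ t y‖ ^ 2
  M := s.honestMeasure
  posSemidef
    | none, q, a => PauliQuestion.measure_posSemidef q a
    | some i, q, b =>
      posSemidef_of_isStarProjection
        (eigenProj_isStarProjection (s.isReflection_reflection i q) b)
  sum_eq_one
    | none, q => PauliQuestion.sum_measure q
    | some i, q => (Fintype.sum_bool _).trans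
      ((add_comm _ _).trans (eigenProj_add (s.reflection i q)))

variable (χ : c.Clock → ((c.W → Bool) × (∀ i, s.D i)) × (s.R × (c.Spare → Bool)) → ℂ)
  (hχ : ∑ t, ∑ y, ‖χ t y‖ ^ 2 = 1)

theorem honestStrategy_isHonest : HPStrategy.IsHonest (s.honestStrategy χ hχ) :=
  ⟨Equiv.refl _, fun _ _ => rfl⟩

theorem obs_honestStrategy : HPStrategy.obs (s.honestStrategy χ hχ) = s.ops := by
  unfold HPStrategy.obs ops
  congr 1
  · ext1 i; ext1 j; exact eigenProj_sub (s.Q i j)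
  · ext1 i; exact eigenProj_sub (s.P i)
  · ext1 i; ext1 j; exact eigenProj_sub (s.A i j)

theorem slice_honestStrategy (t : c.Clock) :
    HPStrategy.slice (s.honestStrategy χ hχ) (Equiv.refl _) t = χ t := by
  ext y
  exact congrArg (χ t) (Equiv.apply_symm_apply _ _)

/-- The rejection probability of `honestStrategy`, as a function of the clock components of its
state. -/
noncomputable def rejection
    (χ : c.Clock → ((c.W → Bool) × (∀ i, s.D i)) × (s.R × (c.Spare → Bool)) → ℂ) : ℝ :=
  (12 * (c.size : ℝ))⁻¹ * ∑ t : Fin c.size,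
      ∑ y, ‖(χ t.succ - s.ops.fullOp _ (c.gates.get t) *ᵥ χ t.castSucc) y‖ ^ 2
    + (3 * ((c.nV + k * c.ℓ : ℕ) : ℝ))⁻¹ * ∑ j, ∑ y,
        (if y.1.1 (.inr j) = true then ‖χ 0 y‖ ^ 2 else 0)
    + 3⁻¹ * ∑ y, if y.1.1 c.outWire = false then ‖χ (Fin.last _) y‖ ^ 2 else 0

theorem one_sub_value_honestStrategy :
    1 - (s.honestStrategy χ hχ).value c.honestPauliGame = s.rejection χ := by
  rw [HPStrategy.one_sub_value (s := s.honestStrategy χ hχ) (e := Equiv.refl _) fun _ _ => rfl]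
  simp only [slice_honestStrategy]
  have hA : ∀ t : Fin c.size,
      ∑ y, ‖(χ t.succ - s.ops.fullOp _ (c.gates.get t) *ᵥ χ t.castSucc) y‖ ^ 2 =
        ∑ y, ‖χ t.castSucc y‖ ^ 2 + ∑ y, ‖χ t.succ y‖ ^ 2
          - (star (χ t.castSucc) ⬝ᵥ ((s.ops.gateOp (c.gates.get t) ⊗ₖ
              (1 : Matrix (s.R × (c.Spare → Bool)) (s.R × (c.Spare → Bool)) ℂ)) *ᵥ
                χ t.succ)).re
          - (star (χ t.succ) ⬝ᵥ ((s.ops.gateOp (c.gates.get t) ⊗ₖ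
              (1 : Matrix (s.R × (c.Spare → Bool)) (s.R × (c.Spare → Bool)) ℂ)) *ᵥ
                χ t.castSucc)).re := by
    intro t
    rw [sum_norm_sq_sub_mulVec (s.ops_isReflective.fullOp _)]
    rw [add_comm (∑ y, ‖χ t.succ y‖ ^ 2)]
    rfl
  rw [rejection, Finset.sum_congr rfl fun t _ => hA t, ← obs_honestStrategy s χ hχ]
  rfl

end NormalFormStrategy

/-! ### Completeness -/

section Pad

variable {I R X : Type} [Fintype I] [DecidableEq I] [Fintype R] [DecidableEq R] [Fintype X]
  [DecidableEq X]

/-- The state in which an additional register is in the basis state `x₀`. -/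
def pad (x₀ : X) (u : I × R → ℂ) : I × (R × X) → ℂ :=
  fun y => if y.2.2 = x₀ then u (y.1, y.2.1) else 0

theorem kronecker_one_mulVec (K : Matrix I I ℂ) (v : I × R → ℂ) (y : I × R) :
    ((K ⊗ₖ (1 : Matrix R R ℂ)) *ᵥ v) y = ∑ i, K y.1 i * v (i, y.2) := by
  simp [Matrix.mulVec, dotProduct, Fintype.sum_prod_type, Matrix.one_apply]

theorem kronecker_one_mulVec_pad (K : Matrix I I ℂ) (x₀ : X) (u : I × R → ℂ) :
    (K ⊗ₖ (1 : Matrix (R × X) (R × X) ℂ)) *ᵥ pad x₀ u =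
      pad x₀ ((K ⊗ₖ (1 : Matrix R R ℂ)) *ᵥ u) := by
  ext y
  rw [kronecker_one_mulVec, pad, kronecker_one_mulVec]
  simp only [pad]
  split_ifs <;> simp

theorem sum_pad (x₀ : X) (u : I × R → ℂ) (q : I → Prop) [DecidablePred q] :
    ∑ y, (if q y.1 then ‖pad x₀ u y‖ ^ 2 else 0) = ∑ y, if q y.1 then ‖u y‖ ^ 2 else 0 := by
  symm
  refine Fintype.sum_of_injective (fun y => (y.1, (y.2, x₀))) ?_ _ _ (fun y hy => ?_) fun y => ?_
  · rintro ⟨i, r⟩ ⟨i', r'⟩ h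
    simp only [Prod.mk.injEq, and_true] at h
    rw [h.1, h.2]
  · have h : y.2.2 ≠ x₀ := fun h => hy ⟨(y.1, y.2.1), by rw [← h]⟩
    simp [pad, h]
  · simp [pad]

end Pad

/-- A verifier gate acts on at least two different qubits, and any other gate belongs to a prover,
whose wire is counted in addition to the output qubit. -/
theorem ProtocolCircuit.two_le_size {k : ℕ} (c : ProtocolCircuit k) : 2 ≤ c.size := by
  have hlen : 0 < c.gates.length := c.size_pos
  have hv := c.nV_pos
  have hw := c.wires_le_size
  rw [Verifier.numVerifierWires] at hw
  have hk : 1 ≤ k → 2 ≤ c.size := fun h => by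
    refine le_trans ?_ hw
    omega
  have hne : ∀ u v : c.W, u ≠ v → 2 ≤ c.size := fun u v h => by
    have h' : ((c.ind u : Fin c.size) : ℕ) ≠ c.ind v := fun e => c.ind_ne h (Fin.ext e)
    have h1 := (c.ind u).2
    have h2 := (c.ind v).2
    omega
  cases c.gates.get ⟨0, hlen⟩ with
  | verifier g =>
    cases g with
    | hadamard u v h => exact hne u v h
    | toffoli u v w h _ _ => exact hne u v h
  | query i j => exact hk i.pos
  | answer i j => exact hk i.pos
  | reflect i => exact hk i.pos

namespace NormalFormStrategy

variable {k : ℕ} {c : ProtocolCircuit k} (s : NormalFormStrategy c.toVerifier)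

/-- The history state of a run of the protocol circuit, with all the spare qubits set to `|0⟩`. -/
noncomputable def history (t : c.Clock) :
    ((c.W → Bool) × (∀ i, s.D i)) × (s.R × (c.Spare → Bool)) → ℂ :=
  (((√((c.size : ℝ) + 1) : ℝ) : ℂ)⁻¹) • pad (fun _ => false) (s.ops.run (c.gates.take t) s.initial)

theorem sum_history (t : c.Clock) (q : (c.W → Bool) → Prop) [DecidablePred q] :
    ∑ y, (if q y.1.1 then ‖s.history t y‖ ^ 2 else 0) = ((c.size : ℝ) + 1)⁻¹ *
      ∑ y, if q y.1.1 then ‖s.ops.run (c.gates.take t) s.initial y‖ ^ 2 else 0 := by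
  have ha : ‖(((√((c.size : ℝ) + 1) : ℝ) : ℂ)⁻¹)‖ ^ 2 = ((c.size : ℝ) + 1)⁻¹ := by
    rw [norm_inv, Complex.norm_real, inv_pow, Real.norm_eq_abs, sq_abs,
      Real.sq_sqrt (by positivity)]
  have hs := sum_pad (fun _ : c.Spare => false) (s.ops.run (c.gates.take t) s.initial)
    fun x => q x.1
  rw [← hs, Finset.mul_sum]
  refine Finset.sum_congr rfl fun y _ => ?_
  rw [history, Pi.smul_apply, smul_eq_mul, norm_mul, mul_pow, ha]
  split_ifs <;> simp

theorem sum_norm_sq_history : ∑ t, ∑ y, ‖s.history t y‖ ^ 2 = 1 := by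
  have h : ∀ t, ∑ y, ‖s.history t y‖ ^ 2 = ((c.size : ℝ) + 1)⁻¹ := by
    intro t
    have h := s.sum_history t fun _ => True
    simp only [if_true] at h
    rw [h, s.ops_isReflective.sum_norm_sq_run, s.sum_norm_sq_initial, mul_one]
  have hp : ((c.size : ℝ) + 1) ≠ 0 := by positivity
  rw [Finset.sum_congr rfl fun t _ => h t, Finset.sum_const, Finset.card_univ, Fintype.card_fin,
    nsmul_eq_mul]
  push_cast
  exact mul_inv_cancel₀ hp

theorem history_succ (t : Fin c.size) :
    s.history t.succ = s.ops.fullOp _ (c.gates.get t) *ᵥ s.history t.castSucc := by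
  rw [history, history, Matrix.mulVec_smul, ProverOps.fullOp, kronecker_one_mulVec_pad]
  congr 2
  exact s.ops.run_take_succ c.gates t t.2 s.initial

theorem initial_eq_zero {y : ((c.W → Bool) × (∀ i, s.D i)) × s.R} {j : Fin c.nV ⊕ (Fin k × Fin c.ℓ)}
    (h : y.1.1 (.inr j) = true) : s.initial y = 0 := by
  rw [initial, if_neg]
  intro h'
  rw [h' j] at h
  exact Bool.false_ne_true h

/-- Only Output Check rejects the history state. -/
theorem rejection_history : s.rejection s.history = (1 - s.value) / (3 * ((c.size : ℝ) + 1)) := by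
  have h1 : ∀ t : Fin c.size, ∑ y, ‖(s.history t.succ -
      s.ops.fullOp _ (c.gates.get t) *ᵥ s.history t.castSucc) y‖ ^ 2 = 0 := by
    intro t
    rw [history_succ, sub_self]
    simp
  have h2 : ∀ j, ∑ y, (if y.1.1 (.inr j) = true then ‖s.history 0 y‖ ^ 2 else 0) = 0 := by
    intro j
    rw [s.sum_history 0 fun x => x (.inr j) = true]
    convert mul_zero _
    rw [Finset.sum_eq_zero fun y _ => ?_]
    split_ifs with h
    · have e : s.ops.run (c.gates.take ((0 : c.Clock) : ℕ)) s.initial = s.initial := rfl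
      rw [e, s.initial_eq_zero h, norm_zero, zero_pow two_ne_zero]
    · rfl
  have e : c.gates.take ((Fin.last c.size : c.Clock) : ℕ) = c.gates := List.take_length
  have h3 := s.sum_history (Fin.last _) fun x => x c.outWire = false
  rw [e, ← s.final_eq] at h3
  rw [rejection, Finset.sum_eq_zero fun t _ => h1 t, Finset.sum_eq_zero fun j _ => h2 j, h3,
    s.value_eq_one_sub]
  have hp : ((c.size : ℝ) + 1) ≠ 0 := by positivity
  field_simp
  ring

/-- A basis state at time `0` in which all the qubits of the Pauli prover are set to `|1⟩`. -/
noncomputable def badState (d : ∀ i, s.D i) (r : s.R) (t : c.Clock) :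
    ((c.W → Bool) × (∀ i, s.D i)) × (s.R × (c.Spare → Bool)) → ℂ :=
  if t = 0 then Pi.single ((fun _ => true, d), (r, fun _ => true)) 1 else 0

theorem sum_norm_sq_badState (d : ∀ i, s.D i) (r : s.R) :
    ∑ t, ∑ y, ‖s.badState d r t y‖ ^ 2 = 1 := by
  rw [Fintype.sum_eq_single 0]
  · rw [Fintype.sum_eq_single ((fun _ => true, d), (r, fun _ => true))]
    · simp [badState]
    · intro y hy
      simp [badState, hy]
  · intro t ht
    simp [badState, ht]

/-- Input Check rejects the bad state with certainty. -/
theorem le_rejection_badState (d : ∀ i, s.D i) (r : s.R) : 3⁻¹ ≤ s.rejection (s.badState d r) := by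
  have h : ∀ j, ∑ y, (if y.1.1 (.inr j) = true then ‖s.badState d r 0 y‖ ^ 2 else 0) = 1 := by
    intro j
    rw [Fintype.sum_eq_single ((fun _ => true, d), (r, fun _ => true))]
    · simp [badState]
    · intro y hy
      simp [badState, hy]
  have hm : ((c.nV + k * c.ℓ : ℕ) : ℝ) ≠ 0 := Nat.cast_ne_zero.2 (by have := c.nV_pos; omega)
  rw [rejection, Finset.sum_congr rfl fun j _ => h j, Finset.sum_const, Finset.card_univ,
    Fintype.card_sum, Fintype.card_prod, Fintype.card_fin, Fintype.card_fin, Fintype.card_fin,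
    nsmul_eq_mul, mul_one]
  have e : (3 * ((c.nV + k * c.ℓ : ℕ) : ℝ))⁻¹ * ((c.nV + k * c.ℓ : ℕ) : ℝ) = 3⁻¹ := by
    field_simp
  rw [e]
  have h1 : 0 ≤ (12 * (c.size : ℝ))⁻¹ * ∑ t : Fin c.size, ∑ y, ‖(s.badState d r t.succ -
      s.ops.fullOp _ (c.gates.get t) *ᵥ s.badState d r t.castSucc) y‖ ^ 2 :=
    mul_nonneg (by positivity) (Finset.sum_nonneg fun t _ => sum_norm_sq_nonneg _)
  have h2 := sum_norm_sq_ite_nonneg (fun y : ((c.W → Bool) × (∀ i, s.D i)) ×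
    (s.R × (c.Spare → Bool)) => y.1.1 c.outWire = false) (s.badState d r (Fin.last _))
  linarith

theorem history_eq_zero_or_badState_eq_zero (d : ∀ i, s.D i) (r : s.R) (t : c.Clock) (y) :
    s.history t y = 0 ∨ s.badState d r t y = 0 := by
  by_cases ht : t = 0
  · by_cases hy : y = ((fun _ => true, d), (r, fun _ => true))
    · left
      subst ht hy
      rw [history, Pi.smul_apply, pad]
      have e : s.ops.run (c.gates.take ((0 : c.Clock) : ℕ)) s.initial = s.initial := rfl
      rw [e, s.initial_eq_zero (j := .inl ⟨0, c.nV_pos⟩) rfl]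
      simp
    · right
      simp [badState, ht, hy]
  · right
    simp [badState, ht]

theorem exists_basis : Nonempty ((∀ i, s.D i) × s.R) := by
  by_contra h
  rw [not_nonempty_iff] at h
  have : IsEmpty ((Fin c.nC → Bool) × (∀ i, s.D i) × s.R) := ⟨fun x => h.false x.2⟩
  have h1 := s.norm_ψ
  rw [Finset.univ_eq_empty, Finset.sum_empty] at h1
  exact zero_ne_one h1

/-- Superpositions of the history state and a bad state have all the rejection probabilities in
between. -/
theorem exists_isHonest_value_eq {x : ℝ} (h1 : (1 - s.value) / (3 * ((c.size : ℝ) + 1)) ≤ x)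
    (h2 : x ≤ 3⁻¹) :
    ∃ s' : c.HonestStrategy, HPStrategy.IsHonest s' ∧ s'.value c.honestPauliGame = 1 - x := by
  obtain ⟨d, r⟩ := s.exists_basis
  let χ : ℝ → c.Clock → ((c.W → Bool) × (∀ i, s.D i)) × (s.R × (c.Spare → Bool)) → ℂ :=
    fun θ t => ((Real.cos θ : ℝ) : ℂ) • s.history t + ((Real.sin θ : ℝ) : ℂ) • s.badState d r t
  -- The two states have disjoint supports.
  have hχ : ∀ θ, ∑ t, ∑ y, ‖χ θ t y‖ ^ 2 = 1 := by
    intro θ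
    have h : ∀ t y, ‖χ θ t y‖ ^ 2 =
        Real.cos θ ^ 2 * ‖s.history t y‖ ^ 2 + Real.sin θ ^ 2 * ‖s.badState d r t y‖ ^ 2 := by
      intro t y
      simp only [χ, Pi.add_apply, Pi.smul_apply, smul_eq_mul]
      rcases s.history_eq_zero_or_badState_eq_zero d r t y with h | h <;>
        simp [h, mul_pow, ← Complex.ofReal_cos, ← Complex.ofReal_sin, -Complex.ofReal_cos,
          -Complex.ofReal_sin, Complex.norm_real]
    simp only [h, Finset.sum_add_distrib, ← Finset.mul_sum, s.sum_norm_sq_history,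
      s.sum_norm_sq_badState]
    rw [mul_one, mul_one, Real.cos_sq_add_sin_sq]
  have hc : Continuous fun θ => s.rejection (χ θ) := by
    have hχc : ∀ t, Continuous fun θ => χ θ t := fun t => by fun_prop
    have hy : ∀ t y, Continuous fun θ => χ θ t y := fun t y => (continuous_apply y).comp (hχc t)
    unfold rejection
    refine ((continuous_const.mul (continuous_finsetSum _ fun t _ =>
      continuous_finsetSum _ fun y _ => ?_)).add (continuous_const.mul (continuous_finsetSum _
      fun j _ => continuous_finsetSum _ fun y _ => ?_))).add (continuous_const.mul
      (continuous_finsetSum _ fun y _ => ?_))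
    · exact (((continuous_apply y).comp ((hχc _).sub
        (continuous_const.matrix_mulVec (hχc _)))).norm).pow 2
    · split_ifs
      · exact (hy _ _).norm.pow 2
      · exact continuous_const
    · split_ifs
      · exact (hy _ _).norm.pow 2
      · exact continuous_const
  have h0 : s.rejection (χ 0) ≤ x := by
    have e : χ 0 = s.history := by
      ext t y
      simp [χ]
    rwa [e, rejection_history]
  have hπ : x ≤ s.rejection (χ (Real.pi / 2)) := by
    have e : χ (Real.pi / 2) = s.badState d r := by
      ext t y
      simp only [χ, Real.cos_pi_div_two, Real.sin_pi_div_two]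
      simp
    rw [e]
    exact h2.trans (s.le_rejection_badState d r)
  obtain ⟨θ, hθ⟩ := mem_range_of_exists_le_of_exists_ge hc ⟨0, h0⟩ ⟨_, hπ⟩
  refine ⟨s.honestStrategy (χ θ) (hχ θ), s.honestStrategy_isHonest _ _, ?_⟩
  have h := s.one_sub_value_honestStrategy (χ θ) (hχ θ)
  change s.rejection (χ θ) = x at hθ
  linarith

end NormalFormStrategy

/-- The completeness bound. The history state of a nearly optimal strategy does better, as only a
third of the tests are Output Checks. If `γ ≤ ω`, then the required rejection probability is at most
`1 / (p + 1) ≤ 1 / 3`, so that it is attained by a superposition with a bad state. -/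
theorem ProtocolCircuit.exists_honestStrategy {k : ℕ} (c : ProtocolCircuit k) {γ : ℝ}
    (hγ : 0 < γ) :
    ∃ s : c.HonestStrategy, HPStrategy.IsHonest s ∧
      1 - (1 - c.omega + γ) / ((c.size : ℝ) + 1) ≤ s.value c.honestPauliGame ∧
      (γ ≤ c.omega → s.value c.honestPauliGame = 1 - (1 - c.omega + γ) / ((c.size : ℝ) + 1)) := by
  obtain ⟨s, hs⟩ := Verifier.exists_lt_value c.toVerifier (sub_lt_self c.omega hγ)
  have hp : (2 : ℝ) ≤ c.size := by exact_mod_cast c.two_le_size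
  have hv := s.value_le_one
  have h1 : (1 - s.value) / (3 * ((c.size : ℝ) + 1)) ≤ (1 - c.omega + γ) / ((c.size : ℝ) + 1) := by
    rw [div_le_div_iff₀ (by positivity) (by positivity)]
    nlinarith
  by_cases h : γ ≤ c.omega
  · have h2 : (1 - c.omega + γ) / ((c.size : ℝ) + 1) ≤ 3⁻¹ := by
      rw [div_le_iff₀ (by positivity)]
      linarith
    obtain ⟨s', hs', e⟩ := s.exists_isHonest_value_eq h1 h2
    exact ⟨s', hs', e.ge, fun _ => e⟩
  · have h2 : (1 - s.value) / (3 * ((c.size : ℝ) + 1)) ≤ 3⁻¹ := by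
      rw [div_le_iff₀ (by positivity)]
      have := s.value_nonneg
      linarith
    obtain ⟨s', hs', e⟩ := s.exists_isHonest_value_eq le_rfl h2
    exact ⟨s', hs', by rw [e]; linarith, fun h' => absurd h' h⟩

end ENL

theorem mainTheorem9 :
    ∃ α β : ℝ, 1 ≤ α ∧ 0 < β ∧
      ∀ (k : ℕ) (G : ENL.GTM k) (n : ℕ), 1 ≤ n →
        (∀ γ : ℝ, 0 < γ →
          ∃ s : (G.circuit (2 ^ n)).HonestStrategy, ENL.HPStrategy.IsHonest s ∧
            1 - (1 - (G.circuit (2 ^ n)).omega + γ) / (((G.circuit (2 ^ n)).size : ℝ) + 1)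
              ≤ s.value (G.circuit (2 ^ n)).honestPauliGame ∧
            (γ ≤ (G.circuit (2 ^ n)).omega →
              s.value (G.circuit (2 ^ n)).honestPauliGame =
                1 - (1 - (G.circuit (2 ^ n)).omega + γ) /
                  (((G.circuit (2 ^ n)).size : ℝ) + 1))) ∧
        (∀ s : (G.circuit (2 ^ n)).HonestStrategy, ENL.HPStrategy.IsHonest s →
          s.value (G.circuit (2 ^ n)).honestPauliGame ≤
            1 - ((1 - (G.circuit (2 ^ n)).omega) /
              (β * ((G.circuit (2 ^ n)).size : ℝ))) ^ α) := by
  -- The soundness bound loses a factor `1000 p³ = (10 p)³`.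
  refine ⟨3, 10, by norm_num, by norm_num, fun k G n _ => ⟨fun γ hγ => ?_, fun s hs => ?_⟩⟩
  · exact (G.circuit (2 ^ n)).exists_honestStrategy hγ
  · exact hs.value_le
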